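/- **Conventions.** Graphs are finite and simple. Let $\mathcal M$ be either the 3-dimensional generic rigidity matroid $\mathcal R_3$ or Whiteley's cofactor matroid $\mathcal M_{K_5}$ (of bivariate $C^1$ splines of degree 2, i.e. the generic matroid of the rows with $((\Delta x)^2,\Delta x\Delta y,(\Delta y)^2)$ and its negative at the two endpoints of an edge), on the edges of complete graphs. Rank, independence and circuits of graphs refer to their edge sets in $\mathcal M$. A *nonedge* is a pair of distinct nonadjacent vertices; a nonedge $f$ of $G$ is *implied* if $G\cup f$ contains a circuit that includes $f$. A *nucleation* of $G$ is a rigid subgraph on $n\ge 5$ vertices (rigid: of rank $3n-6$); $G$ is *nucleation-free* if it has none. **Covers.** A *2-thin cover* of $G$ is a collection $\mathcal X$ of subsets of $V(G)$ (*clusters*), each of size at least $2$, any two distinct ones meeting in at most two vertices and neither containing the other, such that the endpoints of each edge lie in a common cluster. Its *shared set* $S(\mathcal X)$ is the set of all pairs $\{u,v\}$, $u\neq v$, of the form $X\cap Y$ with $X\ne Y$ in $\mathcal X$; $\mathcal X$ is *independent* if $S(\mathcal X)$ is. For a set $T$ of pairs put $$IE_T(G,\mathcal X)=\sum_{X\in\mathcal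 X}\operatorname{rank}\big((G\cup T)[X]\big)-\sum_{e\in T}\big(d(\mathcal X,e)-1\big),$$ where $d(\mathcal X,e)$ is the number of clusters containing $e$, and $IE(G,\mathcal X)=IE_{S(\mathcal X)}(G,\mathcal X)$. **Safe nonedge-split.** A *nonedge-split* of $G$ at a nonedge $(a,b)$ deletes $a,b$ and adds pairwise nonadjacent new vertices $a_1,a_2,b_1,b_2$, where the neighbourhoods of $a_1,a_2$ partition that of $a$ and the neighbourhoods of $b_1,b_2$ partition that of $b$ (arbitrarily, empty parts allowed); the result is the *split graph* $G^s$. For a 2-thin cover $\mathcal X$ of $G$ and $X\in\mathcal X$ let $X'$ arise from $X$ by replacing $a$, if $a\in X$, by those of $a_1,a_2$ that have a neighbour in $X\setminus\{a,b\}$ in $G^s$, and likewise $b$ by those of $b_1,b_2$. The split is *safe* on $(G,\mathcal X)$ if $(a,b)\in S(\mathcal X)$ and: (i) $X'$ contains neither $\{a_1,a_2\}$ nor $\{b_1,b_2\}$ whenever $X\in\mathcal X$ contains a nonedge of $G$ belonging to $S(\mathcal X)$; (ii) $X'\cap\{a_1,a_2\}=Y'\cap\{a_1,a_2\}$ whenever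 $X\neq Y$ in $\mathcal X$, $X\cap Y=\{a,u\}$, $u\ne b$ and $(a,u)$ is a nonedge of $G$; and the same with $a$ and $b$ interchanged. The *safe split cover* $\mathcal X^s$ of $G^s$ consists of those $X'$ with $|X'|>2$ that contain neither $\{a_1,a_2\}$ nor $\{b_1,b_2\}$, and of the endpoint pairs of all edges of $G^s$ contained in no such $X'$. The *key gluing pairs* of $G^s$ are the pairs of distinct vertices of $\{a_1,a_2,b_1,b_2\}$ contained in a cluster of $\mathcal X^s$. $G$ is a *safe base graph*, with cover $\mathcal X$ and this split, if moreover $G$ and $\mathcal X$ are independent and $\operatorname{rank}(G)=IE(G,\mathcal X)$. **Safe ear.** A graph $H$ with a set $B$ of *gluing vertices* is a *safe ear*, with *safe ear cover* $\mathcal X^H$, if $\mathcal X^H$ is an independent 2-thin cover of $H$ such that, with the *key gluing pairs* of $H$ being the pairs of distinct vertices of $B$ contained in a cluster of $\mathcal X^H$ and $F_H$ the set of them: each cluster contains at most two vertices of $B$; $S(\mathcal X^H)$ together with all pairs of distinct vertices of $B$ is independent; and $\operatorname{rank}(H)=IE_{S(\mathcal X^H)\cup F_H}(H,\mathcal X^H)-1$.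 **Safe split-and-glue.** It consists of a safe base graph $G$ (with cover and safe nonedge-split as above), a safe ear $H$ vertex-disjoint from it, a set $A\subseteq\{a_1,a_2,b_1,b_2\}$ containing the endpoints of all key gluing pairs of $G^s$, and a bijection $A\to B$ under which the key gluing pairs of $G^s$ correspond exactly to those of $H$. It yields the graph $G^s:H$ obtained from $G^s$ and $H$ by identifying $A$ with $B$ through the bijection. **Double-butterfly.** A *butterfly* is $K_5$ minus two non-incident edges. A *double-butterfly* consists of two butterflies, on $\{a'_1,b'_1,c,u,v\}$ with nonedges $(a'_1,b'_1),(u,v)$ and on $\{a'_2,b'_2,c',u,v\}$ with nonedges $(a'_2,b'_2),(u,v)$, that share exactly $u,v$; its gluing vertices are $a'_1,b'_1,a'_2,b'_2$. **Corollary 3.9.** If in a safe split-and-glue the split graph $G^s$ is nucleation-free and the ear $H$ is a double-butterfly (with its four gluing vertices), then $G^s:H$ is independent, is nucleation-free, and has an implied nonedge. -/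

import Mathlib

namespace SplitGlue

/-! ### The two rigidity matroids -/

/-- The two matroids on the edges of complete graphs that are considered: the 3-dimensional generic
rigidity matroid `R3`, and Whiteley's cofactor matroid `MK5` (of bivariate `C^1` splines of
degree 2), which is the maximal matroid in which all copies of `K_5` are circuits. -/
inductive RigidityMatroid
  | R3
  | MK5

/-- The dimension of the space in which the vertices of a framework are placed. -/
def RigidityMatroid.dim : RigidityMatroid → ℕ
  | .R3 => 3
  | .MK5 => 2

/-- The vector in `ℝ³` that a bar with endpoints `p` and `q` contributes to the rigidity matrix
(`p - q`), respectively to the cofactor matrix (`((Δx)², Δx Δy, (Δy)²)`). -/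
def RigidityMatroid.dir : (M : RigidityMatroid) → (Fin M.dim → ℝ) → (Fin M.dim → ℝ) → (Fin 3 → ℝ)
  | .R3, p, q => fun k => p k - q k
  | .MK5, p, q =>
      let x : ℝ := p (0 : Fin 2) - q (0 : Fin 2)
      let y : ℝ := p (1 : Fin 2) - q (1 : Fin 2)
      ![x ^ 2, x * y, y ^ 2]

open Classical in
/-- The row of the rigidity (or cofactor) matrix of the framework `p` for the pair `i`, `j`: it has
`dir (p i) (p j)` in the three columns of `i`, its negative in the three columns of `j`, and zeros
elsewhere. Exchanging `i` and `j` changes the row at most by a sign. -/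
noncomputable def edgeRow {V : Type*} (M : RigidityMatroid) (p : V → Fin M.dim → ℝ) (i j : V) :
    V → Fin 3 → ℝ :=
  Pi.single i (M.dir (p i) (p j)) - Pi.single j (M.dir (p i) (p j))

/-- The rank of the rigidity (or cofactor) matrix of the framework of `G` placed at `p`. -/
noncomputable def frameworkRank {V : Type*} (M : RigidityMatroid) (G : SimpleGraph V)
    (p : V → Fin M.dim → ℝ) : ℕ :=
  Module.finrank ℝ (Submodule.span ℝ {r | ∃ i j, G.Adj i j ∧ r = edgeRow M p i j})

/-- The rank of the edge set of `G` in the matroid `M`, i.e. the rank of the matrix of a generic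
framework of `G`, which is the maximum over all frameworks. -/
noncomputable def rank {V : Type*} (M : RigidityMatroid) (G : SimpleGraph V) : ℕ :=
  ⨆ p : V → Fin M.dim → ℝ, frameworkRank M G p

/-- `G` is independent: its edge set is independent in the matroid. -/
def Independent {V : Type*} (M : RigidityMatroid) (G : SimpleGraph V) : Prop :=
  rank M G = G.edgeSet.ncard

/-- `C` is a circuit: its edge set is a minimal dependent set of the matroid. -/
def IsCircuit {V : Type*} (M : RigidityMatroid) (C : SimpleGraph V) : Prop :=
  ¬ Independent M C ∧ ∀ D : SimpleGraph V, D < C → Independent M D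

/-- The pair `x`, `y` is an implied nonedge of `G`: it is a nonedge, and `G` together with this
pair contains a circuit that includes the pair. -/
def IsImpliedNonedge {V : Type*} (M : RigidityMatroid) (G : SimpleGraph V) (x y : V) : Prop :=
  x ≠ y ∧ ¬ G.Adj x y ∧
    ∃ C : SimpleGraph V, C ≤ G ⊔ SimpleGraph.edge x y ∧ C.Adj x y ∧ IsCircuit M C

/-- A nucleation of `G` is a rigid subgraph on `n ≥ 5` vertices; rigidity of a graph on `n ≥ 3`
vertices means that its rank is `3 n - 6`. -/
def IsNucleation {V : Type*} (M : RigidityMatroid) {G : SimpleGraph V} (N : G.Subgraph) : Prop :=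
  5 ≤ N.verts.ncard ∧ rank M N.spanningCoe + 6 = 3 * N.verts.ncard

/-- `G` has no nucleation. -/
def NucleationFree {V : Type*} (M : RigidityMatroid) (G : SimpleGraph V) : Prop :=
  ∀ N : G.Subgraph, ¬ IsNucleation M N

/-! ### 2-thin covers and inclusion-exclusion counts -/

/-- `𝒳` is a 2-thin cover of `G`. -/
structure IsTwoThinCover {V : Type*} [DecidableEq V] (G : SimpleGraph V)
    (𝒳 : Finset (Finset V)) : Prop where
  two_le : ∀ X ∈ 𝒳, 2 ≤ X.card
  inter_le : ∀ X ∈ 𝒳, ∀ Y ∈ 𝒳, X ≠ Y → (X ∩ Y).card ≤ 2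
  not_subset : ∀ X ∈ 𝒳, ∀ Y ∈ 𝒳, X ≠ Y → ¬ X ⊆ Y
  covers : ∀ x y, G.Adj x y → ∃ X ∈ 𝒳, x ∈ X ∧ y ∈ X

/-- The shared set `S(𝒳)`, as a graph: the pairs that are the intersection of two clusters. -/
def sharedGraph {V : Type*} [DecidableEq V] (𝒳 : Finset (Finset V)) : SimpleGraph V where
  Adj u v := u ≠ v ∧ ∃ X ∈ 𝒳, ∃ Y ∈ 𝒳, X ≠ Y ∧ X ∩ Y = {u, v}
  symm := ⟨fun u v h => ⟨h.1.symm, by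
    obtain ⟨X, hX, Y, hY, hne, he⟩ := h.2
    exact ⟨X, hX, Y, hY, hne, by rw [he, Finset.pair_comm]⟩⟩⟩
  loopless := ⟨fun u h => h.1 rfl⟩

/-- The pairs of distinct elements of `A` that are contained in some cluster of `𝒳`, as a graph. For
a set `A` of candidate gluing vertices these are the key gluing pairs. -/
def keyPairs {V : Type*} (𝒳 : Finset (Finset V)) (A : Finset V) : SimpleGraph V where
  Adj u v := u ≠ v ∧ u ∈ A ∧ v ∈ A ∧ ∃ X ∈ 𝒳, u ∈ X ∧ v ∈ X
  symm := ⟨fun u v h => by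
    obtain ⟨hne, hu, hv, X, hX, huX, hvX⟩ := h
    exact ⟨hne.symm, hv, hu, X, hX, hvX, huX⟩⟩
  loopless := ⟨fun u h => h.1 rfl⟩

open Classical in
/-- `d(𝒳, e)`: the number of clusters of `𝒳` that contain both endpoints of `e`. -/
noncomputable def clusterDegree {V : Type*} (𝒳 : Finset (Finset V)) (e : Sym2 V) : ℕ :=
  (𝒳.filter fun X => ∀ v ∈ e, v ∈ X).card

/-- The sum of the ranks of the graphs `(G ∪ T)[X]` over the clusters `X` of `𝒳`, minus the sum of
`d(𝒳, e) - 1` over the pairs `e` in `T`. -/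
noncomputable def ieCountWith {V : Type*} (M : RigidityMatroid) (G : SimpleGraph V)
    (𝒳 : Finset (Finset V)) (T : SimpleGraph V) : ℤ :=
  (∑ X ∈ 𝒳, (rank M ((G ⊔ T).induce (X : Set V)).spanningCoe : ℤ)) -
    ∑ᶠ e ∈ T.edgeSet, ((clusterDegree 𝒳 e : ℤ) - 1)

/-- The inclusion-exclusion rank count `IE(G, 𝒳)`. -/
noncomputable def ieCount {V : Type*} [DecidableEq V] (M : RigidityMatroid) (G : SimpleGraph V)
    (𝒳 : Finset (Finset V)) : ℤ :=
  ieCountWith M G 𝒳 (sharedGraph 𝒳)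

/-- The count `IE'(G, 𝒳)`: the key gluing pairs, for the gluing vertices `A`, are added to the
shared set in both sums. -/
noncomputable def ieCount' {V : Type*} [DecidableEq V] (M : RigidityMatroid) (G : SimpleGraph V)
    (𝒳 : Finset (Finset V)) (A : Finset V) : ℤ :=
  ieCountWith M G 𝒳 (sharedGraph 𝒳 ⊔ keyPairs 𝒳 A)

/-! ### Nonedge-splits -/

/-- The vertices after a nonedge-split: those other than `a`, `b`, and four new ones. -/
abbrev SplitVertex {V : Type*} (a b : V) : Type _ := {x : V // x ≠ a ∧ x ≠ b} ⊕ (Fin 2 ⊕ Fin 2)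

/-- The new vertices `a₁`, `a₂` (for `i = 0`, `1`). -/
abbrev newA {V : Type*} (a b : V) (i : Fin 2) : SplitVertex a b := Sum.inr (Sum.inl i)

/-- The new vertices `b₁`, `b₂` (for `i = 0`, `1`). -/
abbrev newB {V : Type*} (a b : V) (i : Fin 2) : SplitVertex a b := Sum.inr (Sum.inr i)

/-- All four new vertices. -/
def newVertices {V : Type*} [DecidableEq V] (a b : V) : Finset (SplitVertex a b) :=
  {newA a b 0, newA a b 1, newB a b 0, newB a b 1}

/-- Adjacency of a new vertex and an old vertex: a neighbour `x` of `a` becomes a neighbour of the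
copy of `a` with index `α x`, and a neighbour `x` of `b` one of the copy of `b` with index `β x`. -/
def attached {V : Type*} (G : SimpleGraph V) (a b : V) (α β : V → Fin 2) :
    Fin 2 ⊕ Fin 2 → V → Prop
  | .inl i, x => G.Adj a x ∧ α x = i
  | .inr i, x => G.Adj b x ∧ β x = i

/-- The split graph `G^s` of the nonedge-split of `G` at the nonedge `a`, `b`; the functions `α` and
`β` encode the (arbitrary) partitions of the neighbourhoods of `a` and of `b` into two, possibly
empty, parts. -/
def splitGraph {V : Type*} (G : SimpleGraph V) (a b : V) (α β : V → Fin 2) :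
    SimpleGraph (SplitVertex a b) where
  Adj
    | .inl x, .inl y => G.Adj x y
    | .inl x, .inr n => attached G a b α β n x
    | .inr n, .inl x => attached G a b α β n x
    | .inr _, .inr _ => False
  symm := ⟨by
    rintro (x | m) (y | n) h
    · exact SimpleGraph.Adj.symm h
    · exact h
    · exact h
    · exact h⟩
  loopless := ⟨by
    rintro (x | m) h
    · exact G.loopless.irrefl _ h
    · exact h⟩

/-- Membership in the image `X'` of a cluster `X`: vertices other than `a`, `b` stay; if `a ∈ X`, then
`a` is replaced by those of its copies that have a neighbour in `X`, and likewise for `b`. -/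
def MemSplitCluster {V : Type*} (G : SimpleGraph V) (a b : V) (α β : V → Fin 2) (X : Finset V) :
    SplitVertex a b → Prop
  | .inl x => (x : V) ∈ X
  | .inr (.inl i) => a ∈ X ∧ ∃ x ∈ X, attached G a b α β (.inl i) x
  | .inr (.inr i) => b ∈ X ∧ ∃ x ∈ X, attached G a b α β (.inr i) x

open Classical in
/-- The image `X'` in the split graph of a cluster `X`. -/
noncomputable def splitCluster {V : Type*} [Fintype V] (G : SimpleGraph V) (a b : V)
    (α β : V → Fin 2) (X : Finset V) : Finset (SplitVertex a b) :=
  Finset.univ.filter (MemSplitCluster G a b α β X)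

/-- `X'` contains both copies of `a` or both copies of `b`. -/
def HasBothCopies {V : Type*} {a b : V} (X' : Finset (SplitVertex a b)) : Prop :=
  (newA a b 0 ∈ X' ∧ newA a b 1 ∈ X') ∨ (newB a b 0 ∈ X' ∧ newB a b 1 ∈ X')

open Classical in
/-- The clusters of the safe split cover of size greater than two. -/
noncomputable def bigSplitClusters {V : Type*} [Fintype V] (G : SimpleGraph V)
    (𝒳 : Finset (Finset V)) (a b : V) (α β : V → Fin 2) : Finset (Finset (SplitVertex a b)) :=
  (𝒳.image (splitCluster G a b α β)).filter fun X' => 2 < X'.card ∧ ¬ HasBothCopies X'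

open Classical in
/-- The safe split cover `𝒳^s`: the big clusters, and the endpoint pairs of all edges of the split
graph that are not contained in a big cluster. -/
noncomputable def safeSplitCover {V : Type*} [Fintype V] (G : SimpleGraph V)
    (𝒳 : Finset (Finset V)) (a b : V) (α β : V → Fin 2) : Finset (Finset (SplitVertex a b)) :=
  bigSplitClusters G 𝒳 a b α β ∪
    Finset.univ.filter fun P => ∃ s t, (splitGraph G a b α β).Adj s t ∧ P = {s, t} ∧
      ∀ X' ∈ bigSplitClusters G 𝒳 a b α β, ¬ P ⊆ X'

/-- The nonedge-split of `G` at `a`, `b` with partitions `α`, `β` is a safe nonedge-split on the pair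
`(G, 𝒳)`. -/
structure IsSafeNonedgeSplit {V : Type*} [Fintype V] [DecidableEq V] (G : SimpleGraph V)
    (𝒳 : Finset (Finset V)) (a b : V) (α β : V → Fin 2) : Prop where
  cover : IsTwoThinCover G 𝒳
  nonedge : ¬ G.Adj a b
  shared : (sharedGraph 𝒳).Adj a b
  not_both : ∀ X ∈ 𝒳, (∃ u ∈ X, ∃ v ∈ X, (sharedGraph 𝒳).Adj u v ∧ ¬ G.Adj u v) →
    ¬ HasBothCopies (splitCluster G a b α β X)
  agree_a : ∀ X ∈ 𝒳, ∀ Y ∈ 𝒳, X ≠ Y → ∀ u, u ≠ a → u ≠ b → X ∩ Y = {a, u} → ¬ G.Adj a u →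
    ∀ i, newA a b i ∈ splitCluster G a b α β X ↔ newA a b i ∈ splitCluster G a b α β Y
  agree_b : ∀ X ∈ 𝒳, ∀ Y ∈ 𝒳, X ≠ Y → ∀ u, u ≠ a → u ≠ b → X ∩ Y = {b, u} → ¬ G.Adj b u →
    ∀ i, newB a b i ∈ splitCluster G a b α β X ↔ newB a b i ∈ splitCluster G a b α β Y

/-- `G` is a safe base graph, as witnessed by the cover `𝒳` and the safe nonedge-split given by `a`,
`b`, `α`, `β`. -/
structure IsSafeBase {V : Type*} [Fintype V] [DecidableEq V] (M : RigidityMatroid)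
    (G : SimpleGraph V) (𝒳 : Finset (Finset V)) (a b : V) (α β : V → Fin 2) : Prop where
  indep : Independent M G
  cover_indep : Independent M (sharedGraph 𝒳)
  rank_eq : (rank M G : ℤ) = ieCount M G 𝒳
  safe_split : IsSafeNonedgeSplit G 𝒳 a b α β

/-! ### Ears and glues -/

/-- `H` with gluing vertices `B` is a safe ear, as witnessed by the safe ear cover `𝒴`. -/
structure IsSafeEar {W : Type*} [Fintype W] [DecidableEq W] (M : RigidityMatroid) (H : SimpleGraph W)
    (𝒴 : Finset (Finset W)) (B : Finset W) : Prop where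
  cover : IsTwoThinCover H 𝒴
  cover_indep : Independent M (sharedGraph 𝒴)
  card_inter_le : ∀ Y ∈ 𝒴, (Y ∩ B).card ≤ 2
  indep_clique : Independent M
    (sharedGraph 𝒴 ⊔ ((⊤ : SimpleGraph W).induce (B : Set W)).spanningCoe)
  rank_eq : (rank M H : ℤ) = ieCount' M H 𝒴 B - 1

/-- The vertices of a glue: those of the first graph, and the vertices of the second graph that are
not gluing vertices. -/
abbrev GlueVertex (U : Type*) {W : Type*} (B : Finset W) : Type _ := U ⊕ {w : W // w ∉ B}

open Classical in
/-- The inclusion of the vertices of the second graph into those of the glue. -/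
noncomputable def glueRight {U W : Type*} {A : Finset U} {B : Finset W} (φ : A ≃ B) (w : W) :
    GlueVertex U B :=
  if h : w ∈ B then Sum.inl (φ.symm ⟨w, h⟩ : U) else Sum.inr ⟨w, h⟩

/-- The glue `G:H` that identifies the gluing vertices `A` of `G` with the gluing vertices `B` of `H`
through the bijection `φ`. -/
noncomputable def glue {U W : Type*} (G : SimpleGraph U) (H : SimpleGraph W) {A : Finset U}
    {B : Finset W} (φ : A ≃ B) : SimpleGraph (GlueVertex U B) :=
  G.map Sum.inl ⊔ H.map (glueRight φ)

/-- A safe split-and-glue on the base graph `G` and the ear `H`: a safe nonedge-split on `(G, 𝒳)`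
followed by a glue of the split graph and `H` along their gluing vertices `A` and `B` that identifies
the key gluing pairs of the split graph with those of `H`. -/
structure IsSafeSplitAndGlue {V W : Type*} [Fintype V] [DecidableEq V] [Fintype W]
    [DecidableEq W] (M : RigidityMatroid) (G : SimpleGraph V) (𝒳 : Finset (Finset V)) (a b : V) (α β : V → Fin 2)
    (H : SimpleGraph W) (𝒴 : Finset (Finset W)) {A : Finset (SplitVertex a b)} {B : Finset W}
    (φ : A ≃ B) : Prop where
  base : IsSafeBase M G 𝒳 a b α β
  ear : IsSafeEar M H 𝒴 B
  gluing_subset : A ⊆ newVertices a b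
  key_mem : ∀ s t, (keyPairs (safeSplitCover G 𝒳 a b α β) (newVertices a b)).Adj s t →
    s ∈ A ∧ t ∈ A
  key_iff : ∀ s t : A, (keyPairs (safeSplitCover G 𝒳 a b α β) (newVertices a b)).Adj s t ↔
    (keyPairs 𝒴 B).Adj (φ s) (φ t)

/-- The butterfly: `K_5` minus two non-incident edges. -/
def butterfly : SimpleGraph (Fin 5) :=
  (⊤ : SimpleGraph (Fin 5)).deleteEdges {s(0, 1), s(3, 4)}

/-- The double-butterfly with vertices `a'₁ = 0`, `b'₁ = 1`, `c = 2`, `a'₂ = 3`, `b'₂ = 4`, `c' = 5`,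
`u = 6`, `v = 7`: two butterflies, on `a'₁, b'₁, c, u, v` and on `a'₂, b'₂, c', u, v`, glued together
on the nonedge `u`, `v`. -/
def doubleButterfly : SimpleGraph (Fin 8) :=
  butterfly.map ![0, 1, 2, 6, 7] ⊔ butterfly.map ![3, 4, 5, 6, 7]

/-- `H` is a double-butterfly whose gluing vertices `a'₁`, `b'₁`, `a'₂`, `b'₂` form the set `B`. -/
def IsDoubleButterfly {W : Type*} [DecidableEq W] (H : SimpleGraph W) (B : Finset W) : Prop :=
  ∃ e : doubleButterfly ≃g H, B = ({0, 1, 3, 4} : Finset (Fin 8)).image e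

end SplitGlue

open SplitGlue

namespace SplitGlue

set_option linter.unusedSectionVars false

/-! Everything is expressed through stresses: symmetric edge weights whose resulting force vanishes
at every vertex. For a placement `p`, the dimension of the stress space plus the rank of the
framework is the number of edges, so a graph is independent as soon as one placement, however
degenerate, carries only the zero stress; a generic placement attains all ranks at once.

Independence of the glue uses a degenerate placement. Both copies of `a` are put at `p a` and both
copies of `b` at `p b`, where `p` is generic for the base graph. Collapsing the copies is injective
on edges, and a weight on the split graph becomes a weight on `G`, which vanishes if it is in
equilibrium. It remains to place the other four vertices of the double-butterfly. If each butterfly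
carries both copies of one vertex, one puts `c` at `p b` and `c'` at `p a`; then the ear exerts no
total force at `a` or at `b`. If each butterfly carries one copy of `a` and one of `b`, one puts `c`
at the midpoint of `a`, `b` and `c'` at the midpoint of `u`, `v`. The total force of the ear is then
that of a bar `ab`, so the collapsed weight completes to a stress of `G + ab`. Such stresses form at
most a line, and some copy of `a` carries a nonzero force `f` proportional to the stress on `ab`.
The hinge `u`, `v` is chosen so that `f` is outside the span of the directions from `a` to `u` and
`v`, and this kills the stress. The carriers are `exists_copy_load`,
`exists_placement_of_not_aligned` and `exists_placement_of_aligned`.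

The implied nonedge comes from a dimension count. For an independent 2-thin cover, stresses of
different clusters are linearly independent. In the base their dimensions add up to the number of
shared nonedges, and in the ear to the number of nonedges among shared and key pairs, less one.
Safety of the split ensures that a stressed cluster is not torn apart, that shared nonedges other
than `{a, b}` have a single image, and that the images of a stressed pair `{a, b}` are key gluing
pairs, hence already present in the ear. Adding all these nonedges to the glue therefore creates at
least as many independent stresses as new edges, so the rank does not grow and every added pair is
implied (`exists_isImpliedNonedge_glue`).

Nucleation-freeness is an edge count. A vertex set of the glue is cut into its part in the split
graph and its part in the ear. The first has few edges because the split graph is nucleation-free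
or, when it contains three or four new vertices, because it collapses into the independent graph
`G`; the second is bounded by `doubleButterfly_count`. -/

/-- The sign `ε` with `dir q p = -ε • dir p q`. -/
noncomputable def RigidityMatroid.sgn : RigidityMatroid → ℝ
  | .R3 => 1
  | .MK5 => -1

lemma sgn_mul_sgn (M : RigidityMatroid) : M.sgn * M.sgn = 1 := by
  cases M <;> simp [RigidityMatroid.sgn]

lemma sgn_ne_zero (M : RigidityMatroid) : M.sgn ≠ 0 := by
  cases M <;> simp [RigidityMatroid.sgn]

lemma dir_swap (M : RigidityMatroid) (p q : Fin M.dim → ℝ) :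
    M.dir q p = -(M.sgn • M.dir p q) := by
  cases M
  · ext k; simp [RigidityMatroid.sgn, RigidityMatroid.dir]
  · ext k; fin_cases k <;> simp [RigidityMatroid.sgn, RigidityMatroid.dir] <;> ring

lemma dir_self (M : RigidityMatroid) (p : Fin M.dim → ℝ) : M.dir p p = 0 := by
  cases M
  · ext k; simp [RigidityMatroid.dir]
  · ext k; fin_cases k <;> simp [RigidityMatroid.dir]

/-! ### Stresses and their push-forwards. -/

section Stress

variable {V U : Type*} [Fintype V] [Fintype U]

/-- The resulting force at the vertex `i` of the edge weights `ω` in the framework `p`. -/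
noncomputable def load (M : RigidityMatroid) (p : V → Fin M.dim → ℝ) (ω : V → V → ℝ) (i : V) :
    Fin 3 → ℝ :=
  ∑ j, ω i j • M.dir (p i) (p j)

/-- Edge weights: functions on ordered pairs that are supported on the edges of `Γ` and satisfy the
symmetry condition that corresponds to the orientation of the rows. -/
def weightSpace (M : RigidityMatroid) (Γ : SimpleGraph V) : Submodule ℝ (V → V → ℝ) where
  carrier := {ω | (∀ i j, ω j i = M.sgn * ω i j) ∧ ∀ i j, ¬ Γ.Adj i j → ω i j = 0}
  add_mem' := by
    rintro x y ⟨h1, h2⟩ ⟨h3, h4⟩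
    exact ⟨fun i j => by simp [h1 i j, h3 i j, mul_add], fun i j h => by simp [h2 i j h, h4 i j h]⟩
  zero_mem' := by simp
  smul_mem' := by
    rintro c x ⟨h1, h2⟩
    exact ⟨fun i j => by simp only [Pi.smul_apply, smul_eq_mul, h1 i j]; ring,
      fun i j h => by simp [h2 i j h]⟩

/-- The map that sends edge weights to the resulting forces. -/
noncomputable def loadMap (M : RigidityMatroid) (p : V → Fin M.dim → ℝ) :
    (V → V → ℝ) →ₗ[ℝ] (V → Fin 3 → ℝ) where
  toFun ω := load M p ω
  map_add' x y := by
    ext i k; simp [load, add_smul, Finset.sum_add_distrib]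
  map_smul' c x := by
    ext i k; simp [load, Finset.mul_sum, mul_assoc]

/-- The space of stresses of the framework of `Γ` placed at `p`. -/
noncomputable def stressSpace (M : RigidityMatroid) (Γ : SimpleGraph V) (p : V → Fin M.dim → ℝ) :
    Submodule ℝ (V → V → ℝ) :=
  weightSpace M Γ ⊓ LinearMap.ker (loadMap M p)

lemma mem_stressSpace {M : RigidityMatroid} {Γ : SimpleGraph V} {p : V → Fin M.dim → ℝ}
    {ω : V → V → ℝ} :
    ω ∈ stressSpace M Γ p ↔ ω ∈ weightSpace M Γ ∧ ∀ i, load M p ω i = 0 := by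
  simp only [stressSpace, Submodule.mem_inf, LinearMap.mem_ker, and_congr_right_iff]
  intro _
  exact ⟨fun h i => congrFun h i, fun h => funext h⟩

lemma weightSpace_mono {M : RigidityMatroid} {Γ Δ : SimpleGraph V} (h : Γ ≤ Δ) :
    weightSpace M Γ ≤ weightSpace M Δ :=
  fun _ hω => ⟨hω.1, fun i j hij => hω.2 i j fun h' => hij (h h')⟩

lemma stressSpace_mono {M : RigidityMatroid} {Γ Δ : SimpleGraph V} (h : Γ ≤ Δ)
    (p : V → Fin M.dim → ℝ) : stressSpace M Γ p ≤ stressSpace M Δ p :=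
  inf_le_inf_right _ (weightSpace_mono h)

open Classical in
/-- Edge weights are the same as functions on the edge set. -/
noncomputable def weightEquiv (M : RigidityMatroid) (Γ : SimpleGraph V) :
    weightSpace M Γ ≃ₗ[ℝ] (Γ.edgeSet → ℝ) where
  -- `Quot.out` selects an orientation of each edge; the opposite value is recovered through the
  -- sign.
  toFun ω e := (ω : V → V → ℝ) (Quot.out e.1).1 (Quot.out e.1).2
  map_add' _ _ := rfl
  map_smul' _ _ := rfl
  invFun c := ⟨fun i j => if h : Γ.Adj i j then
      (if Quot.out s(i, j) = (i, j) then c ⟨s(i, j), h⟩ else M.sgn * c ⟨s(i, j), h⟩) else 0, by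
    constructor
    · intro i j
      by_cases h : Γ.Adj i j
      · have hne : i ≠ j := h.ne
        have hs : s(j, i) = s(i, j) := Sym2.eq_swap
        have h1 : (⟨s(j, i), h.symm⟩ : Γ.edgeSet) = ⟨s(i, j), h⟩ := Subtype.ext hs
        have hout : Quot.out s(i, j) = (i, j) ∨ Quot.out s(i, j) = (j, i) := by
          have : Sym2.mk (Quot.out s(i, j)).1 (Quot.out s(i,j)).2 = s(i, j) := Quot.out_eq _
          rcases Sym2.eq_iff.1 this with h | h
          · left; exact Prod.ext h.1 h.2
          · right; exact Prod.ext h.1 h.2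
        have hne' : (i, j) ≠ (j, i) := fun h => hne (Prod.ext_iff.1 h).1
        simp only [h, h.symm, dif_pos, h1]
        rw [hs]
        rcases hout with ho | ho
        · rw [ho]; simp [hne']
        · rw [ho]; simp [hne'.symm, ← mul_assoc, sgn_mul_sgn]
      · have h' : ¬ Γ.Adj j i := fun h' => h h'.symm
        simp [h, h']
    · intro i j h; simp [h]⟩
  left_inv := by
    rintro ⟨ω, h1, h2⟩
    ext i j
    by_cases h : Γ.Adj i j
    · have hout : Quot.out s(i, j) = (i, j) ∨ Quot.out s(i, j) = (j, i) := by
        have : Sym2.mk (Quot.out s(i, j)).1 (Quot.out s(i,j)).2 = s(i, j) := Quot.out_eq _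
        rcases Sym2.eq_iff.1 this with h | h
        · left; exact Prod.ext h.1 h.2
        · right; exact Prod.ext h.1 h.2
      have hne' : (j, i) ≠ (i, j) := fun hh => h.ne (Prod.ext_iff.1 hh).1.symm
      rcases hout with ho | ho
      · simp [h, ho]
      · simp [h, ho, hne', h1 i j, ← mul_assoc, sgn_mul_sgn]
    · simp [h, h2 i j h]
  right_inv := by
    intro c
    ext ⟨e, he⟩
    have hq : s((Quot.out e).1, (Quot.out e).2) = e := Quot.out_eq e
    have hadj : Γ.Adj (Quot.out e).1 (Quot.out e).2 := by
      rw [← SimpleGraph.mem_edgeSet, hq]; exact he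
    have h2 : (⟨s((Quot.out e).1, (Quot.out e).2), hadj⟩ : Γ.edgeSet) = ⟨e, he⟩ := Subtype.ext hq
    simp only [hadj, dif_pos, h2]
    rw [hq]; simp

lemma finrank_weightSpace (M : RigidityMatroid) (Γ : SimpleGraph V) :
    Module.finrank ℝ (weightSpace M Γ) = Γ.edgeSet.ncard := by
  classical
  rw [(weightEquiv M Γ).finrank_eq, Module.finrank_fintype_fun_eq_card, Set.ncard_eq_toFinset_card',
    Set.toFinset_card]

open Classical in
/-- The weight with value `1` on the ordered pair `(i, j)`. -/
noncomputable def unitWeight (M : RigidityMatroid) (i j : V) : V → V → ℝ :=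
  fun x y => (if x = i ∧ y = j then 1 else 0) + (if x = j ∧ y = i then M.sgn else 0)

lemma unitWeight_mem {M : RigidityMatroid} {Γ : SimpleGraph V} {i j : V} (h : Γ.Adj i j) :
    unitWeight M i j ∈ weightSpace M Γ := by
  classical
  constructor
  · intro x y
    have := sgn_mul_sgn M
    simp only [unitWeight, mul_add, mul_ite, mul_one, mul_zero, this]
    rw [add_comm]
    exact congrArg₂ (· + ·) (if_congr and_comm rfl rfl) (if_congr and_comm rfl rfl)
  · intro x y hxy
    have h1 : ¬ (x = i ∧ y = j) := by rintro ⟨rfl, rfl⟩; exact hxy h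
    have h2 : ¬ (x = j ∧ y = i) := by rintro ⟨rfl, rfl⟩; exact hxy h.symm
    simp [unitWeight, h1, h2]

lemma load_unitWeight (M : RigidityMatroid) (p : V → Fin M.dim → ℝ) (i j : V) :
    loadMap M p (unitWeight M i j) = edgeRow M p i j := by
  classical
  ext x k
  simp only [loadMap, LinearMap.coe_mk, AddHom.coe_mk, load, unitWeight, edgeRow, add_smul,
    Finset.sum_add_distrib, ite_and]
  rcases eq_or_ne i j with rfl | hij
  · by_cases hx : x = i
    · subst hx; simp [dir_self]
    · simp [hx]
  · by_cases hx : x = i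
    · subst hx; simp [hij]
    · by_cases hx' : x = j
      · subst hx'; simp [hx]; simp [dir_swap M (p i) (p x), ← mul_assoc, sgn_mul_sgn]
      · simp [hx, hx']

/-- The map from edge weights to forces on `Γ`. -/
lemma map_loadMap_weightSpace (M : RigidityMatroid) (Γ : SimpleGraph V) (p : V → Fin M.dim → ℝ) :
    (weightSpace M Γ).map (loadMap M p) =
      Submodule.span ℝ {r | ∃ i j, Γ.Adj i j ∧ r = edgeRow M p i j} := by
  classical
  apply le_antisymm
  · rintro _ ⟨ω, hω, rfl⟩
    -- The double sum meets every edge in both orientations, hence the factor 2.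
    have key : (2 : ℝ) • ω = ∑ i, ∑ j, ω i j • unitWeight M i j := by
      ext x y
      simp only [unitWeight, Finset.sum_apply, Pi.smul_apply, smul_eq_mul, mul_add, ite_and,
        mul_ite, mul_one, mul_zero, Finset.sum_add_distrib]
      have h1 : ∑ i, ∑ j, (if x = i then if y = j then ω i j else 0 else 0) = ω x y := by
        rw [Finset.sum_eq_single x (by intro b _ hb; simp [hb.symm]) (by simp)]
        simp
      have h2 : ∑ i, ∑ j, (if x = j then if y = i then ω i j * M.sgn else 0 else 0)
          = ω x y := by
        rw [Finset.sum_eq_single y (by intro b _ hb; simp [hb.symm]) (by simp)]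
        simp only [Finset.sum_ite_eq, Finset.mem_univ, if_true]
        rw [hω.1 x y, mul_right_comm, sgn_mul_sgn, one_mul]
      rw [h1, h2]; ring
    have h3 : ω = (2 : ℝ)⁻¹ • ∑ i, ∑ j, ω i j • unitWeight M i j := by
      rw [← key]; simp
    rw [h3, map_smul, map_sum]
    refine Submodule.smul_mem _ _ (Submodule.sum_mem _ fun i _ => ?_)
    rw [map_sum]
    refine Submodule.sum_mem _ fun j _ => ?_
    by_cases h : Γ.Adj i j
    · rw [map_smul, load_unitWeight]
      exact Submodule.smul_mem _ _ (Submodule.subset_span ⟨i, j, h, rfl⟩)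
    · simp [hω.2 i j h]
  · rw [Submodule.span_le]
    rintro _ ⟨i, j, h, rfl⟩
    exact ⟨_, unitWeight_mem h, load_unitWeight M p i j⟩

/-- Rank-nullity for the load map on edge weights, whose image is the row space. -/
theorem finrank_stressSpace_add (M : RigidityMatroid) (Γ : SimpleGraph V)
    (p : V → Fin M.dim → ℝ) :
    Module.finrank ℝ (stressSpace M Γ p) + frameworkRank M Γ p = Γ.edgeSet.ncard := by
  rw [frameworkRank, ← map_loadMap_weightSpace, ← finrank_weightSpace M Γ,
    ← LinearMap.finrank_range_add_finrank_ker ((loadMap M p).domRestrict (weightSpace M Γ)),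
    LinearMap.range_domRestrict, add_comm]
  congr 1
  rw [LinearMap.ker_domRestrict, stressSpace]
  exact (LinearEquiv.finrank_eq (Submodule.comapSubtypeEquivOfLe (p := stressSpace M Γ p) (q := weightSpace M Γ) inf_le_left)).symm.trans
    (by rw [show (stressSpace M Γ p).comap (weightSpace M Γ).subtype =
      (LinearMap.ker (loadMap M p)).comap (weightSpace M Γ).subtype by
        rw [stressSpace, Submodule.comap_inf]; simp])

lemma frameworkRank_le_ncard (M : RigidityMatroid) (Γ : SimpleGraph V) (p : V → Fin M.dim → ℝ) :
    frameworkRank M Γ p ≤ Γ.edgeSet.ncard := by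
  have := finrank_stressSpace_add M Γ p; omega

lemma bddAbove_frameworkRank (M : RigidityMatroid) (Γ : SimpleGraph V) :
    BddAbove (Set.range fun p : V → Fin M.dim → ℝ => frameworkRank M Γ p) :=
  ⟨Γ.edgeSet.ncard, by rintro _ ⟨p, rfl⟩; exact frameworkRank_le_ncard M Γ p⟩

lemma frameworkRank_le_rank (M : RigidityMatroid) (Γ : SimpleGraph V) (p : V → Fin M.dim → ℝ) :
    frameworkRank M Γ p ≤ rank M Γ :=
  le_ciSup (bddAbove_frameworkRank M Γ) p

lemma rank_le_ncard (M : RigidityMatroid) (Γ : SimpleGraph V) : rank M Γ ≤ Γ.edgeSet.ncard :=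
  ciSup_le fun p => frameworkRank_le_ncard M Γ p

lemma exists_frameworkRank_eq_rank (M : RigidityMatroid) (Γ : SimpleGraph V) :
    ∃ p : V → Fin M.dim → ℝ, frameworkRank M Γ p = rank M Γ := by
  have := Nat.sSup_mem (Set.range_nonempty _) (bddAbove_frameworkRank M Γ)
  exact this

lemma finrank_stressSpace_ge (M : RigidityMatroid) (Γ : SimpleGraph V)
    (p : V → Fin M.dim → ℝ) :
    Γ.edgeSet.ncard ≤ Module.finrank ℝ (stressSpace M Γ p) + rank M Γ := by
  have := finrank_stressSpace_add M Γ p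
  have := frameworkRank_le_rank M Γ p
  omega

/-- The rank is a maximum over placements, so one special placement is enough of a certificate. -/
lemma independent_of_stressSpace_eq_bot {M : RigidityMatroid} {Γ : SimpleGraph V}
    (p : V → Fin M.dim → ℝ) (h : stressSpace M Γ p = ⊥) : Independent M Γ := by
  have h1 := finrank_stressSpace_ge M Γ p
  rw [h, finrank_bot, zero_add] at h1
  exact le_antisymm (rank_le_ncard M Γ) h1

lemma Independent.exists_stressSpace_eq_bot {M : RigidityMatroid} {Γ : SimpleGraph V}
    (h : Independent M Γ) : ∃ p : V → Fin M.dim → ℝ, stressSpace M Γ p = ⊥ := by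
  obtain ⟨p, hp⟩ := exists_frameworkRank_eq_rank M Γ
  refine ⟨p, ?_⟩
  have h1 := finrank_stressSpace_add M Γ p
  rw [hp, h] at h1
  exact Submodule.finrank_eq_zero.1 (by omega)

lemma Independent.mono {M : RigidityMatroid} {Γ Δ : SimpleGraph V} (h : Independent M Δ)
    (hle : Γ ≤ Δ) : Independent M Γ := by
  obtain ⟨p, hp⟩ := h.exists_stressSpace_eq_bot
  exact independent_of_stressSpace_eq_bot p (le_bot_iff.1 (hp ▸ stressSpace_mono hle p))

lemma rank_mono {M : RigidityMatroid} {Γ Δ : SimpleGraph V} (hle : Γ ≤ Δ) :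
    rank M Γ ≤ rank M Δ := by
  refine ciSup_le fun p => le_trans ?_ (frameworkRank_le_rank M Δ p)
  refine Submodule.finrank_mono (Submodule.span_mono ?_)
  rintro _ ⟨i, j, h, rfl⟩
  exact ⟨i, j, hle h, rfl⟩

open Classical in
/-- The push-forward of edge weights along a map of vertices. -/
noncomputable def push (ι : V → U) : (V → V → ℝ) →ₗ[ℝ] (U → U → ℝ) where
  toFun ω s t := ∑ x, ∑ y, if ι x = s ∧ ι y = t then ω x y else 0
  map_add' ω η := by
    ext s t
    simp only [Pi.add_apply, ← Finset.sum_add_distrib]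
    refine Finset.sum_congr rfl fun x _ => Finset.sum_congr rfl fun y _ => ?_
    split_ifs <;> simp
  map_smul' c ω := by
    ext s t
    simp [Finset.mul_sum]

lemma push_apply_of_injective {ι : V → U} (hι : Function.Injective ι) (ω : V → V → ℝ) (x y : V) :
    push ι ω (ι x) (ι y) = ω x y := by
  classical
  simp only [push, LinearMap.coe_mk, AddHom.coe_mk, hι.eq_iff]
  rw [Finset.sum_eq_single x (by intro b _ hb; simp [hb]) (by simp),
    Finset.sum_eq_single y (by intro b _ hb; simp [hb]) (by simp)]
  simp

lemma exists_of_push_ne_zero {ι : V → U} {ω : V → V → ℝ} {s t : U} (h : push ι ω s t ≠ 0) :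
    ∃ x y, ι x = s ∧ ι y = t ∧ ω x y ≠ 0 := by
  classical
  obtain ⟨x, -, hx⟩ := Finset.exists_ne_zero_of_sum_ne_zero h
  obtain ⟨y, -, hy⟩ := Finset.exists_ne_zero_of_sum_ne_zero hx
  by_cases hc : ι x = s ∧ ι y = t
  · exact ⟨x, y, hc.1, hc.2, by simpa [hc] using hy⟩
  · simp [hc] at hy

-- Identifying vertices placed at the same point adds their forces; this is what makes the collapse
-- of a split useful.
open Classical in
lemma load_push {M : RigidityMatroid} (ι : V → U) (P : U → Fin M.dim → ℝ) (ω : V → V → ℝ) (s : U) :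
    load M P (push ι ω) s = ∑ x, if ι x = s then load M (fun v => P (ι v)) ω x else 0 := by
  simp only [load, push, LinearMap.coe_mk, AddHom.coe_mk, Finset.sum_smul]
  rw [Finset.sum_comm]
  refine Finset.sum_congr rfl fun x _ => ?_
  rw [Finset.sum_comm]
  by_cases hx : ι x = s
  · simp only [hx, true_and, if_true]
    refine Finset.sum_congr rfl fun y _ => ?_
    rw [Finset.sum_eq_single (ι y) (by intro b _ hb; simp [hb.symm]) (by simp)]
    simp
  · simp [hx]

lemma push_sgn {M : RigidityMatroid} (ι : V → U) {ω : V → V → ℝ}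
    (h : ∀ i j, ω j i = M.sgn * ω i j) (s t : U) : push ι ω t s = M.sgn * push ι ω s t := by
  classical
  simp only [push, LinearMap.coe_mk, AddHom.coe_mk, Finset.mul_sum]
  rw [Finset.sum_comm]
  refine Finset.sum_congr rfl fun x _ => Finset.sum_congr rfl fun y _ => ?_
  rw [h x y]
  by_cases h1 : ι y = t <;> by_cases h2 : ι x = s <;> simp [h1, h2]

lemma push_mem_weightSpace {M : RigidityMatroid} {Γ : SimpleGraph V} {Δ : SimpleGraph U}
    (ι : V → U) {ω : V → V → ℝ} (hω : ω ∈ weightSpace M Γ)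
    (h : ∀ x y, ω x y ≠ 0 → Δ.Adj (ι x) (ι y)) : push ι ω ∈ weightSpace M Δ := by
  refine ⟨push_sgn ι hω.1, fun s t hst => ?_⟩
  by_contra hne
  obtain ⟨x, y, rfl, rfl, hxy⟩ := exists_of_push_ne_zero hne
  exact hst (h x y hxy)

lemma push_mem_stressSpace {M : RigidityMatroid} {Γ : SimpleGraph V} {Δ : SimpleGraph U}
    (ι : V → U) (P : U → Fin M.dim → ℝ) {ω : V → V → ℝ}
    (hω : ω ∈ stressSpace M Γ (fun v => P (ι v)))
    (h : ∀ x y, ω x y ≠ 0 → Δ.Adj (ι x) (ι y)) : push ι ω ∈ stressSpace M Δ P := by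
  rw [mem_stressSpace] at hω ⊢
  refine ⟨push_mem_weightSpace ι hω.1 h, fun s => ?_⟩
  rw [load_push]
  exact Finset.sum_eq_zero fun x _ => by simp [hω.2 x]

end Stress

/-! ### Generic placements by Zariski density. -/

section Generic

variable {V U : Type*}

/-- The polynomial functions on the placements of `V` in `ℝ^d`. -/
noncomputable def polyFun (V : Type*) (d : ℕ) : Subalgebra ℝ ((V → Fin d → ℝ) → ℝ) :=
  (MvPolynomial.aeval (R := ℝ) (fun (x : V × Fin d) (p : V → Fin d → ℝ) => p x.1 x.2)).range

lemma coord_mem_polyFun {d : ℕ} (v : V) (k : Fin d) :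
    (fun p : V → Fin d → ℝ => p v k) ∈ polyFun V d :=
  ⟨MvPolynomial.X (v, k), by simp⟩

lemma const_mem_polyFun {d : ℕ} (c : ℝ) : (fun _ : V → Fin d → ℝ => c) ∈ polyFun V d :=
  (polyFun V d).algebraMap_mem c

lemma aeval_coord_apply {d : ℕ} (F : MvPolynomial (V × Fin d) ℝ) (p : V → Fin d → ℝ) :
    MvPolynomial.aeval (R := ℝ) (fun (x : V × Fin d) (p : V → Fin d → ℝ) => p x.1 x.2) F p =
      MvPolynomial.eval (fun x => p x.1 x.2) F := by
  induction F using MvPolynomial.induction_on with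
  | C a => simp
  | add f g hf hg => simp [hf, hg]
  | mul_X f x hf => simp [hf]

/-- Over an infinite field a polynomial that vanishes as a function is zero, so polynomial functions
form a domain. This makes nonempty open sets meet. -/
lemma polyFun_mul_ne_zero {d : ℕ} {f g : (V → Fin d → ℝ) → ℝ} (hf : f ∈ polyFun V d)
    (hg : g ∈ polyFun V d) (hf0 : f ≠ 0) (hg0 : g ≠ 0) : f * g ≠ 0 := by
  obtain ⟨F, rfl⟩ := hf
  obtain ⟨G, rfl⟩ := hg
  intro h
  have h0 : F * G = 0 := by
    apply MvPolynomial.funext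
    intro x
    have := congrFun h fun v k => x (v, k)
    simpa [aeval_coord_apply] using this
  rcases mul_eq_zero.1 h0 with rfl | rfl
  · exact hf0 (map_zero _)
  · exact hg0 (map_zero _)

/-- A set of placements that contains a nonempty Zariski-open set. -/
def ZariskiDense {d : ℕ} (O : Set (V → Fin d → ℝ)) : Prop :=
  ∃ f ∈ polyFun V d, f ≠ 0 ∧ ∀ p, f p ≠ 0 → p ∈ O

namespace ZariskiDense

variable {d : ℕ} {O O' : Set (V → Fin d → ℝ)}

lemma nonempty (h : ZariskiDense O) : O.Nonempty := by
  obtain ⟨f, -, hf, h⟩ := h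
  obtain ⟨p, hp⟩ := Function.ne_iff.1 hf
  exact ⟨p, h p hp⟩

lemma inter (h : ZariskiDense O) (h' : ZariskiDense O') : ZariskiDense (O ∩ O') := by
  obtain ⟨f, hf, hf0, h⟩ := h
  obtain ⟨g, hg, hg0, h'⟩ := h'
  refine ⟨f * g, mul_mem hf hg, polyFun_mul_ne_zero hf hg hf0 hg0, fun p hp => ?_⟩
  have := mul_ne_zero_iff.1 (show f p * g p ≠ 0 from hp)
  exact ⟨h p this.1, h' p this.2⟩

lemma univ : ZariskiDense (Set.univ : Set (V → Fin d → ℝ)) :=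
  ⟨1, one_mem _, one_ne_zero, fun _ _ => trivial⟩

lemma iInter {I : Type*} [Finite I] {O : I → Set (V → Fin d → ℝ)} (h : ∀ i, ZariskiDense (O i)) :
    ZariskiDense (⋂ i, O i) := by
  classical
  have := Fintype.ofFinite I
  have key : ∀ s : Finset I, ZariskiDense (⋂ i ∈ s, O i) := by
    intro s
    induction s using Finset.induction_on with
    | empty => simpa using univ
    | insert i s _ ih => rw [Finset.set_biInter_insert]; exact (h i).inter ih
  simpa using key Finset.univ

/-- Restriction of placements along an injection is onto, so the defining polynomial stays nonzero.
Thus one placement of the glue can be generic on many embedded vertex sets at once. -/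
lemma comap {ι : V → U} (hι : Function.Injective ι) (h : ZariskiDense O) :
    ZariskiDense {P : U → Fin d → ℝ | (fun v => P (ι v)) ∈ O} := by
  obtain ⟨f, ⟨F, rfl⟩, hf0, h⟩ := h
  refine ⟨fun P => MvPolynomial.aeval (R := ℝ)
      (fun (x : V × Fin d) (p : V → Fin d → ℝ) => p x.1 x.2) F fun v => P (ι v),
    ⟨MvPolynomial.rename (fun x : V × Fin d => (ι x.1, x.2)) F, ?_⟩, ?_, fun P hP => h _ hP⟩
  · ext P
    simp only [AlgHom.toRingHom_eq_coe, RingHom.coe_coe, aeval_coord_apply,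
      MvPolynomial.eval_rename]
    rfl
  · obtain ⟨p, hp⟩ := Function.ne_iff.1 hf0
    refine Function.ne_iff.2 ⟨Function.extend ι p 0, ?_⟩
    simpa [hι.extend_apply] using hp

end ZariskiDense

lemma dir_mem_polyFun {d : ℕ} (M : RigidityMatroid) {f g : (V → Fin d → ℝ) → Fin M.dim → ℝ}
    (hf : ∀ k, (fun p => f p k) ∈ polyFun V d) (hg : ∀ k, (fun p => g p k) ∈ polyFun V d)
    (k : Fin 3) : (fun p => M.dir (f p) (g p) k) ∈ polyFun V d := by
  cases M
  · exact sub_mem (hf k) (hg k)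
  · have h0 := sub_mem (hf (0 : Fin 2)) (hg (0 : Fin 2))
    have h1 := sub_mem (hf (1 : Fin 2)) (hg (1 : Fin 2))
    fin_cases k
    · exact pow_mem h0 2
    · exact mul_mem h0 h1
    · exact pow_mem h1 2

/-- The Gram determinant is a polynomial in the placement and, over the reals, is nonzero exactly
for independent families. -/
lemma zariskiDense_linearIndependent {d : ℕ} {J K : Type*} [Finite J] [Finite K]
    {v : (V → Fin d → ℝ) → J → K → ℝ} (hv : ∀ j k, (fun p => v p j k) ∈ polyFun V d)
    {p₀ : V → Fin d → ℝ} (h : LinearIndependent ℝ (v p₀)) :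
    ZariskiDense {p | LinearIndependent ℝ (v p)} := by
  classical
  have := Fintype.ofFinite J
  have := Fintype.ofFinite K
  let w : (V → Fin d → ℝ) → J → EuclideanSpace ℝ K := fun p j => WithLp.toLp 2 (v p j)
  have hw : ∀ p, LinearIndependent ℝ (w p) ↔ LinearIndependent ℝ (v p) := fun p =>
    LinearMap.linearIndependent_iff (WithLp.linearEquiv 2 ℝ (K → ℝ)).symm.toLinearMap
      (LinearEquiv.ker _)
  refine ⟨fun p => (Matrix.gram ℝ (w p)).det, ?_, ?_, fun p hp => ?_⟩
  · have : (fun p => (Matrix.gram ℝ (w p)).det) =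
        ∑ σ : Equiv.Perm J, ((Equiv.Perm.sign σ : ℤ) : ℝ) •
          ∏ i, fun p => ∑ k, v p (σ i) k * v p i k := by
      ext p
      simp only [Matrix.det_apply', Finset.sum_apply, Finset.prod_apply, Pi.smul_apply, smul_eq_mul]
      refine Finset.sum_congr rfl fun σ _ => ?_
      congr 1
      refine Finset.prod_congr rfl fun i _ => ?_
      simp [Matrix.gram_apply, w, PiLp.inner_apply, mul_comm]
    rw [this]
    refine Subalgebra.sum_mem _ fun σ _ => Subalgebra.smul_mem _
      (Subalgebra.prod_mem _ fun i _ => ?_) _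
    have h2 : (fun p => ∑ k, v p (σ i) k * v p i k) =
        ∑ k, (fun p => v p (σ i) k) * fun p => v p i k := by
      ext p; simp
    rw [h2]
    exact sum_mem fun k _ => mul_mem (hv _ _) (hv _ _)
  · refine Function.ne_iff.2 ⟨p₀, ?_⟩
    exact Matrix.det_gram_ne_zero_iff_linearIndependent.2 ((hw p₀).2 h)
  · exact (hw p).1 (Matrix.linearIndependent_of_det_gram_ne_zero hp)

lemma edgeRow_mem_polyFun (M : RigidityMatroid) (i j x : V) (k : Fin 3) :
    (fun p => edgeRow M p i j x k) ∈ polyFun V M.dim := by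
  classical
  have h := dir_mem_polyFun M (coord_mem_polyFun i) (coord_mem_polyFun j) k
  have h0 : (fun _ => 0) ∈ polyFun V M.dim := const_mem_polyFun 0
  have h1 : ∀ y : V, (fun p : V → Fin M.dim → ℝ =>
      (Pi.single y (M.dir (p i) (p j)) : V → Fin 3 → ℝ) x k) ∈ polyFun V M.dim := by
    intro y
    by_cases hxy : x = y
    · subst hxy; simpa using h
    · simpa [hxy] using h0
  have h2 := sub_mem (h1 i) (h1 j)
  simp only [edgeRow]
  convert h2 using 1
  rfl

/-- Rows that form a basis at an optimal placement stay independent on an open set. -/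
lemma zariskiDense_rank [Fintype V] (M : RigidityMatroid) (Γ : SimpleGraph V) :
    ZariskiDense {p : V → Fin M.dim → ℝ | rank M Γ ≤ frameworkRank M Γ p} := by
  obtain ⟨p₀, hp₀⟩ := exists_frameworkRank_eq_rank M Γ
  let D := {x : V × V // Γ.Adj x.1 x.2}
  let row : (V → Fin M.dim → ℝ) → D → V → Fin 3 → ℝ := fun p e => edgeRow M p e.1.1 e.1.2
  have hset : ∀ p, {r | ∃ i j, Γ.Adj i j ∧ r = edgeRow M p i j} = Set.range (row p) := by
    intro p; ext r; constructor
    · rintro ⟨i, j, h, rfl⟩; exact ⟨⟨(i, j), h⟩, rfl⟩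
    · rintro ⟨⟨⟨i, j⟩, h⟩, rfl⟩; exact ⟨i, j, h, rfl⟩
  obtain ⟨J, a, ha, hspan, hli⟩ := exists_linearIndependent' ℝ (row p₀)
  have : Finite J := Finite.of_injective a ha
  have := Fintype.ofFinite J
  have hcard : Fintype.card J = rank M Γ := by
    rw [← hp₀, frameworkRank, hset, ← hspan, finrank_span_eq_card hli]
  let flat : (V → Fin 3 → ℝ) ≃ₗ[ℝ] (V × Fin 3 → ℝ) := (LinearEquiv.curry ℝ ℝ V (Fin 3)).symm
  have hflat : ∀ p, LinearIndependent ℝ (fun j => flat (row p (a j))) ↔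
      LinearIndependent ℝ (row p ∘ a) := fun p =>
    LinearMap.linearIndependent_iff flat.toLinearMap (LinearEquiv.ker _)
  obtain ⟨f, hf, hf0, h⟩ := zariskiDense_linearIndependent
    (v := fun p j => flat (row p (a j))) (p₀ := p₀)
    (fun j k => edgeRow_mem_polyFun M _ _ _ _) ((hflat p₀).2 hli)
  refine ⟨f, hf, hf0, fun p hp => ?_⟩
  have h1 := (hflat p).1 (h p hp)
  have h2 := finrank_span_eq_card h1
  rw [Set.mem_ofPred_eq, ← hcard, ← h2, frameworkRank, hset]
  exact Submodule.finrank_mono (Submodule.span_mono (Set.range_comp_subset_range _ _))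

/-- The last coordinate of the space of placements. -/
def RigidityMatroid.last : (M : RigidityMatroid) → Fin M.dim
  | .R3 => (2 : Fin 3)
  | .MK5 => (1 : Fin 2)

/-- A placement is generic if all graphs attain their rank and it is in general position. -/
structure IsGeneric (M : RigidityMatroid) (p : V → Fin M.dim → ℝ) : Prop where
  rank_le : ∀ Γ, rank M Γ ≤ frameworkRank M Γ p
  dir_indep : ∀ i j k, i ≠ j → i ≠ k → j ≠ k →
    LinearIndependent ℝ ![M.dir (p i) (p j), M.dir (p i) (p k)]
  last_ne : ∀ i j, i ≠ j → p i M.last ≠ p j M.last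

lemma zariskiDense_dir_indep (M : RigidityMatroid) {i j k : V} (hij : i ≠ j) (hik : i ≠ k)
    (hjk : j ≠ k) : ZariskiDense {p : V → Fin M.dim → ℝ |
      LinearIndependent ℝ ![M.dir (p i) (p j), M.dir (p i) (p k)]} := by
  classical
  have key : ∃ p₀ : V → Fin M.dim → ℝ,
      LinearIndependent ℝ ![M.dir (p₀ i) (p₀ j), M.dir (p₀ i) (p₀ k)] := by
    cases M
    · refine ⟨fun v => if v = j then ![1, 0, 0] else if v = k then ![0, 1, 0] else (0 : Fin 3 → ℝ), ?_⟩
      rw [LinearIndependent.pair_iff]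
      intro s t h
      have h0 := congrFun h 0
      have h1 := congrFun h 1
      simp [RigidityMatroid.dir, hij, hik, hjk.symm] at h0 h1
      exact ⟨h0, h1⟩
    · refine ⟨fun v => if v = j then ![1, 0] else if v = k then ![0, 1] else (0 : Fin 2 → ℝ), ?_⟩
      rw [LinearIndependent.pair_iff]
      intro s t h
      have h0 := congrFun h 0
      have h1 := congrFun h 2
      simp [RigidityMatroid.dir, hij, hik, hjk.symm] at h0 h1
      exact ⟨h0, h1⟩
  obtain ⟨p₀, h⟩ := key
  refine zariskiDense_linearIndependent
    (v := fun p => ![M.dir (p i) (p j), M.dir (p i) (p k)]) (fun a b => ?_) h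
  fin_cases a
  · exact dir_mem_polyFun M (coord_mem_polyFun i) (coord_mem_polyFun j) b
  · exact dir_mem_polyFun M (coord_mem_polyFun i) (coord_mem_polyFun k) b

lemma zariskiDense_isGeneric [Fintype V] (M : RigidityMatroid) :
    ZariskiDense {p : V → Fin M.dim → ℝ | IsGeneric M p} := by
  classical
  have h1 := ZariskiDense.iInter fun Γ : SimpleGraph V => zariskiDense_rank M Γ
  have h2 := ZariskiDense.iInter
    (I := {x : V × V × V // x.1 ≠ x.2.1 ∧ x.1 ≠ x.2.2 ∧ x.2.1 ≠ x.2.2})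
    fun x => zariskiDense_dir_indep M x.2.1 x.2.2.1 x.2.2.2
  have h3 := ZariskiDense.iInter (I := {x : V × V // x.1 ≠ x.2})
    (O := fun x => {p : V → Fin M.dim → ℝ | p x.1.1 M.last ≠ p x.1.2 M.last})
    fun x => ⟨fun p => p x.1.1 M.last - p x.1.2 M.last,
      sub_mem (coord_mem_polyFun _ _) (coord_mem_polyFun _ _),
      Function.ne_iff.2 ⟨fun v _ => if v = x.1.1 then 1 else 0, by simp [x.2.symm]⟩,
      fun p hp => sub_ne_zero.1 hp⟩
  obtain ⟨f, hf, hf0, h⟩ := (h1.inter h2).inter h3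
  refine ⟨f, hf, hf0, fun p hp => ?_⟩
  obtain ⟨⟨ha, hb⟩, hc⟩ := h p hp
  rw [Set.mem_iInter] at ha hb hc
  exact ⟨ha, fun i j k hij hik hjk => hb ⟨(i, j, k), hij, hik, hjk⟩, fun i j hij => hc ⟨(i, j), hij⟩⟩

namespace IsGeneric

variable [Fintype V] {M : RigidityMatroid} {p : V → Fin M.dim → ℝ}

lemma finrank_stressSpace (hp : IsGeneric M p) (Γ : SimpleGraph V) :
    Module.finrank ℝ (stressSpace M Γ p) + rank M Γ = Γ.edgeSet.ncard := by
  rw [← finrank_stressSpace_add M Γ p]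
  exact congrArg _ (le_antisymm (hp.rank_le Γ) (frameworkRank_le_rank M Γ p))

lemma stressSpace_eq_bot (hp : IsGeneric M p) {Γ : SimpleGraph V} (h : Independent M Γ) :
    stressSpace M Γ p = ⊥ := by
  have := hp.finrank_stressSpace Γ
  rw [h] at this
  exact Submodule.finrank_eq_zero.1 (by omega)

end IsGeneric

end Generic

/-! ### Trivial motions and the bound `3n - 5`. -/

section Motions

/-- Five linearly independent trivial motions. -/
def RigidityMatroid.motion : (M : RigidityMatroid) → (Fin M.dim → ℝ) → Fin 5 → Fin 3 → ℝ
  | .R3, p => ![![1, 0, 0], ![0, 1, 0], ![0, 0, 1],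
      ![p (2 : Fin 3), 0, -p (0 : Fin 3)], ![0, p (2 : Fin 3), -p (1 : Fin 3)]]
  | .MK5, p => ![![1, 0, 0], ![0, 1, 0], ![0, 0, 1],
      ![p (1 : Fin 2), -p (0 : Fin 2), 0], ![0, p (1 : Fin 2), -p (0 : Fin 2)]]

lemma sum_dir_mul_motion (M : RigidityMatroid) (p q : Fin M.dim → ℝ) (c : Fin 5) :
    ∑ k, M.dir p q k * M.motion p c k - ∑ k, M.dir p q k * M.motion q c k = 0 := by
  cases M <;> fin_cases c <;>
    simp [RigidityMatroid.dir, RigidityMatroid.motion, Fin.sum_univ_three] <;> ring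

/-- The five motions stay independent when restricted to any two points with different last
coordinates. The witnesses solve the first three equations by `F` and the last two by the first two
entries of `G`. -/
lemma exists_sum_mul_motion (M : RigidityMatroid) {p q : Fin M.dim → ℝ}
    (h : p M.last ≠ q M.last) (z : Fin 5 → ℝ) :
    ∃ F G : Fin 3 → ℝ, ∀ c, ∑ k, F k * M.motion p c k + ∑ k, G k * M.motion q c k = z c := by
  cases M
  · have h' : q (2 : Fin 3) - p (2 : Fin 3) ≠ 0 := sub_ne_zero.2 (Ne.symm h)
    have e0 := div_mul_cancel₀
      (z 3 - (z 0 * p (2 : Fin 3) - z 2 * p (0 : Fin 3))) h'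
    have e1 := div_mul_cancel₀
      (z 4 - (z 1 * p (2 : Fin 3) - z 2 * p (1 : Fin 3))) h'
    generalize (z 3 - (z 0 * p (2 : Fin 3) - z 2 * p (0 : Fin 3))) /
      (q (2 : Fin 3) - p (2 : Fin 3)) = G0 at e0
    generalize (z 4 - (z 1 * p (2 : Fin 3) - z 2 * p (1 : Fin 3))) /
      (q (2 : Fin 3) - p (2 : Fin 3)) = G1 at e1
    refine ⟨![z 0 - G0, z 1 - G1, z 2], ![G0, G1, 0], fun c => ?_⟩
    fin_cases c <;> simp [RigidityMatroid.motion, Fin.sum_univ_three] <;> linarith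
  · have h' : q (1 : Fin 2) - p (1 : Fin 2) ≠ 0 := sub_ne_zero.2 (Ne.symm h)
    have e1 := div_mul_cancel₀
      (z 4 - (z 1 * p (1 : Fin 2) - z 2 * p (0 : Fin 2))) h'
    generalize (z 4 - (z 1 * p (1 : Fin 2) - z 2 * p (0 : Fin 2))) /
      (q (1 : Fin 2) - p (1 : Fin 2)) = G1 at e1
    have e0 := div_mul_cancel₀
      (z 3 - (z 0 * p (1 : Fin 2) - z 1 * p (0 : Fin 2)) +
        G1 * (q (0 : Fin 2) - p (0 : Fin 2))) h'
    generalize (z 3 - (z 0 * p (1 : Fin 2) - z 1 * p (0 : Fin 2)) +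
        G1 * (q (0 : Fin 2) - p (0 : Fin 2))) /
      (q (1 : Fin 2) - p (1 : Fin 2)) = G0 at e0
    refine ⟨![z 0 - G0, z 1 - G1, z 2], ![G0, G1, 0], fun c => ?_⟩
    fin_cases c <;> simp [RigidityMatroid.motion, Fin.sum_univ_three] <;> linarith

variable {V : Type*} [Fintype V]

/-- Every row lies in the common kernel of five independent functionals on forces. Five motions, and
not six, give a bound that also holds for two vertices. -/
theorem rank_add_five_le (M : RigidityMatroid) {Γ : SimpleGraph V} {S : Finset V}
    (hS : ∀ i j, Γ.Adj i j → i ∈ S) (hcard : 2 ≤ S.card) : rank M Γ + 5 ≤ 3 * S.card := by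
  classical
  obtain ⟨p, hp⟩ := (zariskiDense_isGeneric (V := V) M).nonempty
  let ext : (S → Fin 3 → ℝ) →ₗ[ℝ] (V → Fin 3 → ℝ) :=
    { toFun := fun F v => if h : v ∈ S then F ⟨v, h⟩ else 0
      map_add' := fun F G => by ext v k; by_cases h : v ∈ S <;> simp [h]
      map_smul' := fun c F => by ext v k; by_cases h : v ∈ S <;> simp [h] }
  let Ψ : (S → Fin 3 → ℝ) →ₗ[ℝ] (Fin 5 → ℝ) :=
    { toFun := fun F c => ∑ v : S, ∑ k, F v k * M.motion (p v) c k
      map_add' := fun F G => by ext c; simp [add_mul, Finset.sum_add_distrib]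
      map_smul' := fun c F => by ext c'; simp [Finset.mul_sum, mul_assoc] }
  have hΨ : Function.Surjective Ψ := by
    intro z
    obtain ⟨i, hi, j, hj, hij⟩ := Finset.one_lt_card.1 hcard
    obtain ⟨F, G, hFG⟩ := exists_sum_mul_motion M (hp.last_ne i j hij) z
    refine ⟨Pi.single ⟨i, hi⟩ F + Pi.single ⟨j, hj⟩ G, ?_⟩
    have h1 : ∀ (x : S) (F : Fin 3 → ℝ),
        Ψ (Pi.single x F) = fun c => ∑ k, F k * M.motion (p x) c k := by
      intro x F
      ext c
      change ∑ v : S, ∑ k, (Pi.single x F : S → Fin 3 → ℝ) v k * M.motion (p v) c k = _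
      rw [Finset.sum_eq_single x (by intro b _ hb; simp [hb]) (by simp)]
      simp
    rw [map_add, h1, h1]
    ext c
    exact hFG c
  have hker : Module.finrank ℝ (LinearMap.ker Ψ) + 5 = 3 * S.card := by
    have := LinearMap.finrank_range_add_finrank_ker Ψ
    rw [LinearMap.range_eq_top.2 hΨ, finrank_top, Module.finrank_fintype_fun_eq_card,
      Module.finrank_pi_fintype] at this
    simp at this
    omega
  have hle : Submodule.span ℝ {r | ∃ i j, Γ.Adj i j ∧ r = edgeRow M p i j} ≤
      (LinearMap.ker Ψ).map ext := by
    rw [Submodule.span_le]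
    rintro _ ⟨i, j, h, rfl⟩
    have hi := hS i j h
    have hj := hS j i h.symm
    have hij : (⟨i, hi⟩ : S) ≠ ⟨j, hj⟩ := fun e => h.ne (Subtype.ext_iff.1 e)
    refine ⟨Pi.single ⟨i, hi⟩ (M.dir (p i) (p j)) - Pi.single ⟨j, hj⟩ (M.dir (p i) (p j)), ?_, ?_⟩
    · rw [SetLike.mem_coe, LinearMap.mem_ker]
      ext c
      have h1 : ∀ (x : S) (F : Fin 3 → ℝ),
          Ψ (Pi.single x F) = fun c => ∑ k, F k * M.motion (p x) c k := by
        intro x F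
        ext c
        change ∑ v : S, ∑ k, (Pi.single x F : S → Fin 3 → ℝ) v k * M.motion (p v) c k = _
        rw [Finset.sum_eq_single x (by intro b _ hb; simp [hb]) (by simp)]
        simp
      rw [map_sub, h1, h1]
      exact sum_dir_mul_motion M (p i) (p j) c
    · ext v k
      simp only [ext, LinearMap.coe_mk, AddHom.coe_mk, edgeRow]
      by_cases hv : v ∈ S
      · simp only [hv, dif_pos, Pi.sub_apply, Pi.single_apply, Subtype.mk.injEq]
      · have h1 : v ≠ i := fun e => hv (e ▸ hi)
        have h2 : v ≠ j := fun e => hv (e ▸ hj)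
        simp [hv, h1, h2]
  have h1 : rank M Γ ≤ Module.finrank ℝ (LinearMap.ker Ψ) :=
    (hp.rank_le Γ).trans ((Submodule.finrank_mono hle).trans (Submodule.finrank_map_le _ _))
  omega

lemma Independent.ncard_add_five_le {M : RigidityMatroid} {Γ : SimpleGraph V}
    (h : Independent M Γ) {S : Finset V} (hS : ∀ i j, Γ.Adj i j → i ∈ S) (hcard : 2 ≤ S.card) :
    Γ.edgeSet.ncard + 5 ≤ 3 * S.card :=
  h ▸ rank_add_five_le M hS hcard

end Motions

/-! ### Independent families of subspaces. -/

section DirectSum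

variable {E : Type*} [AddCommGroup E] [Module ℝ E] [FiniteDimensional ℝ E] {I : Type*} [Fintype I]

/-- The sum map from the product of a family of submodules. -/
noncomputable def sumMap (K : I → Submodule ℝ E) : (∀ i, K i) →ₗ[ℝ] E :=
  ∑ i, (K i).subtype ∘ₗ LinearMap.proj i

lemma sumMap_apply (K : I → Submodule ℝ E) (f : ∀ i, K i) : sumMap K f = ∑ i, (f i : E) := by
  simp [sumMap]

lemma finrank_range_sumMap {K : I → Submodule ℝ E}
    (h : ∀ f : I → E, (∀ i, f i ∈ K i) → ∑ i, f i = 0 → ∀ i, f i = 0) :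
    Module.finrank ℝ (LinearMap.range (sumMap K)) = ∑ i, Module.finrank ℝ (K i) := by
  have hinj : Function.Injective (sumMap K) := by
    rw [← LinearMap.ker_eq_bot, LinearMap.ker_eq_bot']
    intro f hf
    rw [sumMap_apply] at hf
    ext i
    exact h (fun i => f i) (fun i => (f i).2) hf i
  rw [LinearMap.finrank_range_of_inj hinj, Module.finrank_pi_fintype]

lemma range_sumMap_le {K : I → Submodule ℝ E} {L : Submodule ℝ E} (hL : ∀ i, K i ≤ L) :
    LinearMap.range (sumMap K) ≤ L := by
  rintro _ ⟨f, rfl⟩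
  rw [sumMap_apply]
  exact Submodule.sum_mem _ fun i _ => hL i (f i).2

lemma sum_finrank_le {K : I → Submodule ℝ E} {L : Submodule ℝ E}
    (h : ∀ f : I → E, (∀ i, f i ∈ K i) → ∑ i, f i = 0 → ∀ i, f i = 0) (hL : ∀ i, K i ≤ L) :
    ∑ i, Module.finrank ℝ (K i) ≤ Module.finrank ℝ L :=
  finrank_range_sumMap h ▸ Submodule.finrank_mono (range_sumMap_le hL)

/-- A direct sum whose dimension reaches that of an ambient subspace fills it. -/
lemma exists_sum_eq_of_finrank_le {K : I → Submodule ℝ E} {L : Submodule ℝ E}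
    (h : ∀ f : I → E, (∀ i, f i ∈ K i) → ∑ i, f i = 0 → ∀ i, f i = 0) (hL : ∀ i, K i ≤ L)
    (hle : Module.finrank ℝ L ≤ ∑ i, Module.finrank ℝ (K i)) {x : E} (hx : x ∈ L) :
    ∃ f : I → E, (∀ i, f i ∈ K i) ∧ ∑ i, f i = x := by
  have := Submodule.eq_of_le_of_finrank_le (range_sumMap_le hL)
    (hle.trans (finrank_range_sumMap h).ge)
  rw [← this] at hx
  obtain ⟨f, rfl⟩ := hx
  exact ⟨fun i => f i, fun i => (f i).2, (sumMap_apply K f).symm⟩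

end DirectSum

/-! ### Stresses of the clusters of a 2-thin cover. -/

section Cover

variable {V : Type*}

/-- The subgraph of `Γ` induced by the cluster `X`, as a graph on all vertices. -/
abbrev clusterGraph (Γ : SimpleGraph V) (X : Finset V) : SimpleGraph V :=
  (Γ.induce (X : Set V)).spanningCoe

lemma clusterGraph_adj {Γ : SimpleGraph V} {X : Finset V} {i j : V} :
    (clusterGraph Γ X).Adj i j ↔ Γ.Adj i j ∧ i ∈ X ∧ j ∈ X := by
  simp [clusterGraph]

lemma clusterGraph_le (Γ : SimpleGraph V) (X : Finset V) : clusterGraph Γ X ≤ Γ :=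
  fun _ _ h => (clusterGraph_adj.1 h).1

lemma edgeSet_sup_edge {G : SimpleGraph V} {x y : V} (hne : x ≠ y) :
    (G ⊔ SimpleGraph.edge x y).edgeSet = insert s(x, y) G.edgeSet := by
  rw [SimpleGraph.edgeSet_sup, SimpleGraph.edgeSet_edge_of_ne hne, Set.union_comm]; rfl

variable [DecidableEq V] {G : SimpleGraph V} {𝒳 : Finset (Finset V)}

lemma IsTwoThinCover.inter_eq_pair (h : IsTwoThinCover G 𝒳) {X Y : Finset V} (hX : X ∈ 𝒳)
    (hY : Y ∈ 𝒳) (hne : X ≠ Y) {i j : V} (hij : i ≠ j) (hiX : i ∈ X) (hjX : j ∈ X) (hiY : i ∈ Y)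
    (hjY : j ∈ Y) : X ∩ Y = {i, j} := by
  symm
  apply Finset.eq_of_subset_of_card_le
  · intro v hv
    rcases Finset.mem_insert.1 hv with rfl | hv
    · exact Finset.mem_inter.2 ⟨hiX, hiY⟩
    · rw [Finset.mem_singleton.1 hv]; exact Finset.mem_inter.2 ⟨hjX, hjY⟩
  · rw [Finset.card_pair hij]; exact h.inter_le X hX Y hY hne

lemma IsTwoThinCover.shared_adj (h : IsTwoThinCover G 𝒳) {X Y : Finset V} (hX : X ∈ 𝒳)
    (hY : Y ∈ 𝒳) (hne : X ≠ Y) {i j : V} (hij : i ≠ j) (hiX : i ∈ X) (hjX : j ∈ X) (hiY : i ∈ Y)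
    (hjY : j ∈ Y) : (sharedGraph 𝒳).Adj i j :=
  ⟨hij, X, hX, Y, hY, hne, h.inter_eq_pair hX hY hne hij hiX hjX hiY hjY⟩

variable [Fintype V]

lemma sum_ncard_clusterGraph (Γ : SimpleGraph V) [Fintype Γ.edgeSet] (𝒳 : Finset (Finset V)) :
    ∑ X ∈ 𝒳, (clusterGraph Γ X).edgeSet.ncard = ∑ e ∈ Γ.edgeFinset, clusterDegree 𝒳 e := by
  classical
  have h1 : ∀ X ∈ 𝒳, (clusterGraph Γ X).edgeSet.ncard =
      (Γ.edgeFinset.filter fun e => ∀ v ∈ e, v ∈ X).card := by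
    intro X _
    rw [← Set.ncard_coe_finset]
    congr 1
    ext e
    induction e with | _ i j => ?_
    simp
  rw [Finset.sum_congr rfl h1]
  simp only [clusterDegree, Finset.card_filter]
  rw [Finset.sum_comm]
  refine Finset.sum_congr rfl fun e _ => Finset.sum_congr rfl fun X _ => ?_
  split_ifs <;> rfl

-- Summing edges minus stresses over the clusters counts each edge as often as it is covered. Edges
-- outside `T` are covered once, since a pair in two clusters is shared; for pairs of `T` the
-- correction term removes the excess.
open Classical in
lemma ieCountWith_eq (M : RigidityMatroid) (hc : IsTwoThinCover G 𝒳) {T : SimpleGraph V}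
    (hT : sharedGraph 𝒳 ≤ T) {p : V → Fin M.dim → ℝ} (hp : IsGeneric M p) :
    ieCountWith M G 𝒳 T + ∑ X ∈ 𝒳, (Module.finrank ℝ (stressSpace M (clusterGraph (G ⊔ T) X) p) : ℤ)
      = (G ⊔ T).edgeSet.ncard := by
  have h1 : ∀ X ∈ 𝒳, (Module.finrank ℝ (stressSpace M (clusterGraph (G ⊔ T) X) p) : ℤ) +
      rank M (clusterGraph (G ⊔ T) X) = (clusterGraph (G ⊔ T) X).edgeSet.ncard := by
    intro X _
    exact_mod_cast hp.finrank_stressSpace (clusterGraph (G ⊔ T) X)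
  have h2 := Finset.sum_congr rfl h1
  rw [Finset.sum_add_distrib] at h2
  have h3' : (∑ X ∈ 𝒳, ((clusterGraph (G ⊔ T) X).edgeSet.ncard : ℤ)) =
      ∑ e ∈ (G ⊔ T).edgeFinset, (clusterDegree 𝒳 e : ℤ) := by
    exact_mod_cast sum_ncard_clusterGraph (G ⊔ T) 𝒳
  have hsub : T.edgeFinset ⊆ (G ⊔ T).edgeFinset := SimpleGraph.edgeFinset_mono le_sup_right
  have h4 : ∑ᶠ e ∈ T.edgeSet, ((clusterDegree 𝒳 e : ℤ) - 1) =
      ∑ e ∈ T.edgeFinset, ((clusterDegree 𝒳 e : ℤ) - 1) := by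
    rw [← SimpleGraph.coe_edgeFinset, finsum_mem_coe_finset]
  have h5 : ∑ e ∈ (G ⊔ T).edgeFinset \ T.edgeFinset, (clusterDegree 𝒳 e : ℤ) =
      ∑ e ∈ (G ⊔ T).edgeFinset \ T.edgeFinset, 1 := by
    refine Finset.sum_congr rfl fun e he => ?_
    induction e with | _ i j => ?_
    simp only [Finset.mem_sdiff, SimpleGraph.mem_edgeFinset, SimpleGraph.mem_edgeSet,
      SimpleGraph.sup_adj] at he
    obtain ⟨hGT, hnT⟩ := he
    have hG : G.Adj i j := hGT.resolve_right hnT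
    obtain ⟨X, hX, hi, hj⟩ := hc.covers i j hG
    have : clusterDegree 𝒳 s(i, j) = 1 := by
      rw [clusterDegree, Finset.card_eq_one]
      refine ⟨X, ?_⟩
      ext Y
      simp only [Finset.mem_filter, Sym2.mem_iff, forall_eq_or_imp, forall_eq,
        Finset.mem_singleton]
      constructor
      · rintro ⟨hY, hi', hj'⟩
        by_contra hne
        exact hnT (hT (hc.shared_adj hX hY (Ne.symm hne) hG.ne hi hj hi' hj'))
      · rintro rfl; exact ⟨hX, hi, hj⟩
    exact_mod_cast this
  have h6 := Finset.sum_sdiff (f := fun e => (clusterDegree 𝒳 e : ℤ)) hsub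
  have h7 := Finset.sum_sdiff (f := fun _ => (1 : ℤ)) hsub
  have h8 : ((G ⊔ T).edgeSet.ncard : ℤ) = ∑ e ∈ (G ⊔ T).edgeFinset, 1 := by
    rw [← SimpleGraph.coe_edgeFinset, Set.ncard_coe_finset]; simp
  rw [ieCountWith, h4, Finset.sum_sub_distrib, h8]
  linarith

variable {M : RigidityMatroid} {p : V → Fin M.dim → ℝ}

/-- Stresses of the clusters that add up to zero vanish if the shared set is independent. -/
lemma cluster_stress_eq_zero (hc : IsTwoThinCover G 𝒳) {Γ : SimpleGraph V}
    (hS : stressSpace M (sharedGraph 𝒳) p = ⊥) (f : 𝒳 → V → V → ℝ)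
    (hf : ∀ X : 𝒳, f X ∈ stressSpace M (clusterGraph Γ X) p) (h0 : ∑ X, f X = 0) (X : 𝒳) : f X = 0 := by
  rw [← Submodule.mem_bot ℝ, ← hS, mem_stressSpace]
  have hX := hf X
  rw [mem_stressSpace] at hX
  refine ⟨⟨hX.1.1, fun i j hij => ?_⟩, hX.2⟩
  by_contra hne
  have hadj : (clusterGraph Γ X).Adj i j := by
    by_contra h; exact hne (hX.1.2 i j h)
  have h1 : ∑ Y, f Y i j = 0 := by
    have := congrFun (congrFun h0 i) j
    simpa [Finset.sum_apply] using this
  rw [Finset.sum_eq_single X ?_ (by simp)] at h1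
  · exact hne h1
  · intro Y _ hYX
    by_contra hY0
    have hY : (clusterGraph Γ Y).Adj i j := by
      by_contra h; exact hY0 ((mem_stressSpace.1 (hf Y)).1.2 i j h)
    rw [clusterGraph_adj] at hadj hY
    exact hij (hc.shared_adj X.2 Y.2 (fun e => hYX (Subtype.ext e.symm)) hadj.1.ne hadj.2.1
      hadj.2.2 hY.2.1 hY.2.2)

/-- If a graph attains the inclusion-exclusion count of an independent cover, then the dimensions of
the stress spaces of the clusters add up to the number of shared nonedges. -/
lemma sum_finrank_cluster (hc : IsTwoThinCover G 𝒳) (hG : Independent M G)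
    (hr : (rank M G : ℤ) = ieCount M G 𝒳) (hp : IsGeneric M p) :
    ∑ X ∈ 𝒳, Module.finrank ℝ (stressSpace M (clusterGraph (G ⊔ sharedGraph 𝒳) X) p) +
      G.edgeSet.ncard = (G ⊔ sharedGraph 𝒳).edgeSet.ncard := by
  have h1 := ieCountWith_eq M hc le_rfl hp
  rw [ieCount, hG] at hr
  rw [← hr] at h1
  zify
  linarith

/-- The cluster stresses fill the whole stress space of `G ∪ S`, so `G ∪ S` has the same rank as
`G`. Hence `G + xy` has a stress, nonzero on `xy` because `G` is independent; normalised there, it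
is a sum of cluster stresses. -/
lemma exists_cluster_stresses (hc : IsTwoThinCover G 𝒳) (hG : Independent M G)
    (hS : Independent M (sharedGraph 𝒳)) (hr : (rank M G : ℤ) = ieCount M G 𝒳)
    (hp : IsGeneric M p) {x y : V} (hxy : (sharedGraph 𝒳).Adj x y) (hn : ¬ G.Adj x y) :
    ∃ f : 𝒳 → V → V → ℝ,
      (∀ X : 𝒳, f X ∈ stressSpace M (clusterGraph (G ⊔ sharedGraph 𝒳) X) p) ∧
      ∑ X, f X x y = 1 ∧ ∀ u w, ¬ G.Adj u w → s(u, w) ≠ s(x, y) → ∑ X, f X u w = 0 := by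
  have hsum := sum_finrank_cluster hc hG hr hp
  rw [← Finset.sum_coe_sort] at hsum
  have hinj := cluster_stress_eq_zero (Γ := G ⊔ sharedGraph 𝒳) hc (hp.stressSpace_eq_bot hS)
  have hle : ∀ X : 𝒳, stressSpace M (clusterGraph (G ⊔ sharedGraph 𝒳) X) p ≤
      stressSpace M (G ⊔ sharedGraph 𝒳) p := fun X => stressSpace_mono (clusterGraph_le _ _) p
  have h1 := sum_finrank_le hinj hle
  have h2 := hp.finrank_stressSpace (G ⊔ sharedGraph 𝒳)
  have h3 : rank M G ≤ rank M (G ⊔ sharedGraph 𝒳) := rank_mono le_sup_left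
  have hG' := hG
  rw [Independent] at hG'
  have hexle : G ⊔ SimpleGraph.edge x y ≤ G ⊔ sharedGraph 𝒳 :=
    sup_le_sup_left (by rw [SimpleGraph.edge_le_iff]; exact Or.inr hxy) _
  have h4 : rank M (G ⊔ SimpleGraph.edge x y) ≤ rank M (G ⊔ sharedGraph 𝒳) := rank_mono hexle
  have h5 := hp.finrank_stressSpace (G ⊔ SimpleGraph.edge x y)
  have h6 : (G ⊔ SimpleGraph.edge x y).edgeSet.ncard = G.edgeSet.ncard + 1 := by
    rw [edgeSet_sup_edge hxy.ne]
    exact Set.ncard_insert_of_notMem hn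
  have h7 : stressSpace M (G ⊔ SimpleGraph.edge x y) p ≠ ⊥ := by
    intro h
    rw [h, finrank_bot] at h5
    omega
  obtain ⟨ω, hω, hω0⟩ := Submodule.exists_mem_ne_zero_of_ne_bot h7
  have hsupp : ∀ u w, ¬ G.Adj u w → s(u, w) ≠ s(x, y) → ω u w = 0 := by
    intro u w hu hne
    refine (mem_stressSpace.1 hω).1.2 u w ?_
    rw [SimpleGraph.sup_adj, SimpleGraph.edge_adj]
    rintro (h | h)
    · exact hu h
    · exact hne (Sym2.eq_iff.2 h.1)
  have hωxy : ω x y ≠ 0 := by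
    intro h0
    apply hω0
    rw [← Submodule.mem_bot ℝ, ← hp.stressSpace_eq_bot hG, mem_stressSpace]
    refine ⟨⟨(mem_stressSpace.1 hω).1.1, fun u w hu => ?_⟩, (mem_stressSpace.1 hω).2⟩
    by_cases he : s(u, w) = s(x, y)
    · rcases Sym2.eq_iff.1 he with ⟨rfl, rfl⟩ | ⟨rfl, rfl⟩
      · exact h0
      · rw [(mem_stressSpace.1 hω).1.1, h0, mul_zero]
    · exact hsupp u w hu he
  obtain ⟨f, hf, hfs⟩ := exists_sum_eq_of_finrank_le hinj hle (by omega)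
    (Submodule.smul_mem _ (ω x y)⁻¹ (stressSpace_mono hexle p hω))
  have hval : ∀ u w, ∑ X, f X u w = (ω x y)⁻¹ * ω u w := by
    intro u w
    have := congrFun (congrFun hfs u) w
    simpa [Finset.sum_apply] using this
  refine ⟨f, hf, ?_, fun u w hu hne => ?_⟩
  · rw [hval, inv_mul_cancel₀ hωxy]
  · rw [hval, hsupp u w hu hne, mul_zero]

/-- If a vertex `b` has no neighbour in a cluster `X` of a tight independent cover, then (under the
agreement condition of safe splits) it is in no shared pair of `X` except possibly `{a, b}`. -/
lemma shared_eq_of_no_neighbor (hc : IsTwoThinCover G 𝒳) (hG : Independent M G)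
    (hS : Independent M (sharedGraph 𝒳)) (hr : (rank M G : ℤ) = ieCount M G 𝒳)
    {a b : V} (hab : a ≠ b) (hagree : ∀ X ∈ 𝒳, ∀ Y ∈ 𝒳, X ≠ Y → ∀ u, u ≠ a → u ≠ b → X ∩ Y = {b, u} →
      ¬ G.Adj b u → ((∃ x ∈ X, G.Adj b x) ↔ ∃ x ∈ Y, G.Adj b x))
    {X : Finset V} (hX : X ∈ 𝒳) (hbX : b ∈ X) (hn : ∀ x ∈ X, ¬ G.Adj b x) {x : V} (hxX : x ∈ X)
    (hbx : (sharedGraph 𝒳).Adj b x) : x = a := by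
  classical
  by_contra hxa
  obtain ⟨p, hp⟩ := (zariskiDense_isGeneric (V := V) M).nonempty
  obtain ⟨f, hf, h1, h0⟩ := exists_cluster_stresses hc hG hS hr hp hbx (hn x hxX)
  -- Only clusters in which `b` has no neighbour are summed. By agreement, a shared nonedge `{b, y}`
  -- with `y ≠ a` has all of its clusters in `Z` or none, so at `b` the partial sum is 1 on `x`,
  -- unknown on `a` and zero elsewhere.
  let Z : Finset 𝒳 := Finset.univ.filter fun Y => ¬ ∃ x ∈ Y.1, G.Adj b x
  have hval : ∀ y, y ≠ a → ∑ Y ∈ Z, f Y b y = if y = x then 1 else 0 := by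
    intro y hya
    have hmem : ∀ Y : 𝒳, f Y b y ≠ 0 → b ∈ Y.1 ∧ y ∈ Y.1 ∧ b ≠ y := by
      intro Y hY
      have : (clusterGraph (G ⊔ sharedGraph 𝒳) Y).Adj b y := by
        by_contra h; exact hY ((mem_stressSpace.1 (hf Y)).1.2 b y h)
      exact ⟨(clusterGraph_adj.1 this).2.1, (clusterGraph_adj.1 this).2.2, this.ne⟩
    by_cases hby : G.Adj b y
    · rw [if_neg (by rintro rfl; exact hn y hxX hby)]
      refine Finset.sum_eq_zero fun Y hY => ?_
      by_contra hne
      exact (Finset.mem_filter.1 hY).2 ⟨y, (hmem Y hne).2.1, hby⟩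
    by_cases hex : ∃ Y ∈ Z, b ∈ Y.1 ∧ y ∈ Y.1
    · obtain ⟨Y, hYZ, hbY, hyY⟩ := hex
      have hall : ∑ Y ∈ Z, f Y b y = ∑ Y, f Y b y := by
        refine Finset.sum_subset (Finset.subset_univ _) fun Y' _ hY' => ?_
        by_contra hne
        obtain ⟨hbY', hyY', hby'⟩ := hmem Y' hne
        have hYY' : Y.1 ≠ Y'.1 := fun e => hY' (Subtype.ext e ▸ hYZ)
        have hiff := hagree Y Y.2 Y' Y'.2 hYY' y hya hby'.symm
          (hc.inter_eq_pair Y.2 Y'.2 hYY' hby' hbY hyY hbY' hyY') hby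
        exact hY' (Finset.mem_filter.2 ⟨Finset.mem_univ _,
          fun h => (Finset.mem_filter.1 hYZ).2 (hiff.2 h)⟩)
      rw [hall]
      split_ifs with hyx
      · rw [hyx, h1]
      · refine h0 b y hby fun e => ?_
        rcases Sym2.eq_iff.1 e with h | h
        · exact hyx h.2
        · exact hbx.ne h.1
    · rw [if_neg]
      · refine Finset.sum_eq_zero fun Y hY => ?_
        by_contra hne
        exact hex ⟨Y, hY, (hmem Y hne).1, (hmem Y hne).2.1⟩
      · rintro rfl
        refine hex ⟨⟨X, hX⟩, Finset.mem_filter.2 ⟨Finset.mem_univ _, ?_⟩, hbX, hxX⟩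
        rintro ⟨z, hz, h⟩
        exact hn z hz h
  have hload : ∑ Y ∈ Z, load M p (f Y) b = 0 :=
    Finset.sum_eq_zero fun Y _ => (mem_stressSpace.1 (hf Y)).2 b
  have hload' : ∑ j, (∑ Y ∈ Z, f Y b j) • M.dir (p b) (p j) = 0 := by
    rw [← hload]
    simp only [load, Finset.sum_smul]
    exact Finset.sum_comm
  have h2 : ∑ j, (∑ Y ∈ Z, f Y b j) • M.dir (p b) (p j) =
      (1 : ℝ) • M.dir (p b) (p x) + (∑ Y ∈ Z, f Y b a) • M.dir (p b) (p a) := by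
    rw [← Finset.add_sum_erase _ _ (Finset.mem_univ a), add_comm]
    congr 1
    rw [Finset.sum_eq_single x]
    · rw [hval x hxa, if_pos rfl]
    · intro y hy hyx
      rw [hval y (Finset.ne_of_mem_erase hy), if_neg hyx, zero_smul]
    · intro h; exact absurd (Finset.mem_erase.2 ⟨hxa, Finset.mem_univ x⟩) h
  -- Equilibrium at `b` would be a relation between two independent directions with coefficient 1 on
  -- the first.
  have h3 := LinearIndependent.pair_iff.1 (hp.dir_indep b x a hbx.ne (Ne.symm hab) hxa) _ _
    (h2.symm.trans hload')
  exact one_ne_zero h3.1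

end Cover

/-! ### Implied nonedges from rank. -/

section Implied

variable {V : Type*} [Fintype V]

lemma exists_isCircuit {M : RigidityMatroid} {Γ : SimpleGraph V} (h : ¬ Independent M Γ) :
    ∃ C ≤ Γ, IsCircuit M C := by
  obtain ⟨C, hC, hmin⟩ := exists_minimal_le_of_wellFoundedLT (fun C => ¬ Independent M C) Γ h
  exact ⟨C, hC, hmin.prop, fun D hD => by
    by_contra hD'
    exact hD.not_ge (hmin.le_of_le hD' hD.le)⟩

/-- `Γ + xy` has more edges than the rank of `Ω` allows, and a circuit in it cannot avoid `xy` since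
`Γ` is independent. -/
lemma isImpliedNonedge_of_rank_le {M : RigidityMatroid} {Γ Ω : SimpleGraph V}
    (hΓ : Independent M Γ) (hle : Γ ≤ Ω) (hr : rank M Ω ≤ Γ.edgeSet.ncard) {x y : V}
    (hxy : Ω.Adj x y) (hn : ¬ Γ.Adj x y) : IsImpliedNonedge M Γ x y := by
  refine ⟨hxy.ne, hn, ?_⟩
  have hdep : ¬ Independent M (Γ ⊔ SimpleGraph.edge x y) := by
    intro h
    have h1 : rank M (Γ ⊔ SimpleGraph.edge x y) ≤ rank M Ω :=
      rank_mono (sup_le hle (by rw [SimpleGraph.edge_le_iff]; exact Or.inr hxy))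
    rw [h, edgeSet_sup_edge hxy.ne,
      Set.ncard_insert_of_notMem (show s(x, y) ∉ Γ.edgeSet from hn)] at h1
    omega
  obtain ⟨C, hC, hcirc⟩ := exists_isCircuit hdep
  refine ⟨C, hC, ?_, hcirc⟩
  by_contra hCxy
  refine hcirc.1 (hΓ.mono fun u w huw => ?_)
  have := hC huw
  rw [SimpleGraph.sup_adj, SimpleGraph.edge_adj] at this
  rcases this with h | ⟨⟨rfl, rfl⟩ | ⟨rfl, rfl⟩, -⟩
  · exact h
  · exact absurd huw hCxy
  · exact absurd huw.symm hCxy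

end Implied

/-! ### Adjacency in a glue. -/

section Glue

variable {U W : Type*} {A : Finset U} {B : Finset W} (φ : A ≃ B)

lemma glueRight_of_mem {w : W} (h : w ∈ B) : glueRight φ w = Sum.inl (φ.symm ⟨w, h⟩ : U) := by
  simp [glueRight, h]

lemma glueRight_of_notMem {w : W} (h : w ∉ B) : glueRight φ w = Sum.inr ⟨w, h⟩ := by
  simp [glueRight, h]

lemma glueRight_apply (s : A) : glueRight φ (φ s) = Sum.inl (s : U) := by
  rw [glueRight_of_mem φ (φ s).2]; simp

lemma glueRight_injective : Function.Injective (glueRight φ) := by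
  intro x y h
  by_cases hx : x ∈ B <;> by_cases hy : y ∈ B
  · rw [glueRight_of_mem φ hx, glueRight_of_mem φ hy, Sum.inl.injEq] at h
    simpa using φ.symm.injective (Subtype.ext h)
  · rw [glueRight_of_mem φ hx, glueRight_of_notMem φ hy] at h; simp at h
  · rw [glueRight_of_notMem φ hx, glueRight_of_mem φ hy] at h; simp at h
  · rw [glueRight_of_notMem φ hx, glueRight_of_notMem φ hy] at h; simpa using h

lemma glueRight_eq_inl {w : W} {s : U} (h : glueRight φ w = Sum.inl s) : w ∈ B ∧ s ∈ A := by
  by_cases hw : w ∈ B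
  · rw [glueRight_of_mem φ hw, Sum.inl.injEq] at h
    exact ⟨hw, h ▸ (φ.symm ⟨w, hw⟩).2⟩
  · rw [glueRight_of_notMem φ hw] at h; simp at h

variable (G : SimpleGraph U) (H : SimpleGraph W)

lemma glue_adj_left {s t : U} (h : G.Adj s t) : (glue G H φ).Adj (Sum.inl s) (Sum.inl t) :=
  Or.inl ⟨by simpa using h.ne, s, t, h, rfl, rfl⟩

lemma glue_adj_right {x y : W} (h : H.Adj x y) :
    (glue G H φ).Adj (glueRight φ x) (glueRight φ y) :=
  Or.inr ⟨(glueRight_injective φ).ne h.ne, x, y, h, rfl, rfl⟩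

/-- The first graph has no edges among the gluing vertices, so it adds none on the side of `H`. -/
lemma glue_adj_right_iff (hA : ∀ s ∈ A, ∀ t ∈ A, ¬ G.Adj s t) {x y : W} :
    (glue G H φ).Adj (glueRight φ x) (glueRight φ y) ↔ H.Adj x y := by
  refine ⟨?_, glue_adj_right φ G H⟩
  rintro (⟨-, s, t, hst, hs, ht⟩ | ⟨-, x', y', h, hx, hy⟩)
  · exact absurd hst (hA s (glueRight_eq_inl φ hs.symm).2 t (glueRight_eq_inl φ ht.symm).2)
  · rwa [← glueRight_injective φ hx, ← glueRight_injective φ hy]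

lemma glue_adj_left_iff (hB : ∀ x ∈ B, ∀ y ∈ B, ¬ H.Adj x y) {s t : U} :
    (glue G H φ).Adj (Sum.inl s) (Sum.inl t) ↔ G.Adj s t := by
  refine ⟨?_, glue_adj_left φ G H⟩
  rintro (⟨-, s', t', hst, hs, ht⟩ | ⟨-, x', y', h, hx, hy⟩)
  · rwa [← Sum.inl_injective hs, ← Sum.inl_injective ht]
  · exact absurd h (hB _ (glueRight_eq_inl φ hx).1 _ (glueRight_eq_inl φ hy).1)

end Glue

/-! ### Clusters in the split graph. -/

section Split

variable {V : Type*} [DecidableEq V] (a b : V)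

/-- The section of the collapse of the split vertices that uses the copies `i` of `a` and `j`
of `b`. -/
def splitSection (i j : Fin 2) (v : V) : SplitVertex a b :=
  if h₁ : v = a then newA a b i else if h₂ : v = b then newB a b j else Sum.inl ⟨v, h₁, h₂⟩

/-- The collapse that identifies the two copies of `a` and the two copies of `b`. -/
def collapse : SplitVertex a b → V
  | .inl x => x
  | .inr (.inl _) => a
  | .inr (.inr _) => b

variable {a b}

lemma collapse_splitSection (i j : Fin 2) (v : V) : collapse a b (splitSection a b i j v) = v := by
  unfold splitSection
  split_ifs with h1 h2
  · exact h1.symm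
  · exact h2.symm
  · rfl

lemma splitSection_injective (i j : Fin 2) : Function.Injective (splitSection a b i j) :=
  Function.LeftInverse.injective (collapse_splitSection i j)

lemma splitSection_a (i j : Fin 2) : splitSection a b i j a = newA a b i := by simp [splitSection]

lemma splitSection_b (hab : a ≠ b) (i j : Fin 2) : splitSection a b i j b = newB a b j := by
  simp [splitSection, hab.symm]

lemma splitSection_of_ne {v : V} (h₁ : v ≠ a) (h₂ : v ≠ b) (i j : Fin 2) :
    splitSection a b i j v = Sum.inl ⟨v, h₁, h₂⟩ := by simp [splitSection, h₁, h₂]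

lemma mem_newVertices {s : SplitVertex a b} : s ∈ newVertices a b ↔ ∃ n, s = Sum.inr n := by
  constructor
  · simp only [newVertices, Finset.mem_insert, Finset.mem_singleton]
    rintro (rfl | rfl | rfl | rfl) <;> exact ⟨_, rfl⟩
  · rintro ⟨n | n, rfl⟩ <;> fin_cases n <;> simp [newVertices]

variable {G : SimpleGraph V} {α β : V → Fin 2}

lemma splitGraph_new_new {s t : SplitVertex a b} (hs : s ∈ newVertices a b)
    (ht : t ∈ newVertices a b) : ¬ (splitGraph G a b α β).Adj s t := by
  obtain ⟨m, rfl⟩ := mem_newVertices.1 hs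
  obtain ⟨n, rfl⟩ := mem_newVertices.1 ht
  exact fun h => h

variable [Fintype V] (G α β)

open Classical in
/-- The copy of `a` in the image of the cluster `X`. -/
noncomputable def copyA (a b : V) (α β : V → Fin 2) (X : Finset V) : Fin 2 :=
  -- If the image contains no copy of `a`, the value 0 is a dummy. It depends only on membership in
  -- the image, so clusters that agree on the copies receive the same value.
  if newA a b 1 ∈ splitCluster G a b α β X then 1 else 0

open Classical in
/-- The copy of `b` in the image of the cluster `X`. -/
noncomputable def copyB (a b : V) (α β : V → Fin 2) (X : Finset V) : Fin 2 :=
  if newB a b 1 ∈ splitCluster G a b α β X then 1 else 0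

/-- The embedding of the vertices that uses the copies in the image of the cluster `X`. -/
noncomputable def clusterSection (a b : V) (α β : V → Fin 2) (X : Finset V) : V → SplitVertex a b :=
  splitSection a b (copyA G a b α β X) (copyB G a b α β X)

variable {G α β} {X Y : Finset V}

lemma copyA_eq (h : ¬ HasBothCopies (splitCluster G a b α β X)) {i : Fin 2}
    (hi : newA a b i ∈ splitCluster G a b α β X) : copyA G a b α β X = i := by
  unfold copyA
  fin_cases i
  · exact if_neg fun h1 => h (Or.inl ⟨hi, h1⟩)
  · exact if_pos hi

lemma copyB_eq (h : ¬ HasBothCopies (splitCluster G a b α β X)) {i : Fin 2}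
    (hi : newB a b i ∈ splitCluster G a b α β X) : copyB G a b α β X = i := by
  unfold copyB
  fin_cases i
  · exact if_neg fun h1 => h (Or.inr ⟨hi, h1⟩)
  · exact if_pos hi

lemma mem_splitCluster {s : SplitVertex a b} :
    s ∈ splitCluster G a b α β X ↔ MemSplitCluster G a b α β X s := by simp [splitCluster]

lemma newA_mem_splitCluster {x : V} (ha : a ∈ X) (hx : x ∈ X) (h : G.Adj a x) :
    newA a b (α x) ∈ splitCluster G a b α β X :=
  mem_splitCluster.2 ⟨ha, x, hx, h, rfl⟩

lemma newB_mem_splitCluster {x : V} (hb : b ∈ X) (hx : x ∈ X) (h : G.Adj b x) :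
    newB a b (β x) ∈ splitCluster G a b α β X :=
  mem_splitCluster.2 ⟨hb, x, hx, h, rfl⟩

lemma exists_adj_of_newA_mem {i : Fin 2} (h : newA a b i ∈ splitCluster G a b α β X) :
    ∃ x ∈ X, G.Adj a x := by
  obtain ⟨-, x, hx, h, -⟩ := mem_splitCluster.1 h
  exact ⟨x, hx, h⟩

lemma exists_adj_of_newB_mem {i : Fin 2} (h : newB a b i ∈ splitCluster G a b α β X) :
    ∃ x ∈ X, G.Adj b x := by
  obtain ⟨-, x, hx, h, -⟩ := mem_splitCluster.1 h
  exact ⟨x, hx, h⟩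

lemma copyA_mem_splitCluster (hab : a ∈ X) (h : ∃ x ∈ X, G.Adj a x)
    (hn : ¬ HasBothCopies (splitCluster G a b α β X)) :
    newA a b (copyA G a b α β X) ∈ splitCluster G a b α β X := by
  obtain ⟨x, hx, hax⟩ := h
  have := newA_mem_splitCluster (b := b) (α := α) (β := β) hab hx hax
  rwa [copyA_eq hn this]

lemma copyB_mem_splitCluster (hab : b ∈ X) (h : ∃ x ∈ X, G.Adj b x)
    (hn : ¬ HasBothCopies (splitCluster G a b α β X)) :
    newB a b (copyB G a b α β X) ∈ splitCluster G a b α β X := by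
  obtain ⟨x, hx, hax⟩ := h
  have := newB_mem_splitCluster (a := a) (α := α) (β := β) hab hx hax
  rwa [copyB_eq hn this]

/-- Edges of a cluster that is not torn apart stay edges in the split graph. -/
lemma splitGraph_adj_clusterSection (hab : ¬ G.Adj a b)
    (hn : ¬ HasBothCopies (splitCluster G a b α β X)) {u w : V} (hu : u ∈ X) (hw : w ∈ X)
    (h : G.Adj u w) : (splitGraph G a b α β).Adj (clusterSection G a b α β X u)
      (clusterSection G a b α β X w) := by
  have haw : ∀ {w}, w ∈ X → a ∈ X → G.Adj a w → (splitGraph G a b α β).Adj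
      (clusterSection G a b α β X w) (clusterSection G a b α β X a) := by
    intro w hw ha h
    have h1 : w ≠ a := h.ne'
    have h2 : w ≠ b := by rintro rfl; exact hab h
    rw [clusterSection, splitSection_of_ne h1 h2, splitSection_a,
      copyA_eq hn (newA_mem_splitCluster ha hw h)]
    exact ⟨h, rfl⟩
  have hbw : ∀ {w}, w ∈ X → b ∈ X → G.Adj b w → (splitGraph G a b α β).Adj
      (clusterSection G a b α β X w) (clusterSection G a b α β X b) := by
    intro w hw hb h
    have h1 : w ≠ b := h.ne'
    have h2 : w ≠ a := by rintro rfl; exact hab h.symm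
    by_cases hab' : a = b
    · subst hab'; exact haw hw hb h
    rw [clusterSection, splitSection_of_ne h2 h1, splitSection_b hab',
      copyB_eq hn (newB_mem_splitCluster hb hw h)]
    exact ⟨h, rfl⟩
  by_cases hua : u = a
  · subst hua; exact (haw hw hu h).symm
  by_cases hub : u = b
  · subst hub; exact (hbw hw hu h).symm
  by_cases hwa : w = a
  · subst hwa; exact haw hu hw h.symm
  by_cases hwb : w = b
  · subst hwb; exact hbw hu hw h.symm
  rw [clusterSection, splitSection_of_ne hua hub, splitSection_of_ne hwa hwb]
  exact h

variable {𝒳 : Finset (Finset V)}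

/-- The image of a shared nonedge other than `{a, b}` does not depend on the cluster. -/
lemma clusterSection_congr (hs : IsSafeNonedgeSplit G 𝒳 a b α β) (hX : X ∈ 𝒳) (hY : Y ∈ 𝒳)
    {u w : V} (huw : u ≠ w) (hn : ¬ G.Adj u w) (hne : s(u, w) ≠ s(a, b)) (huX : u ∈ X) (hwX : w ∈ X)
    (huY : u ∈ Y) (hwY : w ∈ Y) :
    clusterSection G a b α β X u = clusterSection G a b α β Y u := by
  by_cases hXY : X = Y
  · rw [hXY]
  have hint := hs.cover.inter_eq_pair hX hY hXY huw huX hwX huY hwY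
  by_cases hua : u = a
  · subst hua
    have hwb : w ≠ b := by rintro rfl; exact hne rfl
    have h := hs.agree_a X hX Y hY hXY w huw.symm hwb hint hn
    rw [clusterSection, clusterSection, splitSection_a, splitSection_a, copyA, copyA]
    simp only [h 1]
  by_cases hub : u = b
  · subst hub
    have hwa : w ≠ a := by rintro rfl; exact hne Sym2.eq_swap
    have h := hs.agree_b X hX Y hY hXY w hwa huw.symm hint hn
    rw [clusterSection, clusterSection, splitSection_b (Ne.symm hua), splitSection_b (Ne.symm hua),
      copyB, copyB]
    simp only [h 1]
  rw [clusterSection, clusterSection, splitSection_of_ne hua hub, splitSection_of_ne hua hub]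

end Split

/-! ### Stressed clusters survive a safe split. -/

section Key

variable {V : Type*} [Fintype V] [DecidableEq V] {M : RigidityMatroid} {G : SimpleGraph V}
  {𝒳 : Finset (Finset V)} {a b : V} {α β : V → Fin 2}

lemma stress_adj {Γ : SimpleGraph V} {p : V → Fin M.dim → ℝ} {ω : V → V → ℝ}
    (hω : ω ∈ stressSpace M Γ p) {u w : V} (h : ω u w ≠ 0) : Γ.Adj u w := by
  by_contra hn; exact h ((mem_stressSpace.1 hω).1.2 u w hn)

/-- A cluster with a nonzero stress is not torn apart by a safe split. -/
lemma not_hasBothCopies_of_stress (hs : IsSafeNonedgeSplit G 𝒳 a b α β) (hG : Independent M G)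
    {p : V → Fin M.dim → ℝ} (hp : IsGeneric M p) {X : Finset V} (hX : X ∈ 𝒳) {ω : V → V → ℝ}
    (hω : ω ∈ stressSpace M (clusterGraph (G ⊔ sharedGraph 𝒳) X) p) (h0 : ω ≠ 0) :
    ¬ HasBothCopies (splitCluster G a b α β X) := by
  refine hs.not_both X hX ?_
  -- A cluster without a shared nonedge spans a subgraph of the independent graph `G` and carries no
  -- stress.
  by_contra hn
  push Not at hn
  apply h0
  rw [← Submodule.mem_bot ℝ, ← hp.stressSpace_eq_bot hG]
  refine stressSpace_mono (fun u w h => ?_) p hω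
  obtain ⟨h | h, hu, hw⟩ := clusterGraph_adj.1 h
  · exact h
  · exact hn u hu w hw h

lemma IsSafeBase.ne (hb : IsSafeBase M G 𝒳 a b α β) : a ≠ b := hb.safe_split.shared.ne

/-- If the shared pair `{a, b}` carries stress in a cluster, then `a` has a neighbour there. -/
lemma exists_adj_of_stress (hc : IsTwoThinCover G 𝒳) (hG : Independent M G)
    (hS : Independent M (sharedGraph 𝒳)) (hr : (rank M G : ℤ) = ieCount M G 𝒳)
    (hab : (sharedGraph 𝒳).Adj a b)
    (hagree : ∀ X ∈ 𝒳, ∀ Y ∈ 𝒳, X ≠ Y → ∀ u, u ≠ b → u ≠ a → X ∩ Y = {a, u} →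
      ¬ G.Adj a u → ((∃ x ∈ X, G.Adj a x) ↔ ∃ x ∈ Y, G.Adj a x))
    {p : V → Fin M.dim → ℝ} (hp : IsGeneric M p) {X : Finset V} (hX : X ∈ 𝒳) {ω : V → V → ℝ}
    (hω : ω ∈ stressSpace M (clusterGraph (G ⊔ sharedGraph 𝒳) X) p) (h0 : ω a b ≠ 0) :
    ∃ x ∈ X, G.Adj a x := by
  by_contra hn
  push Not at hn
  have haX := (clusterGraph_adj.1 (stress_adj hω h0)).2.1
  have key : ∀ x ∈ X, (sharedGraph 𝒳).Adj a x → x = b := fun x hx hax =>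
    shared_eq_of_no_neighbor hc hG hS hr hab.ne.symm hagree hX haX hn hx hax
  have hload := (mem_stressSpace.1 hω).2 a
  rw [load, Finset.sum_eq_single b] at hload
  -- Only the term of `b` is left in the load at `a`. A third vertex `c` is needed just to read off
  -- from general position that the direction `ab` is nonzero.
  · obtain ⟨c, hc⟩ : ∃ c, c ≠ a ∧ c ≠ b := by
      obtain ⟨-, Y, hY, Z, hZ, hYZ, hint⟩ := hab
      have : ¬ Y ⊆ {a, b} := fun h => hc.not_subset Y hY Z hZ hYZ
        (h.trans (hint ▸ Finset.inter_subset_right))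
      obtain ⟨c, hc, hc'⟩ := Finset.not_subset.1 this
      exact ⟨c, by simpa using hc'⟩
    have h2 := LinearIndependent.pair_iff.1 (hp.dir_indep a b c hab.ne hc.1.symm hc.2.symm)
      (ω a b) 0 (by simpa using hload)
    exact h0 h2.1
  · intro x _ hxb
    by_contra hne
    have hax : ω a x ≠ 0 := fun h => hne (by rw [h, zero_smul])
    obtain ⟨h | h, -, hx⟩ := clusterGraph_adj.1 (stress_adj hω hax)
    · exact hn x hx h
    · exact hxb (key x hx h)
  · simp

/-- A cluster containing `a` has a neighbour of `a` exactly when its image has a copy of `a`, so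
agreement on copies passes to agreement on neighbours. -/
lemma agree_neighbor_a (hs : IsSafeNonedgeSplit G 𝒳 a b α β) : ∀ X ∈ 𝒳, ∀ Y ∈ 𝒳, X ≠ Y →
    ∀ u, u ≠ b → u ≠ a → X ∩ Y = {a, u} → ¬ G.Adj a u →
      ((∃ x ∈ X, G.Adj a x) ↔ ∃ x ∈ Y, G.Adj a x) := by
  intro X hX Y hY hXY u hub hua hint hnu
  have ha : a ∈ X ∩ Y := hint ▸ Finset.mem_insert_self _ _
  have := hs.agree_a X hX Y hY hXY u hua hub hint hnu
  constructor
  · rintro ⟨x, hx, hax⟩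
    exact exists_adj_of_newA_mem ((this _).1
      (newA_mem_splitCluster (Finset.mem_inter.1 ha).1 hx hax))
  · rintro ⟨x, hx, hax⟩
    exact exists_adj_of_newA_mem ((this _).2
      (newA_mem_splitCluster (Finset.mem_inter.1 ha).2 hx hax))

lemma agree_neighbor_b (hs : IsSafeNonedgeSplit G 𝒳 a b α β) : ∀ X ∈ 𝒳, ∀ Y ∈ 𝒳, X ≠ Y →
    ∀ u, u ≠ a → u ≠ b → X ∩ Y = {b, u} → ¬ G.Adj b u →
      ((∃ x ∈ X, G.Adj b x) ↔ ∃ x ∈ Y, G.Adj b x) := by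
  intro X hX Y hY hXY u hua hub hint hnu
  have ha : b ∈ X ∩ Y := hint ▸ Finset.mem_insert_self _ _
  have := hs.agree_b X hX Y hY hXY u hua hub hint hnu
  constructor
  · rintro ⟨x, hx, hax⟩
    exact exists_adj_of_newB_mem ((this _).1
      (newB_mem_splitCluster (Finset.mem_inter.1 ha).1 hx hax))
  · rintro ⟨x, hx, hax⟩
    exact exists_adj_of_newB_mem ((this _).2
      (newB_mem_splitCluster (Finset.mem_inter.1 ha).2 hx hax))

/-- A cluster in which the pair `{a, b}` carries stress yields a key gluing pair. -/
lemma keyPairs_of_stress (hb : IsSafeBase M G 𝒳 a b α β) {p : V → Fin M.dim → ℝ}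
    (hp : IsGeneric M p) {X : Finset V} (hX : X ∈ 𝒳) {ω : V → V → ℝ}
    (hω : ω ∈ stressSpace M (clusterGraph (G ⊔ sharedGraph 𝒳) X) p) (h0 : ω a b ≠ 0) :
    (keyPairs (safeSplitCover G 𝒳 a b α β) (newVertices a b)).Adj
      (clusterSection G a b α β X a) (clusterSection G a b α β X b) := by
  classical
  have hs := hb.safe_split
  have hne := hs.shared.ne
  have hab := (clusterGraph_adj.1 (stress_adj hω h0)).2
  have hn := not_hasBothCopies_of_stress hs hb.indep hp hX hω (by rintro rfl; exact h0 rfl)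
  have h0' : ω b a ≠ 0 := by
    rw [(mem_stressSpace.1 hω).1.1 a b]; exact mul_ne_zero (sgn_ne_zero M) h0
  have h1 := exists_adj_of_stress hs.cover hb.indep hb.cover_indep hb.rank_eq hs.shared
    (agree_neighbor_a hs) hp hX hω h0
  have h2 := exists_adj_of_stress hs.cover hb.indep hb.cover_indep hb.rank_eq hs.shared.symm
    (agree_neighbor_b hs) hp hX hω h0'
  have hA := copyA_mem_splitCluster hab.1 h1 hn
  have hB := copyB_mem_splitCluster hab.2 h2 hn
  rw [clusterSection, splitSection_a, splitSection_b hne]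
  refine ⟨by simp, mem_newVertices.2 ⟨_, rfl⟩, mem_newVertices.2 ⟨_, rfl⟩,
    splitCluster G a b α β X, ?_, hA, hB⟩
  unfold safeSplitCover bigSplitClusters
  simp only [Finset.mem_union, Finset.mem_filter, Finset.mem_image]
  refine Or.inl ⟨⟨X, hX, rfl⟩, ?_, hn⟩
  -- A neighbour of `a` in the cluster is the third element that makes its image big.
  obtain ⟨x, hx, hax⟩ := h1
  have hxa : x ≠ a := hax.ne'
  have hxb : x ≠ b := by rintro rfl; exact hs.nonedge hax
  have hxm : (Sum.inl ⟨x, hxa, hxb⟩ : SplitVertex a b) ∈ splitCluster G a b α β X :=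
    mem_splitCluster.2 hx
  rw [Finset.two_lt_card]
  exact ⟨_, hA, _, hB, _, hxm, by simp, by simp, by simp⟩

end Key

/-! ### Independence of the transferred cluster stresses. -/

section Transfer

variable {V W : Type*} [Fintype V] [DecidableEq V] [Fintype W] [DecidableEq W]
  {M : RigidityMatroid} {G : SimpleGraph V} {𝒳 : Finset (Finset V)} {a b : V} {α β : V → Fin 2}
  {H : SimpleGraph W} {𝒴 : Finset (Finset W)} {A : Finset (SplitVertex a b)} {B : Finset W}
  {φ : A ≃ B}

/-- Stresses of the clusters of the split graph and of the ear that add up to zero vanish. -/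
lemma pushed_stress_eq_zero (hb : IsSafeBase M G 𝒳 a b α β) (hear : IsSafeEar M H 𝒴 B)
    (hA : A ⊆ newVertices a b) {P : GlueVertex (SplitVertex a b) B → Fin M.dim → ℝ}
    (hP : ∀ i j, IsGeneric M fun v => P (Sum.inl (splitSection a b i j v)))
    (hPW : IsGeneric M fun w => P (glueRight φ w))
    {Γ : SimpleGraph V} {Δ : SimpleGraph W} (f : 𝒳 → V → V → ℝ) (g : 𝒴 → W → W → ℝ)
    (hf : ∀ X : 𝒳, f X ∈ stressSpace M (clusterGraph Γ X)
      fun v => P (Sum.inl (clusterSection G a b α β X v)))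
    (hg : ∀ Y : 𝒴, g Y ∈ stressSpace M (clusterGraph Δ Y) fun w => P (glueRight φ w))
    (h0 : ∑ X : 𝒳, push (fun v => (Sum.inl (clusterSection G a b α β X v) :
        GlueVertex (SplitVertex a b) B)) (f X) + ∑ Y, push (glueRight φ) (g Y) = 0) :
    (∀ X, f X = 0) ∧ ∀ Y, g Y = 0 := by
  have hs := hb.safe_split
  have hinj : ∀ X : 𝒳, Function.Injective (fun v => (Sum.inl (clusterSection G a b α β X v) :
      GlueVertex (SplitVertex a b) B)) := fun X =>
    Sum.inl_injective.comp (splitSection_injective _ _)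
  have hval : ∀ s t, ∑ X : 𝒳, push (fun v => (Sum.inl (clusterSection G a b α β X v) :
        GlueVertex (SplitVertex a b) B)) (f X) s t + ∑ Y, push (glueRight φ) (g Y) s t = 0 := by
    intro s t
    have := congrFun (congrFun h0 s) t
    simpa [Finset.sum_apply] using this
  have hf0 : ∀ X, f X = 0 := by
    intro X
    rw [← Submodule.mem_bot ℝ, ← (hP _ _).stressSpace_eq_bot hb.cover_indep, mem_stressSpace]
    refine ⟨⟨(mem_stressSpace.1 (hf X)).1.1, fun u w huw => ?_⟩, (mem_stressSpace.1 (hf X)).2⟩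
    by_contra hne
    have hadj := stress_adj (hf X) hne
    have h1 := hval (Sum.inl (clusterSection G a b α β X u)) (Sum.inl (clusterSection G a b α β X w))
    rw [Finset.sum_eq_zero (s := (Finset.univ : Finset 𝒴)), add_zero,
      Finset.sum_eq_single X _ (by simp)] at h1
    · rw [push_apply_of_injective (hinj X)] at h1
      exact hne h1
    -- The collapse recovers a pair from its image, so another cluster meets it only if the pair is
    -- shared.
    · intro X' _ hX'
      by_contra hsum
      obtain ⟨u', w', hu', hw', hne'⟩ := exists_of_push_ne_zero hsum
      have e1 : u' = u := by
        have := congrArg (collapse a b) (Sum.inl_injective hu')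
        simpa [clusterSection, collapse_splitSection] using this
      have e2 : w' = w := by
        have := congrArg (collapse a b) (Sum.inl_injective hw')
        simpa [clusterSection, collapse_splitSection] using this
      subst e1 e2
      have hadj' := stress_adj (hf X') hne'
      rw [clusterGraph_adj] at hadj hadj'
      exact huw (hs.cover.shared_adj X.2 X'.2 (fun e => hX' (Subtype.ext e.symm)) hadj.1.ne
        hadj.2.1 hadj.2.2 hadj'.2.1 hadj'.2.2)
    -- The ear meets the old part only in copies of `a` and `b`, so it can interfere only on `{a,
    -- b}`, which is shared.
    · intro Y _
      by_contra hne'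
      obtain ⟨x, y, hx, hy, hne'⟩ := exists_of_push_ne_zero hne'
      have key : ∀ {x : W} {u : V}, glueRight φ x = Sum.inl (clusterSection G a b α β X u) →
          u = a ∨ u = b := by
        intro x u hx
        by_contra hu
        push Not at hu
        obtain ⟨n, hn⟩ := mem_newVertices.1 (hA (glueRight_eq_inl φ hx).2)
        rw [clusterSection, splitSection_of_ne hu.1 hu.2] at hn
        cases hn
      have hne2 := hadj.ne
      rcases key hx with rfl | rfl <;> rcases key hy with rfl | rfl
      · exact hne2 rfl
      · exact huw hs.shared
      · exact huw hs.shared.symm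
      · exact hne2 rfl
  refine ⟨hf0, fun Y => ?_⟩
  refine cluster_stress_eq_zero (Γ := Δ) hear.cover (hPW.stressSpace_eq_bot hear.cover_indep) g hg ?_ Y
  ext x y
  have h1 := hval (glueRight φ x) (glueRight φ y)
  simp only [hf0, map_zero, Pi.zero_apply, Finset.sum_const_zero, zero_add,
    push_apply_of_injective (glueRight_injective φ)] at h1
  simpa [Finset.sum_apply] using h1

end Transfer

/-! ### The dimension count for implied nonedges. -/

section ImpliedNonedge

variable {V W : Type*} [Fintype V] [DecidableEq V] [Fintype W] [DecidableEq W]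
  {M : RigidityMatroid} {G : SimpleGraph V} {𝒳 : Finset (Finset V)} {a b : V} {α β : V → Fin 2}
  {H : SimpleGraph W} {𝒴 : Finset (Finset W)} {A : Finset (SplitVertex a b)} {B : Finset W}
  {φ : A ≃ B}

lemma exists_generic_glue (M : RigidityMatroid) (φ : A ≃ B) :
    ∃ P : GlueVertex (SplitVertex a b) B → Fin M.dim → ℝ, IsGeneric M P ∧
      (∀ i j, IsGeneric M fun v => P (Sum.inl (splitSection a b i j v))) ∧
      IsGeneric M fun w => P (glueRight φ w) := by
  have h1 := zariskiDense_isGeneric (V := GlueVertex (SplitVertex a b) B) M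
  have h2 := ZariskiDense.iInter fun x : Fin 2 × Fin 2 =>
    (zariskiDense_isGeneric (V := V) M).comap (U := GlueVertex (SplitVertex a b) B)
      (ι := fun v => Sum.inl (splitSection a b x.1 x.2 v))
      (Sum.inl_injective.comp (splitSection_injective x.1 x.2))
  have h3 := (zariskiDense_isGeneric (V := W) M).comap (glueRight_injective φ)
  obtain ⟨P, ⟨hP1, hP2⟩, hP3⟩ := ((h1.inter h2).inter h3).nonempty
  rw [Set.mem_iInter] at hP2
  exact ⟨P, hP1, fun i j => hP2 (i, j), hP3⟩

lemma IsGeneric.finrank_stressSpace_eq {p q : V → Fin M.dim → ℝ} (hp : IsGeneric M p)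
    (hq : IsGeneric M q) (Γ : SimpleGraph V) :
    Module.finrank ℝ (stressSpace M Γ p) = Module.finrank ℝ (stressSpace M Γ q) := by
  have h1 := hp.finrank_stressSpace Γ
  have h2 := hq.finrank_stressSpace Γ
  omega

lemma push_injective {V U : Type*} [Fintype V] [Fintype U] {ι : V → U}
    (hι : Function.Injective ι) : Function.Injective (push ι) := by
  intro ω η h
  ext x y
  rw [← push_apply_of_injective hι ω, h, push_apply_of_injective hι]

lemma edgeSet_ncard_sup (Γ Δ : SimpleGraph V) :
    (Γ ⊔ Δ).edgeSet.ncard = Γ.edgeSet.ncard + (Δ.edgeSet \ Γ.edgeSet).ncard := by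
  rw [SimpleGraph.edgeSet_sup, ← Set.union_sdiff_self, Set.ncard_union_eq Set.disjoint_sdiff_right]

open Classical in
/-- A glue of a safe split-and-glue that is independent has an implied nonedge. -/
theorem exists_isImpliedNonedge_glue (h : IsSafeSplitAndGlue M G 𝒳 a b α β H 𝒴 φ)
    (hind : Independent M (glue (splitGraph G a b α β) H φ)) :
    ∃ x y, IsImpliedNonedge M (glue (splitGraph G a b α β) H φ) x y := by
  obtain ⟨P, hP, hPV, hPW⟩ := exists_generic_glue (a := a) (b := b) M φ
  have hb := h.base
  have hs := hb.safe_split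
  have hear := h.ear
  set Γ := glue (splitGraph G a b α β) H φ with hΓ
  set S := sharedGraph 𝒳 with hS
  set T := sharedGraph 𝒴 ⊔ keyPairs 𝒴 B with hT
  let ι : Finset V → V → GlueVertex (SplitVertex a b) B :=
    fun X v => Sum.inl (clusterSection G a b α β X v)
  have hιinj : ∀ X, Function.Injective (ι X) := fun X =>
    Sum.inl_injective.comp (splitSection_injective _ _)
  -- A cluster is chosen for each pair to define its image; by `clusterSection_congr` the choice
  -- does not matter for the nonedges other than `{a, b}` that carry stress.
  let c : Sym2 V → Finset V := fun e =>
    if he : ∃ X ∈ 𝒳, ∀ v ∈ e, v ∈ X then he.choose else ∅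
  have hc : ∀ e, (∃ X ∈ 𝒳, ∀ v ∈ e, v ∈ X) → c e ∈ 𝒳 ∧ ∀ v ∈ e, v ∈ c e := by
    intro e he
    simp only [c, dif_pos he]
    exact he.choose_spec
  -- The pair `{a, b}` is left out: when stressed, its images are key gluing pairs and are supplied
  -- by `H` or `N₂`. This omission balances the `-1` in the ear count.
  let N₁ : Set (Sym2 (GlueVertex (SplitVertex a b) B)) :=
    (fun e => e.map (ι (c e))) '' ((S.edgeSet \ G.edgeSet) \ {s(a, b)})
  let N₂ : Set (Sym2 (GlueVertex (SplitVertex a b) B)) :=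
    Sym2.map (glueRight φ) '' (T.edgeSet \ H.edgeSet)
  set Ω := Γ ⊔ SimpleGraph.fromEdgeSet (N₁ ∪ N₂) with hΩ
  -- the stresses of the clusters become stresses of `Ω`
  have hX : ∀ X : 𝒳, (stressSpace M (clusterGraph (G ⊔ S) X) fun v => P (ι X v)).map (push (ι X)) ≤
      stressSpace M Ω P := by
    rintro X _ ⟨ω, hω, rfl⟩
    refine push_mem_stressSpace (ι X) P hω fun u w huw => ?_
    have hn := not_hasBothCopies_of_stress hs hb.indep (hPV _ _) X.2 hω
      (by rintro rfl; exact huw rfl)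
    obtain ⟨hadj, hu, hw⟩ := clusterGraph_adj.1 (stress_adj hω huw)
    by_cases hG : G.Adj u w
    · exact Or.inl (glue_adj_left φ _ H (splitGraph_adj_clusterSection hs.nonedge hn hu hw hG))
    have hSuw := hadj.resolve_left hG
    by_cases hab : s(u, w) = s(a, b)
    · have hab0 : ω a b ≠ 0 := by
        rcases Sym2.eq_iff.1 hab with ⟨rfl, rfl⟩ | ⟨rfl, rfl⟩
        · exact huw
        · rw [(mem_stressSpace.1 hω).1.1 u w]; exact mul_ne_zero (sgn_ne_zero M) huw
      have hkey := keyPairs_of_stress hb (hPV _ _) X.2 hω hab0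
      have hmem := h.key_mem _ _ hkey
      have hk := (h.key_iff ⟨_, hmem.1⟩ ⟨_, hmem.2⟩).1 hkey
      have hΩab : Ω.Adj (ι X a) (ι X b) := by
        have e1 : ι X a = glueRight φ (φ ⟨_, hmem.1⟩) := (glueRight_apply φ ⟨_, hmem.1⟩).symm
        have e2 : ι X b = glueRight φ (φ ⟨_, hmem.2⟩) := (glueRight_apply φ ⟨_, hmem.2⟩).symm
        rw [e1, e2]
        by_cases hH : H.Adj (φ ⟨_, hmem.1⟩) (φ ⟨_, hmem.2⟩)
        · exact Or.inl (glue_adj_right φ _ H hH)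
        · refine Or.inr ((SimpleGraph.fromEdgeSet_adj _).2 ⟨Or.inr ⟨s(_, _), ⟨Or.inr hk, hH⟩, rfl⟩,
            (glueRight_injective φ).ne hk.ne⟩)
      rcases Sym2.eq_iff.1 hab with ⟨rfl, rfl⟩ | ⟨rfl, rfl⟩
      · exact hΩab
      · exact hΩab.symm
    · refine Or.inr ((SimpleGraph.fromEdgeSet_adj _).2 ⟨Or.inl ⟨s(u, w), ⟨⟨hSuw, hG⟩, hab⟩, ?_⟩,
        (hιinj _).ne hadj.ne⟩)
      obtain ⟨hc1, hc2⟩ := hc s(u, w) ⟨X, X.2, by simp [hu, hw]⟩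
      have hcu := hc2 u (by simp)
      have hcw := hc2 w (by simp)
      have e1 := clusterSection_congr hs hc1 X.2 hadj.ne hG hab hcu hcw hu hw
      have e2 := clusterSection_congr hs hc1 X.2 hadj.ne.symm (fun h => hG h.symm)
        (by rwa [Sym2.eq_swap]) hcw hcu hw hu
      simp only [Sym2.map_mk, ι, e1, e2]
  have hY : ∀ Y : 𝒴, (stressSpace M (clusterGraph (H ⊔ T) Y) fun w => P (glueRight φ w)).map
      (push (glueRight φ)) ≤ stressSpace M Ω P := by
    rintro Y _ ⟨ω, hω, rfl⟩
    refine push_mem_stressSpace (glueRight φ) P hω fun u w huw => ?_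
    obtain ⟨hadj, -, -⟩ := clusterGraph_adj.1 (stress_adj hω huw)
    by_cases hH : H.Adj u w
    · exact Or.inl (glue_adj_right φ _ H hH)
    · exact Or.inr ((SimpleGraph.fromEdgeSet_adj _).2
        ⟨Or.inr ⟨s(u, w), ⟨hadj.resolve_left hH, hH⟩, rfl⟩, (glueRight_injective φ).ne hadj.ne⟩)
  -- the dimension count
  let K : 𝒳 ⊕ 𝒴 → Submodule ℝ (GlueVertex (SplitVertex a b) B → GlueVertex (SplitVertex a b) B → ℝ) :=
    Sum.elim (fun X => (stressSpace M (clusterGraph (G ⊔ S) X) fun v => P (ι X v)).map (push (ι X)))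
      (fun Y => (stressSpace M (clusterGraph (H ⊔ T) Y) fun w => P (glueRight φ w)).map
        (push (glueRight φ)))
  have hK0 : ∀ f : 𝒳 ⊕ 𝒴 → GlueVertex (SplitVertex a b) B → GlueVertex (SplitVertex a b) B → ℝ,
      (∀ i, f i ∈ K i) → ∑ i, f i = 0 → ∀ i, f i = 0 := by
    intro f hf h0
    choose f₁ hf₁ hf₁' using fun X => hf (Sum.inl X)
    choose g₁ hg₁ hg₁' using fun Y => hf (Sum.inr Y)
    rw [Fintype.sum_sum_type, ← Finset.sum_congr rfl fun X _ => hf₁' X,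
      ← Finset.sum_congr rfl fun Y _ => hg₁' Y] at h0
    obtain ⟨h1, h2⟩ := pushed_stress_eq_zero hb hear h.gluing_subset hPV hPW f₁ g₁ hf₁ hg₁ h0
    rintro (X | Y)
    · rw [← hf₁', h1, map_zero]
    · rw [← hg₁', h2, map_zero]
  have hdim := sum_finrank_le hK0 (L := stressSpace M Ω P) (by
    rintro (X | Y)
    · exact hX X
    · exact hY Y)
  rw [Fintype.sum_sum_type] at hdim
  -- Different clusters use different copies of `a` and `b`; all these placements are generic, so
  -- the dimensions can be compared at one of them.
  have hdX : ∀ X : 𝒳, Module.finrank ℝ (K (Sum.inl X)) = Module.finrank ℝ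
      (stressSpace M (clusterGraph (G ⊔ S) X) fun v => P (Sum.inl (splitSection a b 0 0 v))) :=
    fun X => (Submodule.equivMapOfInjective _ (push_injective (hιinj X)) _).finrank_eq.symm.trans
      ((hPV _ _).finrank_stressSpace_eq (hPV 0 0) _)
  have hdY : ∀ Y : 𝒴, Module.finrank ℝ (K (Sum.inr Y)) = Module.finrank ℝ
      (stressSpace M (clusterGraph (H ⊔ T) Y) fun w => P (glueRight φ w)) :=
    fun Y => (Submodule.equivMapOfInjective _ (push_injective (glueRight_injective φ)) _).finrank_eq.symm
  rw [Finset.sum_congr rfl fun X _ => hdX X, Finset.sum_congr rfl fun Y _ => hdY Y] at hdim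
  have hsumX := sum_finrank_cluster hs.cover hb.indep hb.rank_eq (hPV 0 0)
  rw [← Finset.sum_coe_sort, edgeSet_ncard_sup, ← hS] at hsumX
  have hsumY := ieCountWith_eq M hear.cover (T := T) le_sup_left hPW
  have hrH := hear.rank_eq
  -- Pushing forward embeds the stresses of the ear into those of the independent glue.
  have hHind : Independent M H := by
    refine independent_of_stressSpace_eq_bot (fun w => P (glueRight φ w)) ?_
    rw [eq_bot_iff]
    intro ω hω
    have h1 := push_mem_stressSpace (Δ := Γ) (glueRight φ) P hω fun x y hxy =>
      glue_adj_right φ _ H (stress_adj hω hxy)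
    rw [hP.stressSpace_eq_bot hind, Submodule.mem_bot] at h1
    exact push_injective (glueRight_injective φ) (by rw [h1, map_zero])
  rw [ieCount', hHind] at hrH
  rw [← Finset.sum_coe_sort, edgeSet_ncard_sup] at hsumY
  have hΩcard : Ω.edgeSet.ncard ≤
      Γ.edgeSet.ncard + (((S.edgeSet \ G.edgeSet).ncard - 1) + (T.edgeSet \ H.edgeSet).ncard) := by
    have h1 : Ω.edgeSet ⊆ Γ.edgeSet ∪ (N₁ ∪ N₂) := by
      rw [hΩ, SimpleGraph.edgeSet_sup, SimpleGraph.edgeSet_fromEdgeSet]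
      exact Set.union_subset_union_right _ Set.sdiff_subset
    have h2 : N₁.ncard ≤ (S.edgeSet \ G.edgeSet).ncard - 1 := by
      refine (Set.ncard_image_le).trans ?_
      rw [Set.ncard_sdiff_singleton_of_mem]
      exact ⟨hs.shared, hs.nonedge⟩
    have h3 : N₂.ncard ≤ (T.edgeSet \ H.edgeSet).ncard := Set.ncard_image_le
    have h4 := Set.ncard_le_ncard h1
    have h5 := Set.ncard_union_le Γ.edgeSet (N₁ ∪ N₂)
    have h6 := Set.ncard_union_le N₁ N₂
    omega
  have hpos : 1 ≤ (S.edgeSet \ G.edgeSet).ncard :=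
    Nat.one_le_iff_ne_zero.2 (Set.ncard_ne_zero_of_mem (a := s(a, b)) ⟨hs.shared, hs.nonedge⟩)
  have hrk := hP.finrank_stressSpace Ω
  have hsumY' : (∑ Y : 𝒴, Module.finrank ℝ
      (stressSpace M (clusterGraph (H ⊔ T) Y) fun w => P (glueRight φ w))) + 1 =
      (T.edgeSet \ H.edgeSet).ncard := by
    zify
    push_cast at hsumY
    rw [← hT] at hrH
    linarith
  -- At most `(|S \ G| - 1) + |T \ H|` pairs were added, while the stresses have dimension at least
  -- `|S \ G| + (|T \ H| - 1)`.
  have hle : rank M Ω ≤ Γ.edgeSet.ncard := by omega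
  have hne : (T.edgeSet \ H.edgeSet).Nonempty := by
    rw [← Set.ncard_pos]; omega
  obtain ⟨e, heT, heH⟩ := hne
  induction e with | _ x y => ?_
  refine ⟨glueRight φ x, glueRight φ y, isImpliedNonedge_of_rank_le hind le_sup_left hle
    (Or.inr ((SimpleGraph.fromEdgeSet_adj _).2 ⟨Or.inr ⟨s(x, y), ⟨heT, heH⟩, rfl⟩,
      (glueRight_injective φ).ne (show T.Adj x y from heT).ne⟩)) ?_⟩
  rw [hΓ, glue_adj_right_iff φ _ H fun s hs' t ht' =>
    splitGraph_new_new (h.gluing_subset hs') (h.gluing_subset ht')]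
  exact heH

end ImpliedNonedge

/-! ### Choosing the hinge positions. -/

section Hinge

/-- Linear independence of three vectors. -/
def Indep3 (x y z : Fin 3 → ℝ) : Prop :=
  ∀ r s t : ℝ, r • x + s • y + t • z = 0 → r = 0 ∧ s = 0 ∧ t = 0

/-- The determinant of three vectors. -/
def det3 (x y z : Fin 3 → ℝ) : ℝ :=
  x 0 * (y 1 * z 2 - y 2 * z 1) - x 1 * (y 0 * z 2 - y 2 * z 0) + x 2 * (y 0 * z 1 - y 1 * z 0)

lemma indep3_of_det3 {x y z : Fin 3 → ℝ} (h : det3 x y z ≠ 0) : Indep3 x y z := by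
  intro r s t hr
  have h0 := congrFun hr 0
  have h1 := congrFun hr 1
  have h2 := congrFun hr 2
  simp only [Pi.add_apply, Pi.smul_apply, smul_eq_mul, Pi.zero_apply] at h0 h1 h2
  refine ⟨?_, ?_, ?_⟩ <;> refine (mul_eq_zero.1 ?_).resolve_right h <;> unfold det3
  · linear_combination (y 1 * z 2 - y 2 * z 1) * h0 - (y 0 * z 2 - y 2 * z 0) * h1 +
      (y 0 * z 1 - y 1 * z 0) * h2
  · linear_combination -(x 1 * z 2 - x 2 * z 1) * h0 + (x 0 * z 2 - x 2 * z 0) * h1 -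
      (x 0 * z 1 - x 1 * z 0) * h2
  · linear_combination (x 1 * y 2 - x 2 * y 1) * h0 - (x 0 * y 2 - x 2 * y 0) * h1 +
      (x 0 * y 1 - x 1 * y 0) * h2

/-- The midpoint of two placed vertices. -/
noncomputable def mid {d : ℕ} (p q : Fin d → ℝ) : Fin d → ℝ := fun k => (p k + q k) / 2

/-- The factor by which the direction of an edge shrinks when the edge is halved. -/
noncomputable def RigidityMatroid.half : RigidityMatroid → ℝ
  | .R3 => 1 / 2
  | .MK5 => 1 / 4

lemma half_ne_zero (M : RigidityMatroid) : M.half ≠ 0 := by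
  cases M <;> norm_num [RigidityMatroid.half]

lemma dir_mid_left (M : RigidityMatroid) (p q : Fin M.dim → ℝ) :
    M.dir p (mid p q) = M.half • M.dir p q := by
  cases M
  · ext k; simp [RigidityMatroid.dir, mid, RigidityMatroid.half]; ring
  · ext k; fin_cases k <;> simp [RigidityMatroid.dir, mid, RigidityMatroid.half] <;> ring

lemma mid_comm {d : ℕ} (p q : Fin d → ℝ) : mid p q = mid q p := by
  ext k; simp [mid, add_comm]

lemma dir_mid_right (M : RigidityMatroid) (p q : Fin M.dim → ℝ) :
    M.dir (mid p q) q = -(M.sgn • M.dir (mid p q) p) := by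
  cases M
  · ext k; simp [RigidityMatroid.dir, mid, RigidityMatroid.sgn]; ring
  · ext k; fin_cases k <;> simp [RigidityMatroid.dir, mid, RigidityMatroid.sgn] <;> ring

/-- The positions `u`, `v` are in general position with respect to `a`, `b` and the force `f`
at `a`. -/
structure IsHinge (M : RigidityMatroid) (a b u v : Fin M.dim → ℝ) (f : Fin 3 → ℝ) : Prop where
  force : Indep3 (M.dir a u) (M.dir a v) f
  at_a : Indep3 (M.dir a u) (M.dir a v) (M.dir a b)
  at_b : Indep3 (M.dir b u) (M.dir b v) (M.dir b a)
  at_u : Indep3 (M.dir u a) (M.dir u b) (M.dir u v)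
  at_v : Indep3 (M.dir v a) (M.dir v b) (M.dir v u)
  at_mid_ab : Indep3 (M.dir (mid a b) a) (M.dir (mid a b) u) (M.dir (mid a b) v)
  at_mid_uv : Indep3 (M.dir (mid u v) u) (M.dir (mid u v) a) (M.dir (mid u v) b)

/-- It suffices to find a normal `n` orthogonal to neither vector and to take `x`, `y` spanning the
plane orthogonal to `n`. -/
lemma exists_det3_ne_zero {d f : Fin 3 → ℝ} (hd : d ≠ 0) (hf : f ≠ 0) :
    ∃ x y, det3 x y d ≠ 0 ∧ det3 x y f ≠ 0 := by
  have hsq : ∀ z : Fin 3 → ℝ, z ≠ 0 → z 0 * z 0 + z 1 * z 1 + z 2 * z 2 ≠ 0 := by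
    intro z hz h
    apply hz
    ext k
    have h0 := mul_self_nonneg (z 0)
    have h1 := mul_self_nonneg (z 1)
    have h2 := mul_self_nonneg (z 2)
    fin_cases k
    · exact mul_self_eq_zero.1 (show z 0 * z 0 = 0 by linarith)
    · exact mul_self_eq_zero.1 (show z 1 * z 1 = 0 by linarith)
    · exact mul_self_eq_zero.1 (show z 2 * z 2 = 0 by linarith)
  obtain ⟨n, hnd, hnf⟩ : ∃ n : Fin 3 → ℝ, n 0 * d 0 + n 1 * d 1 + n 2 * d 2 ≠ 0 ∧
      n 0 * f 0 + n 1 * f 1 + n 2 * f 2 ≠ 0 := by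
    -- If `d` is not orthogonal to `f`, then `d` itself serves; otherwise `d + f` does.
    by_cases h : d 0 * f 0 + d 1 * f 1 + d 2 * f 2 = 0
    · refine ⟨d + f, ?_, ?_⟩
      · have := hsq d hd
        simp only [Pi.add_apply]
        contrapose! this
        linarith
      · have := hsq f hf
        simp only [Pi.add_apply]
        contrapose! this
        linarith
    · exact ⟨d, hsq d hd, h⟩
  -- The witnesses have as cross product a nonzero multiple of `n`; a nonzero entry of `n` provides
  -- the factor.
  by_cases h0 : n 0 = 0
  · by_cases h1 : n 1 = 0
    · have h2 : n 2 ≠ 0 := by rintro h2; simp [h0, h1, h2] at hnd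
      refine ⟨![n 2, 0, -n 0], ![0, n 2, -n 1], ?_, ?_⟩
      · convert mul_ne_zero h2 hnd using 1; simp [det3]; ring
      · convert mul_ne_zero h2 hnf using 1; simp [det3]; ring
    · refine ⟨![n 1, -n 0, 0], ![0, -n 2, n 1], ?_, ?_⟩
      · convert mul_ne_zero (neg_ne_zero.2 h1) hnd using 1; simp [det3]; ring
      · convert mul_ne_zero (neg_ne_zero.2 h1) hnf using 1; simp [det3]; ring
  · refine ⟨![-n 1, n 0, 0], ![-n 2, 0, n 0], ?_, ?_⟩
    · convert mul_ne_zero h0 hnd using 1; simp [det3]; ring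
    · convert mul_ne_zero h0 hnf using 1; simp [det3]; ring

/-- With `u = a + x` and `v = a + y`, every condition other than the one on `f` is a nonzero
multiple of the determinant of `x`, `y` and the direction `ab`. -/
lemma exists_isHinge_R3 {a b : Fin 3 → ℝ} (hab : RigidityMatroid.R3.dir a b ≠ 0) {f : Fin 3 → ℝ}
    (hf : f ≠ 0) : ∃ u v, IsHinge RigidityMatroid.R3 a b u v f := by
  obtain ⟨x, y, hxd, hxf⟩ := exists_det3_ne_zero hab hf
  refine ⟨(fun k => a k + x k : Fin 3 → ℝ), (fun k => a k + y k : Fin 3 → ℝ), ?_⟩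
  constructor <;> apply indep3_of_det3
  · convert hxf using 1; simp [det3, RigidityMatroid.dir]; ring
  · convert hxd using 1; simp [det3, RigidityMatroid.dir]; ring
  · convert neg_ne_zero.2 hxd using 1; simp [det3, RigidityMatroid.dir]; ring
  · convert hxd using 1; simp [det3, RigidityMatroid.dir]; ring
  · convert neg_ne_zero.2 hxd using 1; simp [det3, RigidityMatroid.dir]; ring
  · convert mul_ne_zero (show (-1/2 : ℝ) ≠ 0 by norm_num) hxd using 1
    simp [det3, RigidityMatroid.dir, mid]; ring
  · convert mul_ne_zero (show (-1/2 : ℝ) ≠ 0 by norm_num) hxd using 1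
    simp [det3, RigidityMatroid.dir, mid]; ring

/-- The cross product of two differences of points in the plane. -/
def cross (o p q : Fin 2 → ℝ) : ℝ := (o 0 - p 0) * (o 1 - q 1) - (o 1 - p 1) * (o 0 - q 0)

/-- A Vandermonde determinant: three directions are independent if no two of the points are
collinear with `o`. -/
lemma det3_dir_MK5 (o p q r : Fin 2 → ℝ) :
    det3 (RigidityMatroid.MK5.dir o p) (RigidityMatroid.MK5.dir o q) (RigidityMatroid.MK5.dir o r) =
      cross o p q * cross o q r * cross o p r := by
  simp [det3, RigidityMatroid.dir, cross]; ring

lemma exists_isHinge_MK5 {a b : Fin 2 → ℝ} (hab : RigidityMatroid.MK5.dir a b ≠ 0)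
    {f : Fin 3 → ℝ} (hf : f ≠ 0) : ∃ u v, IsHinge RigidityMatroid.MK5 a b u v f := by
  set d0 := b 0 - a 0 with hd0
  set d1 := b 1 - a 1 with hd1
  have hb0 : b 0 = a 0 + d0 := by rw [hd0]; ring
  have hb1 : b 1 = a 1 + d1 := by rw [hd1]; ring
  have hN : d0 ^ 2 + d1 ^ 2 ≠ 0 := by
    intro h
    have h0 : d0 = 0 := by nlinarith [sq_nonneg d0, sq_nonneg d1]
    have h1 : d1 = 0 := by nlinarith [sq_nonneg d0, sq_nonneg d1]
    apply hab
    ext k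
    fin_cases k <;> simp [RigidityMatroid.dir, hb0, hb1, h0, h1]
  -- Candidates for `u`, `v` lie on the line parallel to `ab` through `a + d^⊥`, where `d = b - a`.
  -- The required noncollinearities then reduce to `s ≠ t` and `d ≠ 0`.
  let pt : ℝ → Fin 2 → ℝ := fun s => ![a 0 + s * d0 - d1, a 1 + s * d1 + d0]
  have hdet : ∀ s t, det3 (RigidityMatroid.MK5.dir a (pt s)) (RigidityMatroid.MK5.dir a (pt t)) f =
      (s - t) * (d0 ^ 2 + d1 ^ 2) * (s * t * (d0 ^ 2 * f 2 - 2 * d0 * d1 * f 1 + d1 ^ 2 * f 0) +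
        (s + t) * (-d0 * d1 * f 2 - (d0 ^ 2 - d1 ^ 2) * f 1 + d0 * d1 * f 0) +
        (d1 ^ 2 * f 2 + 2 * d0 * d1 * f 1 + d0 ^ 2 * f 0)) := by
    intro s t
    simp [det3, RigidityMatroid.dir, pt]; ring
  obtain ⟨s, t, hst, hforce⟩ : ∃ s t, s - t ≠ 0 ∧ det3 (RigidityMatroid.MK5.dir a (pt s))
      (RigidityMatroid.MK5.dir a (pt t)) f ≠ 0 := by
    by_contra hcon
    push Not at hcon
    -- These three choices of `(s, t)` separate the coefficients of `s t`, of `s + t` and of 1.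
    have e1 := hcon 0 1 (by norm_num)
    have e2 := hcon 0 (-1) (by norm_num)
    have e3 := hcon 1 (-1) (by norm_num)
    rw [hdet] at e1 e2 e3
    replace e1 := (mul_eq_zero.1 e1).resolve_left (mul_ne_zero (by norm_num) hN)
    replace e2 := (mul_eq_zero.1 e2).resolve_left (mul_ne_zero (by norm_num) hN)
    replace e3 := (mul_eq_zero.1 e3).resolve_left (mul_ne_zero (by norm_num) hN)
    set B1 := d0 ^ 2 * f 2 - 2 * d0 * d1 * f 1 + d1 ^ 2 * f 0 with hB1
    set B2 := -d0 * d1 * f 2 - (d0 ^ 2 - d1 ^ 2) * f 1 + d0 * d1 * f 0 with hB2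
    set B3 := d1 ^ 2 * f 2 + 2 * d0 * d1 * f 1 + d0 ^ 2 * f 0 with hB3
    have b3 : B3 = 0 := by linarith
    have b2 : B2 = 0 := by linarith
    have b1 : B1 = 0 := by linarith
    rw [hB1] at b1
    rw [hB2] at b2
    rw [hB3] at b3
    have hN2 := pow_ne_zero 2 hN
    apply hf
    ext k
    -- Up to sign, `B1`, `B2`, `B3` are the entries of `f`, read as a quadratic form, in the
    -- orthogonal basis `d`, `d^⊥`; changing back recovers `f` times `|d|^4`.
    fin_cases k
    · refine (mul_eq_zero.1 (?_ : f 0 * (d0 ^ 2 + d1 ^ 2) ^ 2 = 0)).resolve_right hN2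
      linear_combination d1 ^ 2 * b1 + d0 ^ 2 * b3 + 2 * d0 * d1 * b2
    · refine (mul_eq_zero.1 (?_ : f 1 * (d0 ^ 2 + d1 ^ 2) ^ 2 = 0)).resolve_right hN2
      linear_combination -d0 * d1 * b1 + d0 * d1 * b3 - (d0 ^ 2 - d1 ^ 2) * b2
    · refine (mul_eq_zero.1 (?_ : f 2 * (d0 ^ 2 + d1 ^ 2) ^ 2 = 0)).resolve_right hN2
      linear_combination d0 ^ 2 * b1 + d1 ^ 2 * b3 - 2 * d0 * d1 * b2
  have hc : ∀ {c x : ℝ}, c ≠ 0 → x = c * (d0 ^ 2 + d1 ^ 2) → x ≠ 0 := by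
    rintro c _ hc rfl; exact mul_ne_zero hc hN
  have hts : t - s ≠ 0 := by rw [← neg_sub]; exact neg_ne_zero.2 hst
  have h1 : (1 : ℝ) ≠ 0 := one_ne_zero
  have h1' : (-1 : ℝ) ≠ 0 := by norm_num
  have h2' : (-1 / 2 : ℝ) ≠ 0 := by norm_num
  refine ⟨pt s, pt t, indep3_of_det3 hforce, ?_, ?_, ?_, ?_, ?_, ?_⟩ <;> apply indep3_of_det3 <;>
    refine (det3_dir_MK5 _ _ _ _).trans_ne (mul_ne_zero (mul_ne_zero ?_ ?_) ?_)
  · exact hc hst (by simp [cross, pt]; ring)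
  · exact hc h1' (by simp [cross, pt, hb0, hb1]; ring)
  · exact hc h1' (by simp [cross, pt, hb0, hb1]; ring)
  · exact hc hst (by simp [cross, pt, hb0, hb1]; ring)
  · exact hc h1 (by simp [cross, pt, hb0, hb1]; ring)
  · exact hc h1 (by simp [cross, pt, hb0, hb1]; ring)
  · exact hc h1 (by simp [cross, pt, hb0, hb1]; ring)
  · exact hc hts (by simp [cross, pt, hb0, hb1]; ring)
  · exact hc hts (by simp [cross, pt]; ring)
  · exact hc h1 (by simp [cross, pt, hb0, hb1]; ring)
  · exact hc hst (by simp [cross, pt, hb0, hb1]; ring)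
  · exact hc hst (by simp [cross, pt]; ring)
  · exact hc h2' (by simp [cross, pt, mid, hb0, hb1]; ring)
  · exact hc hst (by simp [cross, pt, mid, hb0, hb1]; ring)
  · exact hc h2' (by simp [cross, pt, mid, hb0, hb1]; ring)
  · exact hc (mul_ne_zero h2' hst) (by simp [cross, pt, mid]; ring)
  · exact hc h1 (by simp [cross, pt, mid, hb0, hb1]; ring)
  · exact hc (mul_ne_zero h2' hst) (by simp [cross, pt, mid, hb0, hb1]; ring)

theorem exists_isHinge (M : RigidityMatroid) {a b : Fin M.dim → ℝ} (hab : M.dir a b ≠ 0)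
    {f : Fin 3 → ℝ} (hf : f ≠ 0) : ∃ u v, IsHinge M a b u v f := by
  cases M
  · exact exists_isHinge_R3 hab hf
  · exact exists_isHinge_MK5 hab hf

end Hinge

/-! ### The double-butterfly in coordinates. -/

section DoubleButterfly

instance : DecidableRel butterfly.Adj := fun x y =>
  decidable_of_iff (x ≠ y ∧ s(x, y) ≠ s(0, 1) ∧ s(x, y) ≠ s(3, 4)) (by
    simp [butterfly, SimpleGraph.deleteEdges_adj])

instance : DecidableRel doubleButterfly.Adj := fun x y =>
  decidable_of_iff ((x ≠ y ∧ ∃ s t, butterfly.Adj s t ∧ (![0, 1, 2, 6, 7] : Fin 5 → Fin 8) s = x ∧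
      (![0, 1, 2, 6, 7] : Fin 5 → Fin 8) t = y) ∨
    (x ≠ y ∧ ∃ s t, butterfly.Adj s t ∧ (![3, 4, 5, 6, 7] : Fin 5 → Fin 8) s = x ∧
      (![3, 4, 5, 6, 7] : Fin 5 → Fin 8) t = y)) Iff.rfl

lemma doubleButterfly_not_adj {k l : Fin 8} (hk : k ∈ ({0, 1, 3, 4} : Finset (Fin 8)))
    (hl : l ∈ ({0, 1, 3, 4} : Finset (Fin 8))) : ¬ doubleButterfly.Adj k l := by
  revert k l; decide

/-- The automorphism that exchanges the first two vertices. -/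
def swapFirst : doubleButterfly ≃g doubleButterfly where
  toEquiv := Equiv.swap 0 1
  map_rel_iff' := by decide

/-- The automorphism that exchanges the two butterflies. -/
def swapButterflies : doubleButterfly ≃g doubleButterfly where
  toFun := ![3, 4, 5, 0, 1, 2, 6, 7]
  invFun := ![3, 4, 5, 0, 1, 2, 6, 7]
  left_inv := by decide
  right_inv := by decide
  map_rel_iff' := by decide

lemma load_doubleButterfly {M : RigidityMatroid} {q : Fin 8 → Fin M.dim → ℝ}
    {x : Fin 8 → Fin 8 → ℝ} (hx : x ∈ weightSpace M doubleButterfly) :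
    load M q x 0 = x 0 2 • M.dir (q 0) (q 2) + x 0 6 • M.dir (q 0) (q 6) +
      x 0 7 • M.dir (q 0) (q 7) ∧
    load M q x 1 = x 1 2 • M.dir (q 1) (q 2) + x 1 6 • M.dir (q 1) (q 6) +
      x 1 7 • M.dir (q 1) (q 7) ∧
    load M q x 2 = x 2 0 • M.dir (q 2) (q 0) + x 2 1 • M.dir (q 2) (q 1) +
      x 2 6 • M.dir (q 2) (q 6) + x 2 7 • M.dir (q 2) (q 7) ∧
    load M q x 3 = x 3 5 • M.dir (q 3) (q 5) + x 3 6 • M.dir (q 3) (q 6) +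
      x 3 7 • M.dir (q 3) (q 7) ∧
    load M q x 4 = x 4 5 • M.dir (q 4) (q 5) + x 4 6 • M.dir (q 4) (q 6) +
      x 4 7 • M.dir (q 4) (q 7) ∧
    load M q x 5 = x 5 3 • M.dir (q 5) (q 3) + x 5 4 • M.dir (q 5) (q 4) +
      x 5 6 • M.dir (q 5) (q 6) + x 5 7 • M.dir (q 5) (q 7) ∧
    load M q x 6 = x 6 0 • M.dir (q 6) (q 0) + x 6 1 • M.dir (q 6) (q 1) +
      x 6 2 • M.dir (q 6) (q 2) + x 6 3 • M.dir (q 6) (q 3) + x 6 4 • M.dir (q 6) (q 4) +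
      x 6 5 • M.dir (q 6) (q 5) ∧
    load M q x 7 = x 7 0 • M.dir (q 7) (q 0) + x 7 1 • M.dir (q 7) (q 1) +
      x 7 2 • M.dir (q 7) (q 2) + x 7 3 • M.dir (q 7) (q 3) + x 7 4 • M.dir (q 7) (q 4) +
      x 7 5 • M.dir (q 7) (q 5) := by
  have hz : ∀ k l, ¬ doubleButterfly.Adj k l → x k l = 0 := hx.2
  refine ⟨?_, ?_, ?_, ?_, ?_, ?_, ?_, ?_⟩ <;> rw [load, Fin.sum_univ_eight]
  · rw [hz 0 0 (by decide), hz 0 1 (by decide), hz 0 3 (by decide), hz 0 4 (by decide),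
      hz 0 5 (by decide)]; simp
  · rw [hz 1 0 (by decide), hz 1 1 (by decide), hz 1 3 (by decide), hz 1 4 (by decide),
      hz 1 5 (by decide)]; simp
  · rw [hz 2 2 (by decide), hz 2 3 (by decide), hz 2 4 (by decide), hz 2 5 (by decide)]; simp
  · rw [hz 3 0 (by decide), hz 3 1 (by decide), hz 3 2 (by decide), hz 3 3 (by decide),
      hz 3 4 (by decide)]; simp
  · rw [hz 4 0 (by decide), hz 4 1 (by decide), hz 4 2 (by decide), hz 4 3 (by decide),
      hz 4 4 (by decide)]; simp
  · rw [hz 5 0 (by decide), hz 5 1 (by decide), hz 5 2 (by decide), hz 5 5 (by decide)]; simp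
  · rw [hz 6 6 (by decide), hz 6 7 (by decide)]; simp
  · rw [hz 7 6 (by decide), hz 7 7 (by decide)]; simp

lemma doubleButterfly_weight_eq_zero {M : RigidityMatroid} {x : Fin 8 → Fin 8 → ℝ}
    (hx : x ∈ weightSpace M doubleButterfly) (h02 : x 0 2 = 0) (h06 : x 0 6 = 0) (h07 : x 0 7 = 0)
    (h12 : x 1 2 = 0) (h16 : x 1 6 = 0) (h17 : x 1 7 = 0) (h26 : x 2 6 = 0) (h27 : x 2 7 = 0)
    (h35 : x 3 5 = 0) (h36 : x 3 6 = 0) (h37 : x 3 7 = 0) (h45 : x 4 5 = 0) (h46 : x 4 6 = 0)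
    (h47 : x 4 7 = 0) (h56 : x 5 6 = 0) (h57 : x 5 7 = 0) : x = 0 := by
  have hlt : ∀ k l : Fin 8, k ≤ l → x k l = 0 := by
    intro k l hkl
    by_cases hadj : doubleButterfly.Adj k l
    · have : ∀ k l : Fin 8, k ≤ l → doubleButterfly.Adj k l → (k, l) ∈
        ([(0, 2), (0, 6), (0, 7), (1, 2), (1, 6), (1, 7), (2, 6), (2, 7), (3, 5), (3, 6), (3, 7),
          (4, 5), (4, 6), (4, 7), (5, 6), (5, 7)] : List (Fin 8 × Fin 8)) := by decide
      have h := this k l hkl hadj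
      simp only [List.mem_cons, Prod.mk.injEq, List.not_mem_nil, or_false] at h
      rcases h with ⟨rfl, rfl⟩ | ⟨rfl, rfl⟩ | ⟨rfl, rfl⟩ | ⟨rfl, rfl⟩ | ⟨rfl, rfl⟩ | ⟨rfl, rfl⟩ |
        ⟨rfl, rfl⟩ | ⟨rfl, rfl⟩ | ⟨rfl, rfl⟩ | ⟨rfl, rfl⟩ | ⟨rfl, rfl⟩ | ⟨rfl, rfl⟩ | ⟨rfl, rfl⟩ |
        ⟨rfl, rfl⟩ | ⟨rfl, rfl⟩ | ⟨rfl, rfl⟩ <;> assumption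
    · exact hx.2 k l hadj
  ext k l
  rcases le_total k l with h | h
  · exact hlt k l h
  · rw [hx.1 l k, hlt l k h, mul_zero]; rfl

end DoubleButterfly

/-! ### Weights under the collapse of a split. -/

section Lift

variable {V : Type*} [Fintype V] [DecidableEq V] {M : RigidityMatroid} {G : SimpleGraph V}
  {a b : V} {α β : V → Fin 2}

lemma collapse_adj {s t : SplitVertex a b} (h : (splitGraph G a b α β).Adj s t) :
    G.Adj (collapse a b s) (collapse a b t) := by
  rcases s with x | m | m <;> rcases t with y | n | n
  · exact h
  · exact h.1.symm
  · exact h.1.symm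
  · exact h.1
  · exact h.elim
  · exact h.elim
  · exact h.1
  · exact h.elim
  · exact h.elim

/-- An edge of the split graph has at most one new endpoint, and its old endpoint determines through
`α` or `β` which copy that is. -/
lemma collapse_adj_injective (hab : a ≠ b) {s t s' t' : SplitVertex a b}
    (h : (splitGraph G a b α β).Adj s t) (h' : (splitGraph G a b α β).Adj s' t')
    (hs : collapse a b s = collapse a b s') (ht : collapse a b t = collapse a b t') :
    s = s' ∧ t = t' := by
  have key : ∀ {s t s' t' : SplitVertex a b}, (splitGraph G a b α β).Adj s t →
      (splitGraph G a b α β).Adj s' t' → collapse a b s = collapse a b s' →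
      collapse a b t = collapse a b t' → s = s' := by
    intro s t s' t' h h' hs ht
    rcases s with x | m | m <;> rcases s' with x' | m' | m'
    · exact congrArg _ (Subtype.ext hs)
    · exact absurd hs x.2.1
    · exact absurd hs x.2.2
    · exact absurd hs.symm x'.2.1
    · rcases t with y | n
      · rcases t' with y' | n'
        · have e : y = y' := Subtype.ext ht
          subst e
          rw [show m = m' from h.2.symm.trans h'.2]
        · exact h'.elim
      · exact h.elim
    · exact absurd hs hab
    · exact absurd hs.symm x'.2.2
    · exact absurd hs.symm hab
    · rcases t with y | n
      · rcases t' with y' | n'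
        · have e : y = y' := Subtype.ext ht
          subst e
          rw [show m = m' from h.2.symm.trans h'.2]
        · exact h'.elim
      · exact h.elim
  exact ⟨key h h' hs ht, key h.symm h'.symm ht hs⟩

lemma exists_splitGraph_adj (hab : ¬ G.Adj a b) {u w : V} (h : G.Adj u w) :
    ∃ s t : SplitVertex a b, collapse a b s = u ∧ collapse a b t = w ∧
      (splitGraph G a b α β).Adj s t := by
  have hA : ∀ {w}, G.Adj a w → ∃ s t : SplitVertex a b, collapse a b s = a ∧
      collapse a b t = w ∧ (splitGraph G a b α β).Adj s t := by
    intro w h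
    exact ⟨newA a b (α w), Sum.inl ⟨w, h.ne', by rintro rfl; exact hab h⟩, rfl, rfl, h, rfl⟩
  have hB : ∀ {w}, G.Adj b w → ∃ s t : SplitVertex a b, collapse a b s = b ∧
      collapse a b t = w ∧ (splitGraph G a b α β).Adj s t := by
    intro w h
    exact ⟨newB a b (β w), Sum.inl ⟨w, by rintro rfl; exact hab h.symm, h.ne'⟩, rfl, rfl, h, rfl⟩
  by_cases hua : u = a
  · subst hua; exact hA h
  by_cases hub : u = b
  · subst hub; exact hB h
  by_cases hwa : w = a
  · subst hwa; obtain ⟨s, t, h1, h2, h3⟩ := hA h.symm; exact ⟨t, s, h2, h1, h3.symm⟩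
  by_cases hwb : w = b
  · subst hwb; obtain ⟨s, t, h1, h2, h3⟩ := hB h.symm; exact ⟨t, s, h2, h1, h3.symm⟩
  exact ⟨Sum.inl ⟨u, hua, hub⟩, Sum.inl ⟨w, hwa, hwb⟩, rfl, rfl, h⟩

lemma push_collapse_apply (hab : a ≠ b) {y : SplitVertex a b → SplitVertex a b → ℝ}
    (hy : y ∈ weightSpace M (splitGraph G a b α β)) {s t : SplitVertex a b}
    (h : (splitGraph G a b α β).Adj s t) :
    push (collapse a b) y (collapse a b s) (collapse a b t) = y s t := by
  classical
  simp only [push, LinearMap.coe_mk, AddHom.coe_mk]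
  rw [Finset.sum_eq_single s, Finset.sum_eq_single t]
  · simp
  · intro t' _ ht'
    split_ifs with hc
    · exact hy.2 _ _ fun hadj => ht' (collapse_adj_injective hab hadj h hc.1 hc.2).2
    · rfl
  · simp
  · intro s' _ hs'
    refine Finset.sum_eq_zero fun t' _ => ?_
    split_ifs with hc
    · exact hy.2 _ _ fun hadj => hs' (collapse_adj_injective hab hadj h hc.1 hc.2).1
    · rfl
  · simp

variable (G a b α β) in
open Classical in
/-- The lift of edge weights along the collapse of the split graph. -/
noncomputable def liftWeight (ω : V → V → ℝ) (s t : SplitVertex a b) : ℝ :=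
  if (splitGraph G a b α β).Adj s t then ω (collapse a b s) (collapse a b t) else 0

lemma liftWeight_mem {ω : V → V → ℝ} (hω : ∀ i j, ω j i = M.sgn * ω i j) :
    liftWeight G a b α β ω ∈ weightSpace M (splitGraph G a b α β) := by
  refine ⟨fun s t => ?_, fun s t h => if_neg h⟩
  unfold liftWeight
  rw [SimpleGraph.adj_comm, hω (collapse a b s)]
  split_ifs <;> simp

lemma liftWeight_push (hab : a ≠ b) {y : SplitVertex a b → SplitVertex a b → ℝ}
    (hy : y ∈ weightSpace M (splitGraph G a b α β)) :
    liftWeight G a b α β (push (collapse a b) y) = y := by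
  ext s t
  unfold liftWeight
  split_ifs with h
  · exact push_collapse_apply hab hy h
  · exact (hy.2 s t h).symm

lemma push_liftWeight (hab : a ≠ b) (hn : ¬ G.Adj a b) {ω : V → V → ℝ}
    (hω : ω ∈ weightSpace M G) :
    push (collapse a b) (liftWeight G a b α β ω) = ω := by
  have hl := liftWeight_mem (G := G) (a := a) (b := b) (α := α) (β := β) hω.1
  ext u w
  by_cases h : G.Adj u w
  · obtain ⟨s, t, rfl, rfl, hst⟩ := exists_splitGraph_adj (α := α) (β := β) hn h
    rw [push_collapse_apply hab hl hst]
    exact if_pos hst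
  · rw [hω.2 u w h]
    by_contra hne
    obtain ⟨s, t, rfl, rfl, hst⟩ := exists_of_push_ne_zero hne
    apply h
    apply collapse_adj (α := α) (β := β)
    by_contra hc
    exact hst (if_neg hc)

lemma liftWeight_congr {ω η : V → V → ℝ} (h : ∀ u w, G.Adj u w → ω u w = η u w) :
    liftWeight G a b α β ω = liftWeight G a b α β η := by
  ext s t
  unfold liftWeight
  split_ifs with hst
  · exact h _ _ (collapse_adj hst)
  · rfl

lemma load_push_collapse_a (hab : a ≠ b) (p : V → Fin M.dim → ℝ)
    (y : SplitVertex a b → SplitVertex a b → ℝ) : load M p (push (collapse a b) y) a =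
      load M (fun s => p (collapse a b s)) y (newA a b 0) +
      load M (fun s => p (collapse a b s)) y (newA a b 1) := by
  classical
  rw [load_push, Fintype.sum_sum_type, Fintype.sum_sum_type, Finset.sum_eq_zero, zero_add]
  · simp [collapse, hab.symm, Fin.sum_univ_two]
  · intro x _
    exact if_neg x.2.1

lemma load_push_collapse_b (hab : a ≠ b) (p : V → Fin M.dim → ℝ)
    (y : SplitVertex a b → SplitVertex a b → ℝ) : load M p (push (collapse a b) y) b =
      load M (fun s => p (collapse a b s)) y (newB a b 0) +
      load M (fun s => p (collapse a b s)) y (newB a b 1) := by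
  classical
  rw [load_push, Fintype.sum_sum_type, Fintype.sum_sum_type, Finset.sum_eq_zero, zero_add]
  · simp [collapse, hab, Fin.sum_univ_two]
  · intro x _
    exact if_neg x.2.2

lemma load_push_collapse_of_ne (p : V → Fin M.dim → ℝ)
    (y : SplitVertex a b → SplitVertex a b → ℝ) {v : V} (h₁ : v ≠ a) (h₂ : v ≠ b) :
    load M p (push (collapse a b) y) v =
      load M (fun s => p (collapse a b s)) y (Sum.inl ⟨v, h₁, h₂⟩) := by
  classical
  rw [load_push, Finset.sum_eq_single (Sum.inl ⟨v, h₁, h₂⟩)]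
  · exact if_pos rfl
  · rintro (x | n | n) _ hne
    · exact if_neg fun h => hne (congrArg _ (Subtype.ext h))
    · exact if_neg fun h => h₁ h.symm
    · exact if_neg fun h => h₂ h.symm
  · simp

/-- One of the copies of `a` carries a nonzero load that is proportional to the stress on the
nonedge `{a, b}`. -/
lemma exists_copy_load (hne : a ≠ b) (hn : ¬ G.Adj a b) {p : V → Fin M.dim → ℝ}
    (hp : stressSpace M G p = ⊥) (hab : M.dir (p a) (p b) ≠ 0) (α β : V → Fin 2) :
    ∃ (i : Fin 2) (f : Fin 3 → ℝ), f ≠ 0 ∧ ∀ ω ∈ stressSpace M (G ⊔ SimpleGraph.edge a b) p,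
      load M (fun s => p (collapse a b s)) (liftWeight G a b α β ω) (newA a b i) = ω a b • f := by
  -- As `G` carries no stress, a stress of `G + ab` is determined by its value on `ab`, so these
  -- stresses form at most a line.
  have hzero : ∀ ω ∈ stressSpace M (G ⊔ SimpleGraph.edge a b) p, ω a b = 0 → ω = 0 := by
    intro ω hω h0
    rw [← Submodule.mem_bot ℝ, ← hp, mem_stressSpace]
    refine ⟨⟨(mem_stressSpace.1 hω).1.1, fun u w hu => ?_⟩, (mem_stressSpace.1 hω).2⟩
    by_contra hne0
    have := stress_adj hω hne0
    rw [SimpleGraph.sup_adj, SimpleGraph.edge_adj] at this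
    rcases this with h | ⟨⟨rfl, rfl⟩ | ⟨rfl, rfl⟩, -⟩
    · exact hu h
    · exact hne0 h0
    · exact hne0 (by rw [(mem_stressSpace.1 hω).1.1, h0, mul_zero])
  have hload : ∀ (c : ℝ) (ω : V → V → ℝ) (i : Fin 2),
      load M (fun s => p (collapse a b s)) (liftWeight G a b α β (c • ω)) (newA a b i) =
        c • load M (fun s => p (collapse a b s)) (liftWeight G a b α β ω) (newA a b i) := by
    intro c ω i
    have : liftWeight G a b α β (c • ω) = c • liftWeight G a b α β ω := by
      ext s t; simp [liftWeight]
    rw [this]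
    simp [load, Finset.smul_sum, smul_smul]
  by_cases hK : stressSpace M (G ⊔ SimpleGraph.edge a b) p = ⊥
  -- Without nonzero stresses any nonzero force serves.
  · refine ⟨0, M.dir (p a) (p b), hab, fun ω hω => ?_⟩
    rw [hK, Submodule.mem_bot] at hω
    subst hω
    simpa using hload 0 0 0
  · obtain ⟨η, hη, hη0⟩ := Submodule.exists_mem_ne_zero_of_ne_bot hK
    have hηab : η a b ≠ 0 := fun h => hη0 (hzero η hη h)
    set σ := (η a b)⁻¹ • η with hσ
    have hσm : σ ∈ stressSpace M (G ⊔ SimpleGraph.edge a b) p := Submodule.smul_mem _ _ hη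
    have hσab : σ a b = 1 := by simp [hσ, hηab]
    have hprop : ∀ ω ∈ stressSpace M (G ⊔ SimpleGraph.edge a b) p, ω = ω a b • σ := by
      intro ω hω
      have := hzero (ω - ω a b • σ) (Submodule.sub_mem _ hω (Submodule.smul_mem _ _ hσm))
        (by simp [hσab])
      exact sub_eq_zero.1 this
    have hall : ∀ i, ∀ ω ∈ stressSpace M (G ⊔ SimpleGraph.edge a b) p,
        load M (fun s => p (collapse a b s)) (liftWeight G a b α β ω) (newA a b i) =
        ω a b • load M (fun s => p (collapse a b s)) (liftWeight G a b α β σ) (newA a b i) := by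
      intro i ω hω
      rw [← hload, ← hprop ω hω]
    -- Without its part on `ab`, the normalised stress is a weight on `G` that can be lifted to the
    -- split graph.
    set τ := σ - unitWeight M a b with hτ
    have hτm : τ ∈ weightSpace M G := by
      refine ⟨(Submodule.sub_mem _ (mem_stressSpace.1 hσm).1 (unitWeight_mem (by
        simp [SimpleGraph.edge_adj, hne]))).1, fun u w hu => ?_⟩
      by_cases h1 : u = a ∧ w = b
      · obtain ⟨rfl, rfl⟩ := h1
        simp [hτ, hσab, unitWeight, hne]
      by_cases h2 : u = b ∧ w = a
      · obtain ⟨rfl, rfl⟩ := h2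
        simp [hτ, (mem_stressSpace.1 hσm).1.1 w u, hσab, unitWeight, hne.symm]
      have : σ u w = 0 := (mem_stressSpace.1 hσm).1.2 u w (by
        rw [SimpleGraph.sup_adj, SimpleGraph.edge_adj]
        tauto)
      simp [hτ, this, unitWeight, h1, h2]
    have hcongr : liftWeight G a b α β σ = liftWeight G a b α β τ := by
      refine liftWeight_congr fun u w huw => ?_
      have h1 : ¬ (u = a ∧ w = b) := by rintro ⟨rfl, rfl⟩; exact hn huw
      have h2 : ¬ (u = b ∧ w = a) := by rintro ⟨rfl, rfl⟩; exact hn huw.symm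
      simp [hτ, unitWeight, h1, h2]
    -- The two copies of `a` together balance the missing bar `ab`, so their forces do not both
    -- vanish.
    have hsum : load M (fun s => p (collapse a b s)) (liftWeight G a b α β σ) (newA a b 0) +
        load M (fun s => p (collapse a b s)) (liftWeight G a b α β σ) (newA a b 1) =
        -M.dir (p a) (p b) := by
      rw [← load_push_collapse_a hne, hcongr, push_liftWeight hne hn hτm]
      have h1 : loadMap M p τ a = loadMap M p σ a - loadMap M p (unitWeight M a b) a := by
        rw [hτ, map_sub]; rfl
      have h2 : loadMap M p σ a = 0 := (mem_stressSpace.1 hσm).2 a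
      rw [load_unitWeight, h2] at h1
      refine h1.trans ?_
      simp [edgeRow, hne]
    by_cases hf0 : load M (fun s => p (collapse a b s)) (liftWeight G a b α β σ) (newA a b 0) = 0
    · refine ⟨1, _, fun hf1 => hab ?_, hall 1⟩
      rw [hf0, hf1, add_zero] at hsum
      exact neg_eq_zero.1 hsum.symm
    · exact ⟨0, _, hf0, hall 0⟩

end Lift

/-! ### Stress-free placements of the ear. -/

section Core

lemma sum_fin_two_of_ne {E : Type*} [AddCommMonoid E] (g : Fin 2 → E) {i j : Fin 2} (h : i ≠ j) :
    g 0 + g 1 = g i + g j := by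
  obtain ⟨rfl, rfl⟩ | ⟨rfl, rfl⟩ : (i = 0 ∧ j = 1) ∨ (i = 1 ∧ j = 0) := by
    revert i j; decide
  · rfl
  · exact add_comm _ _

variable {V : Type*} [Fintype V] [DecidableEq V] {M : RigidityMatroid} {G : SimpleGraph V}
  {a b : V} {α β : V → Fin 2}

/-- A balanced collapse is a stress of `G`, hence zero, and the collapse loses no edge weight. It is
thus enough to balance the sum of the forces at the two copies, not each force separately. -/
lemma eq_zero_of_push_collapse {p : V → Fin M.dim → ℝ} (hab : a ≠ b)
    (hp : stressSpace M G p = ⊥) {y : SplitVertex a b → SplitVertex a b → ℝ}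
    (hy : y ∈ weightSpace M (splitGraph G a b α β))
    (hl : ∀ v, load M p (push (collapse a b) y) v = 0) : y = 0 := by
  have h1 : push (collapse a b) y ∈ stressSpace M G p :=
    mem_stressSpace.2 ⟨push_mem_weightSpace _ hy fun s t hst => collapse_adj (α := α) (β := β) (by
      by_contra hn; exact hst (hy.2 s t hn)), hl⟩
  rw [hp, Submodule.mem_bot] at h1
  rw [← liftWeight_push hab hy, h1]
  ext s t
  simp [liftWeight]

/-- The equilibrium conditions for a weight `y` on the split graph and a weight `x` on the
double-butterfly, placed at `q`, whose gluing vertices are identified with the vertices `n`. -/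
structure IsGluedStress (M : RigidityMatroid) (G : SimpleGraph V) (a b : V) (α β : V → Fin 2)
    (p : V → Fin M.dim → ℝ) (n : Fin 8 → SplitVertex a b) (q : Fin 8 → Fin M.dim → ℝ)
    (y : SplitVertex a b → SplitVertex a b → ℝ) (x : Fin 8 → Fin 8 → ℝ) : Prop where
  left_mem : y ∈ weightSpace M (splitGraph G a b α β)
  right_mem : x ∈ weightSpace M doubleButterfly
  load_old : ∀ v, load M (fun s => p (collapse a b s)) y (Sum.inl v) = 0
  load_glue : ∀ k ∈ ({0, 1, 3, 4} : Finset (Fin 8)),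
    load M (fun s => p (collapse a b s)) y (n k) + load M q x k = 0
  load_ear : ∀ k ∉ ({0, 1, 3, 4} : Finset (Fin 8)), load M q x k = 0

/-- If each butterfly contains both copies of `a` or both copies of `b`, then there is a placement
of the double-butterfly without stress. -/
lemma exists_placement_of_not_aligned (hne : a ≠ b) {p : V → Fin M.dim → ℝ}
    (hp : stressSpace M G p = ⊥) (hab : M.dir (p a) (p b) ≠ 0) {n : Fin 8 → SplitVertex a b}
    {i i' j j' : Fin 2} (hi : i ≠ i') (hj : j ≠ j') (h0 : n 0 = newA a b i) (h1 : n 1 = newA a b i')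
    (h3 : n 3 = newB a b j) (h4 : n 4 = newB a b j') :
    ∃ q : Fin 8 → Fin M.dim → ℝ, (∀ k ∈ ({0, 1, 3, 4} : Finset (Fin 8)), q k = p (collapse a b (n k))) ∧
      ∀ y x, IsGluedStress M G a b α β p n q y x → y = 0 ∧ x = 0 := by
  obtain ⟨u, v, hh⟩ := exists_isHinge M hab hab
  -- The first butterfly has both copies of `a` and `c` at `b`; the second has both copies of `b`
  -- and `c'` at `a`.
  refine ⟨![p a, p a, p b, p b, p b, p a, u, v], ?_, ?_⟩
  · intro k hk
    fin_cases hk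
    · simp [h0, collapse]
    · simp [h1, collapse]
    · simp [h3, collapse]
    · simp [h4, collapse]
  intro y x hs
  obtain ⟨e0, e1, e2, e3, e4, e5, e6, e7⟩ :=
    load_doubleButterfly (q := ![p a, p a, p b, p b, p b, p a, u, v]) hs.right_mem
  have l2 := hs.load_ear 2 (by decide)
  have l5 := hs.load_ear 5 (by decide)
  have l6 := hs.load_ear 6 (by decide)
  have l7 := hs.load_ear 7 (by decide)
  have l0 := hs.load_glue 0 (by decide)
  have l1 := hs.load_glue 1 (by decide)
  have l3 := hs.load_glue 3 (by decide)
  have l4 := hs.load_glue 4 (by decide)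
  rw [e2] at l2
  rw [e5] at l5
  rw [e6] at l6
  rw [e7] at l7
  have hx : ∀ k l, x l k = M.sgn * x k l := hs.right_mem.1
  have hback : ∀ {k l}, x k l = 0 → x l k = 0 := fun {k l} h => by rw [hx k l, h, mul_zero]
  simp only [Matrix.cons_val] at e0 e1 e3 e4 l2 l5 l6 l7
  -- At `c` the two bars to the copies of `a` coincide, so their weights cancel; the same happens at
  -- `c'`, `u` and `v`.
  obtain ⟨x26, x27, x201⟩ := hh.at_b (x 2 6) (x 2 7) (x 2 0 + x 2 1) (by rw [← l2]; module)
  obtain ⟨x56, x57, x534⟩ := hh.at_a (x 5 6) (x 5 7) (x 5 3 + x 5 4) (by rw [← l5]; module)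
  obtain ⟨x601, x634, -⟩ := hh.at_u (x 6 0 + x 6 1) (x 6 3 + x 6 4) 0 (by
    rw [← l6, hback x26, hback x56]; module)
  obtain ⟨x701, x734, -⟩ := hh.at_v (x 7 0 + x 7 1) (x 7 3 + x 7 4) 0 (by
    rw [← l7, hback x27, hback x57]; module)
  have hsum : ∀ {k l m : Fin 8}, x m k + x m l = 0 → x k m + x l m = 0 := fun {k l m} h => by
    rw [hx m k, hx m l, ← mul_add, h, mul_zero]
  have f201 := hsum x201
  have f534 := hsum x534
  have f601 := hsum x601
  have f634 := hsum x634
  have f701 := hsum x701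
  have f734 := hsum x734
  have hy0 : y = 0 := by
    refine eq_zero_of_push_collapse hne hp hs.left_mem fun w => ?_
    by_cases hwa : w = a
    · rw [hwa, load_push_collapse_a hne,
        sum_fin_two_of_ne (fun i => load M (fun s => p (collapse a b s)) y (newA a b i)) hi, ← h0, ← h1]
      rw [eq_neg_of_add_eq_zero_left l0, eq_neg_of_add_eq_zero_left l1, e0, e1]
      have : -(x 0 2 • M.dir (p a) (p b) + x 0 6 • M.dir (p a) u + x 0 7 • M.dir (p a) v) +
          -(x 1 2 • M.dir (p a) (p b) + x 1 6 • M.dir (p a) u + x 1 7 • M.dir (p a) v) =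
          -((x 0 2 + x 1 2) • M.dir (p a) (p b) + (x 0 6 + x 1 6) • M.dir (p a) u +
            (x 0 7 + x 1 7) • M.dir (p a) v) := by module
      rw [this, f201, f601, f701]; simp
    by_cases hwb : w = b
    · rw [hwb, load_push_collapse_b hne,
        sum_fin_two_of_ne (fun i => load M (fun s => p (collapse a b s)) y (newB a b i)) hj, ← h3, ← h4]
      rw [eq_neg_of_add_eq_zero_left l3, eq_neg_of_add_eq_zero_left l4, e3, e4]
      have : -(x 3 5 • M.dir (p b) (p a) + x 3 6 • M.dir (p b) u + x 3 7 • M.dir (p b) v) +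
          -(x 4 5 • M.dir (p b) (p a) + x 4 6 • M.dir (p b) u + x 4 7 • M.dir (p b) v) =
          -((x 3 5 + x 4 5) • M.dir (p b) (p a) + (x 3 6 + x 4 6) • M.dir (p b) u +
            (x 3 7 + x 4 7) • M.dir (p b) v) := by module
      rw [this, f534, f634, f734]; simp
    · rw [load_push_collapse_of_ne p y hwa hwb]
      exact hs.load_old _
  refine ⟨hy0, ?_⟩
  have hly : ∀ s, load M (fun s => p (collapse a b s)) y s = 0 := by
    intro s; rw [hy0]; simp [load]
  rw [hly, zero_add, e0] at l0
  rw [hly, zero_add, e1] at l1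
  rw [hly, zero_add, e3] at l3
  rw [hly, zero_add, e4] at l4
  -- Now `y = 0`, and the three bars at each gluing vertex have independent directions.
  obtain ⟨x06, x07, x02⟩ := hh.at_a (x 0 6) (x 0 7) (x 0 2) (by rw [← l0]; module)
  obtain ⟨x16, x17, x12⟩ := hh.at_a (x 1 6) (x 1 7) (x 1 2) (by rw [← l1]; module)
  obtain ⟨x36, x37, x35⟩ := hh.at_b (x 3 6) (x 3 7) (x 3 5) (by rw [← l3]; module)
  obtain ⟨x46, x47, x45⟩ := hh.at_b (x 4 6) (x 4 7) (x 4 5) (by rw [← l4]; module)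
  exact doubleButterfly_weight_eq_zero hs.right_mem x02 x06 x07 x12 x16 x17 x26 x27 x35 x36 x37
    x45 x46 x47 x56 x57

/-- If each butterfly contains one copy of `a` and one copy of `b`, then there is a placement
of the double-butterfly without stress, provided that the second butterfly contains a copy of `a`
that carries a nonzero load. -/
lemma exists_placement_of_aligned (hne : a ≠ b) (hn : ¬ G.Adj a b) {p : V → Fin M.dim → ℝ}
    (hp : stressSpace M G p = ⊥) (hab : M.dir (p a) (p b) ≠ 0) {n : Fin 8 → SplitVertex a b}
    {i i' j j' : Fin 2} (hi : i ≠ i') (hj : j ≠ j') (h0 : n 0 = newA a b i') (h1 : n 1 = newB a b j')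
    (h3 : n 3 = newA a b i) (h4 : n 4 = newB a b j) {f : Fin 3 → ℝ} (hf : f ≠ 0)
    (hload : ∀ ω ∈ stressSpace M (G ⊔ SimpleGraph.edge a b) p,
      load M (fun s => p (collapse a b s)) (liftWeight G a b α β ω) (newA a b i) = ω a b • f) :
    ∃ q : Fin 8 → Fin M.dim → ℝ, (∀ k ∈ ({0, 1, 3, 4} : Finset (Fin 8)), q k = p (collapse a b (n k))) ∧
      ∀ y x, IsGluedStress M G a b α β p n q y x → y = 0 ∧ x = 0 := by
  obtain ⟨u, v, hh⟩ := exists_isHinge M hab hf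
  -- With `c` at the midpoint of `a`, `b`, the path through `c` acts like a bar `ab`; with `c'` at
  -- the midpoint of `u`, `v`, the path through `c'` lies along `uv`.
  refine ⟨![p a, p b, mid (p a) (p b), p a, p b, mid u v, u, v], ?_, ?_⟩
  · intro k hk
    fin_cases hk
    · simp [h0, collapse]
    · simp [h1, collapse]
    · simp [h3, collapse]
    · simp [h4, collapse]
  intro y x hs
  obtain ⟨e0, e1, e2, e3, e4, e5, e6, e7⟩ :=
    load_doubleButterfly (q := ![p a, p b, mid (p a) (p b), p a, p b, mid u v, u, v]) hs.right_mem
  have l2 := hs.load_ear 2 (by decide)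
  have l5 := hs.load_ear 5 (by decide)
  have l6 := hs.load_ear 6 (by decide)
  have l7 := hs.load_ear 7 (by decide)
  have l0 := hs.load_glue 0 (by decide)
  have l1 := hs.load_glue 1 (by decide)
  have l3 := hs.load_glue 3 (by decide)
  have l4 := hs.load_glue 4 (by decide)
  rw [e2] at l2
  rw [e5] at l5
  rw [e6] at l6
  rw [e7] at l7
  have hx : ∀ k l, x l k = M.sgn * x k l := hs.right_mem.1
  have hback : ∀ {k l}, x k l = 0 → x l k = 0 := fun {k l} h => by rw [hx k l, h, mul_zero]
  have hsum : ∀ {k l m : Fin 8}, x m k + x m l = 0 → x k m + x l m = 0 := fun {k l m} h => by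
    rw [hx m k, hx m l, ← mul_add, h, mul_zero]
  simp only [Matrix.cons_val] at e0 e1 e3 e4 l2 l5 l6 l7
  have hsgn := sgn_mul_sgn M
  -- At `c` the bars to `a` and `b` are parallel, so they can only balance each other.
  obtain ⟨x201, x26, x27⟩ := hh.at_mid_ab (x 2 0 - M.sgn * x 2 1) (x 2 6) (x 2 7) (by
    rw [← l2, dir_mid_right M (p a) (p b)]; module)
  obtain ⟨x567, x53, x54⟩ := hh.at_mid_uv (x 5 6 - M.sgn * x 5 7) (x 5 3) (x 5 4) (by
    rw [← l5, dir_mid_right M u v]; module)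
  -- At `u` the bar to `c'` points along `uv`, independent of the bars to `a` and `b`; its weight
  -- vanishes and the two butterflies cancel on `ua` and on `ub`.
  obtain ⟨x603, x614, x65⟩ := hh.at_u (x 6 0 + x 6 3) (x 6 1 + x 6 4) (x 6 5 * M.half) (by
    rw [← l6, hback x26, dir_mid_left M u v]; module)
  obtain ⟨x703, x714, x75⟩ := hh.at_v (x 7 0 + x 7 3) (x 7 1 + x 7 4) (x 7 5 * M.half) (by
    rw [← l7, hback x27, mid_comm u v, dir_mid_left M v u]; module)
  replace x65 := (mul_eq_zero.1 x65).resolve_right (half_ne_zero M)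
  replace x75 := (mul_eq_zero.1 x75).resolve_right (half_ne_zero M)
  have f603 := hsum x603
  have f614 := hsum x614
  have f703 := hsum x703
  have f714 := hsum x714
  have x35 := hback x53
  have x45 := hback x54
  have x1202 : M.sgn * x 0 2 = x 1 2 := by
    rw [hx 2 0, hx 2 1, ← mul_assoc, hsgn]; linarith
  rw [dir_mid_left] at e0
  have hdb : M.dir (p b) (mid (p a) (p b)) = M.half • M.dir (p b) (p a) := by
    rw [mid_comm, dir_mid_left]
  rw [hdb] at e1
  rw [x35] at e3
  rw [x45] at e4
  -- Over both copies of `a` the bars to `u` and `v` cancel, and only the path through `c` is felt.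
  have hσa : load M p (push (collapse a b) y) a = -((x 0 2 * M.half) • M.dir (p a) (p b)) := by
    rw [load_push_collapse_a hne,
      sum_fin_two_of_ne (fun i => load M (fun s => p (collapse a b s)) y (newA a b i)) hi, ← h0, ← h3]
    rw [eq_neg_of_add_eq_zero_left l0, eq_neg_of_add_eq_zero_left l3, e0, e3]
    have h06 : x 3 6 = -x 0 6 := by linarith
    have h07 : x 3 7 = -x 0 7 := by linarith
    rw [h06, h07]; module
  have hσb : load M p (push (collapse a b) y) b = -((x 1 2 * M.half) • M.dir (p b) (p a)) := by
    rw [load_push_collapse_b hne,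
      sum_fin_two_of_ne (fun i => load M (fun s => p (collapse a b s)) y (newB a b i)) hj, ← h1, ← h4]
    rw [eq_neg_of_add_eq_zero_left l1, eq_neg_of_add_eq_zero_left l4, e1, e4]
    have h06 : x 4 6 = -x 1 6 := by linarith
    have h07 : x 4 7 = -x 1 7 := by linarith
    rw [h06, h07]; module
  have hσ : push (collapse a b) y ∈ weightSpace M G :=
    push_mem_weightSpace _ hs.left_mem fun s t hst => collapse_adj (α := α) (β := β) (by
      by_contra hn; exact hst (hs.left_mem.2 s t hn))
  set ω := push (collapse a b) y + (x 0 2 * M.half) • unitWeight M a b with hω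
  have hωm : ω ∈ stressSpace M (G ⊔ SimpleGraph.edge a b) p := by
    refine mem_stressSpace.2 ⟨Submodule.add_mem _ (weightSpace_mono le_sup_left hσ)
      (Submodule.smul_mem _ _ (unitWeight_mem (by simp [SimpleGraph.edge_adj, hne]))), fun w => ?_⟩
    have h1 : load M p ω w = load M p (push (collapse a b) y) w +
        (x 0 2 * M.half) • edgeRow M p a b w := by
      change loadMap M p ω w = loadMap M p (push (collapse a b) y) w + _
      rw [hω, map_add, map_smul, load_unitWeight]; rfl
    rw [h1]
    by_cases hwa : w = a
    · rw [hwa, hσa]; simp [edgeRow, hne]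
    by_cases hwb : w = b
    · rw [hwb, hσb, ← x1202, dir_swap M (p a) (p b)]
      have hrow : edgeRow M p a b b = -M.dir (p a) (p b) := by simp [edgeRow, hne.symm]
      rw [hrow]
      have : M.sgn * x 0 2 * M.half * M.sgn = x 0 2 * M.half := by
        linear_combination x 0 2 * M.half * hsgn
      rw [smul_neg, neg_neg, smul_smul, this]; module
    · rw [load_push_collapse_of_ne p y hwa hwb, hs.load_old]; simp [edgeRow, hwa, hwb]
  have hωab : ω a b = x 0 2 * M.half := by
    simp [hω, hσ.2 a b hn, unitWeight, hne]
  have hlift : liftWeight G a b α β ω = y := by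
    rw [← liftWeight_push hne hs.left_mem]
    refine liftWeight_congr fun s t hst => ?_
    have h1 : ¬ (s = a ∧ t = b) := by rintro ⟨rfl, rfl⟩; exact hn hst
    have h2 : ¬ (s = b ∧ t = a) := by rintro ⟨rfl, rfl⟩; exact hn hst.symm
    simp [hω, unitWeight, h1, h2]
  -- The copy of `a` in the second butterfly is held only by the bars to `u` and `v`, as the bar to
  -- `c'` has weight zero. Since `f` is independent of these two directions, everything vanishes.
  have hyi := hload ω hωm
  rw [hlift, hωab, ← h3] at hyi
  rw [hyi, e3] at l3
  obtain ⟨x36, x37, x02⟩ := hh.force (x 3 6) (x 3 7) (x 0 2 * M.half) (by rw [← l3]; module)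
  replace x02 := (mul_eq_zero.1 x02).resolve_right (half_ne_zero M)
  have x12 : x 1 2 = 0 := by rw [← x1202, x02, mul_zero]
  have hy0 : y = 0 := by
    refine eq_zero_of_push_collapse hne hp hs.left_mem fun w => ?_
    by_cases hwa : w = a
    · rw [hwa, hσa, x02]; simp
    by_cases hwb : w = b
    · rw [hwb, hσb, x12]; simp
    · rw [load_push_collapse_of_ne p y hwa hwb]
      exact hs.load_old _
  refine ⟨hy0, ?_⟩
  have hly : ∀ s, load M (fun s => p (collapse a b s)) y s = 0 := by
    intro s; rw [hy0]; simp [load]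
  rw [hly, zero_add, e4] at l4
  obtain ⟨x46, x47, -⟩ := hh.at_b (x 4 6) (x 4 7) 0 (by rw [← l4]; module)
  exact doubleButterfly_weight_eq_zero hs.right_mem x02 (by linarith) (by linarith) x12
    (by linarith) (by linarith) x26 x27 x35 x36 x37 x45 x46 x47 (hback x65) (hback x75)

end Core

/-! ### Loads of push-forwards. -/

section LoadPush

variable {V U : Type*} [Fintype V] [Fintype U] {M : RigidityMatroid}

lemma load_push_of_injective {ι : V → U} (hι : Function.Injective ι) (P : U → Fin M.dim → ℝ)
    (ω : V → V → ℝ) (v : V) :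
    load M P (push ι ω) (ι v) = load M (fun v => P (ι v)) ω v := by
  classical
  rw [load_push, Finset.sum_eq_single v]
  · exact if_pos rfl
  · exact fun w _ hw => if_neg fun h => hw (hι h)
  · simp

lemma load_push_of_notMem_range {ι : V → U} (P : U → Fin M.dim → ℝ) (ω : V → V → ℝ) {z : U}
    (hz : ∀ v, ι v ≠ z) : load M P (push ι ω) z = 0 := by
  classical
  rw [load_push]
  exact Finset.sum_eq_zero fun v _ => if_neg (hz v)

lemma load_add (P : V → Fin M.dim → ℝ) (ω η : V → V → ℝ) (v : V) :
    load M P (ω + η) v = load M P ω v + load M P η v :=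
  congrFun ((loadMap M P).map_add ω η) v

lemma IsGeneric.dir_ne_zero {p : V → Fin M.dim → ℝ} (hp : IsGeneric M p) {i j : V} (hij : i ≠ j) :
    M.dir (p i) (p j) ≠ 0 := by
  intro h
  have hl := hp.last_ne i j hij
  cases M
  · exact hl (sub_eq_zero.1 (congrFun h 2))
  · have := congrFun h 2
    simp only [RigidityMatroid.dir, Matrix.cons_val, Pi.zero_apply] at this
    exact hl (sub_eq_zero.1 (pow_eq_zero_iff two_ne_zero |>.1 this))

end LoadPush

/-! ### Independence of the glue. -/

section GlueStress

variable {V W : Type*} [Fintype V] [DecidableEq V] [Fintype W] [DecidableEq W]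
  {M : RigidityMatroid} {G : SimpleGraph V} {a b : V} {α β : V → Fin 2} {H : SimpleGraph W}
  {A : Finset (SplitVertex a b)} {B : Finset W} {φ : A ≃ B}

lemma IsDoubleButterfly.not_adj (hH : IsDoubleButterfly H B) : ∀ x ∈ B, ∀ y ∈ B, ¬ H.Adj x y := by
  obtain ⟨e, rfl⟩ := hH
  intro x hx y hy
  obtain ⟨k, hk, rfl⟩ := Finset.mem_image.1 hx
  obtain ⟨l, hl, rfl⟩ := Finset.mem_image.1 hy
  rw [e.map_adj_iff]
  exact doubleButterfly_not_adj hk hl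

/-- The gluing vertices are pairwise nonadjacent on both sides, so a weight on the glue is the sum
of a weight `y` on the split graph and a weight `x` on the ear, whose forces add at the gluing
vertices. -/
lemma exists_stressSpace_glue_eq_bot (hA : A ⊆ newVertices a b) (e : doubleButterfly ≃g H)
    (hB : B = ({0, 1, 3, 4} : Finset (Fin 8)).image e) {n : Fin 8 → SplitVertex a b}
    (hn : ∀ k ∈ ({0, 1, 3, 4} : Finset (Fin 8)), glueRight φ (e k) = Sum.inl (n k))
    {p : V → Fin M.dim → ℝ} {q : Fin 8 → Fin M.dim → ℝ}
    (hq : ∀ k ∈ ({0, 1, 3, 4} : Finset (Fin 8)), q k = p (collapse a b (n k)))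
    (hcore : ∀ y x, IsGluedStress M G a b α β p n q y x → y = 0 ∧ x = 0) :
    ∃ P, stressSpace M (glue (splitGraph G a b α β) H φ) P = ⊥ := by
  have hBn := IsDoubleButterfly.not_adj ⟨e, hB⟩
  have hAn : ∀ s ∈ A, ∀ t ∈ A, ¬ (splitGraph G a b α β).Adj s t := fun s hs t ht =>
    splitGraph_new_new (hA hs) (hA ht)
  have hmem : ∀ k, e k ∈ B ↔ k ∈ ({0, 1, 3, 4} : Finset (Fin 8)) := by
    intro k
    rw [hB, Finset.mem_image]
    exact ⟨fun ⟨l, hl, h⟩ => e.injective h ▸ hl, fun h => ⟨k, h, rfl⟩⟩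
  set ψ : Fin 8 → GlueVertex (SplitVertex a b) B := fun k => glueRight φ (e k) with hψ
  have hψinj : Function.Injective ψ := (glueRight_injective φ).comp e.injective
  refine ⟨Sum.elim (fun s => p (collapse a b s)) fun w => q (e.symm w), ?_⟩
  set P : GlueVertex (SplitVertex a b) B → Fin M.dim → ℝ :=
    Sum.elim (fun s => p (collapse a b s)) fun w => q (e.symm w) with hP
  have hPψ : (fun k => P (ψ k)) = q := by
    ext1 k
    by_cases hk : k ∈ ({0, 1, 3, 4} : Finset (Fin 8))
    · rw [hψ]; simp only [hn k hk]; exact (hq k hk).symm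
    · rw [hψ]; simp only [glueRight_of_notMem φ ((hmem k).not.2 hk)]
      simp [hP]
  rw [eq_bot_iff]
  intro ω hω
  rw [Submodule.mem_bot]
  obtain ⟨⟨hsymm, hsupp⟩, hload⟩ := mem_stressSpace.1 hω
  set y : SplitVertex a b → SplitVertex a b → ℝ := fun s t => ω (Sum.inl s) (Sum.inl t) with hy
  set x : Fin 8 → Fin 8 → ℝ := fun k l => ω (ψ k) (ψ l) with hx
  have hym : y ∈ weightSpace M (splitGraph G a b α β) :=
    ⟨fun s t => hsymm _ _, fun s t h => hsupp _ _ (by rwa [glue_adj_left_iff φ _ H hBn])⟩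
  have hxm : x ∈ weightSpace M doubleButterfly :=
    ⟨fun s t => hsymm _ _, fun s t h => hsupp _ _ (by
      rwa [hψ, glue_adj_right_iff φ _ H hAn, e.map_adj_iff])⟩
  have hinl : ∀ {k s}, ψ k = Sum.inl s → k ∈ ({0, 1, 3, 4} : Finset (Fin 8)) ∧ s ∈ A :=
    fun h => ⟨(hmem _).1 (glueRight_eq_inl φ h).1, (glueRight_eq_inl φ h).2⟩
  have hdec : ω = push Sum.inl y + push ψ x := by
    ext s t
    by_cases hst : (glue (splitGraph G a b α β) H φ).Adj s t
    · rcases hst with ⟨-, s, t, hst, rfl, rfl⟩ | ⟨-, u, w, huw, rfl, rfl⟩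
      · have h0 : push ψ x (Sum.inl s) (Sum.inl t) = 0 := by
          by_contra hne
          obtain ⟨k, l, hk, hl, hkl⟩ := exists_of_push_ne_zero hne
          exact hkl (hxm.2 k l (doubleButterfly_not_adj (hinl hk).1 (hinl hl).1))
        change _ = push Sum.inl y (Sum.inl s) (Sum.inl t) + push ψ x (Sum.inl s) (Sum.inl t)
        rw [h0, push_apply_of_injective Sum.inl_injective, add_zero]
      · obtain ⟨k, rfl⟩ := e.surjective u
        obtain ⟨l, rfl⟩ := e.surjective w
        have h0 : push Sum.inl y (ψ k) (ψ l) = 0 := by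
          by_contra hne
          obtain ⟨s, t, hs, ht, hst⟩ := exists_of_push_ne_zero hne
          exact hst (hym.2 s t (hAn s (hinl hs.symm).2 t (hinl ht.symm).2))
        change ω (ψ k) (ψ l) = push Sum.inl y (ψ k) (ψ l) + push ψ x (ψ k) (ψ l)
        rw [h0, push_apply_of_injective hψinj, zero_add]
    · have h1 := (push_mem_weightSpace (Δ := glue (splitGraph G a b α β) H φ) Sum.inl hym
        fun s t h => glue_adj_left φ _ H (by by_contra hc; exact h (hym.2 s t hc))).2 s t hst
      have h2 := (push_mem_weightSpace (Δ := glue (splitGraph G a b α β) H φ) ψ hxm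
        fun k l h => glue_adj_right φ _ H (e.map_adj_iff.2 (by
          by_contra hc; exact h (hxm.2 k l hc)))).2 s t hst
      rw [hsupp s t hst]
      simp [h1, h2]
  have hsum : ∀ z, load M P (push Sum.inl y) z + load M P (push ψ x) z = 0 := by
    intro z
    rw [← load_add, ← hdec, hload z]
  have hcore' := hcore y x
    { left_mem := hym
      right_mem := hxm
      load_old := fun v => by
        have h := hsum (Sum.inl (Sum.inl v))
        rwa [load_push_of_injective Sum.inl_injective, load_push_of_notMem_range, add_zero] at h
        intro k hk
        obtain ⟨m, hm⟩ := mem_newVertices.1 (hA (hinl hk).2)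
        simp at hm
      load_glue := fun k hk => by
        have h := hsum (ψ k)
        rw [load_push_of_injective hψinj, hPψ] at h
        rw [show ψ k = Sum.inl (n k) from hn k hk, load_push_of_injective Sum.inl_injective] at h
        exact h
      load_ear := fun k hk => by
        have h := hsum (ψ k)
        rw [load_push_of_injective hψinj, hPψ, load_push_of_notMem_range, zero_add] at h
        · exact h
        · exact fun s hs => hk (hinl hs.symm).1 }
  rw [hdec, hcore'.1, hcore'.2, map_zero, map_zero, add_zero]

/-- The gluing vertices of the two butterflies can be arranged so that either the first butterfly
contains both copies of `a`, or each butterfly contains one copy of `a` and one copy of `b`, with a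
given copy of `a` in the second butterfly. -/
lemma exists_arrangement {T : (s t r q : Fin 2 ⊕ Fin 2) → Prop}
    (h₁ : ∀ {s t r q}, T s t r q → T t s r q) (h₂ : ∀ {s t r q}, T s t r q → T r q s t)
    {s t r q : Fin 2 ⊕ Fin 2} (hT : T s t r q) (hst : s ≠ t) (hsr : s ≠ r) (hsq : s ≠ q)
    (htr : t ≠ r) (htq : t ≠ q) (hrq : r ≠ q) :
    (∃ i i' j j', i ≠ i' ∧ j ≠ j' ∧ T (.inl i) (.inl i') (.inr j) (.inr j')) ∨
      ∀ i, ∃ i' j j', i ≠ i' ∧ j ≠ j' ∧ T (.inl i') (.inr j') (.inl i) (.inr j) := by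
  have h₃ : ∀ {s t r q}, T s t r q → T s t q r := fun h => h₂ (h₁ (h₂ h))
  have two : ∀ {i j : Fin 2}, i ≠ j → ∀ k, k = i ∨ k = j := by decide
  have aligned : ∀ {i j i' j'}, i ≠ i' → j ≠ j' → T (.inl i) (.inr j) (.inl i') (.inr j') →
      ∀ i, ∃ i' j j', i ≠ i' ∧ j ≠ j' ∧ T (.inl i') (.inr j') (.inl i) (.inr j) := by
    intro i j i' j' hi hj h k
    rcases two hi k with rfl | rfl
    · exact ⟨i', j, j', hi, hj, h₂ h⟩
    · exact ⟨i, j', j, hi.symm, hj.symm, h⟩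
  -- Only two copies of each vertex exist, which excludes three gluing vertices of one kind.
  have three : ∀ {i j k : Fin 2}, i ≠ j → i ≠ k → j ≠ k → False := by decide
  rcases s with s | s <;> rcases t with t | t <;> rcases r with r | r <;> rcases q with q | q <;>
    simp only [ne_eq, Sum.inl.injEq, Sum.inr.injEq] at hst hsr hsq htr htq hrq
  · exact (three hst hsr htr).elim
  · exact (three hst hsr htr).elim
  · exact (three hst hsq htq).elim
  · exact Or.inl ⟨s, t, r, q, hst, hrq, hT⟩
  · exact (three hsr hsq hrq).elim
  · exact Or.inr (aligned hsr htq hT)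
  · exact Or.inr (aligned hsq htr (h₃ hT))
  · exact (three htr htq hrq).elim
  · exact (three htr htq hrq).elim
  · exact Or.inr (aligned htr hsq (h₁ hT))
  · exact Or.inr (aligned htq hsr (h₁ (h₃ hT)))
  · exact (three hsr hsq hrq).elim
  · exact Or.inl ⟨r, q, s, t, hrq, hst, h₂ hT⟩
  · exact (three hst hsq htq).elim
  · exact (three hst hsr htr).elim
  · exact (three hst hsr htr).elim

/-- The symmetries of the double-butterfly reduce all identifications to the two placements above.
-/
theorem independent_glue_doubleButterfly (hG : Independent M G) (hne : a ≠ b) (hn : ¬ G.Adj a b)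
    (hA : A ⊆ newVertices a b) (hH : IsDoubleButterfly H B) :
    Independent M (glue (splitGraph G a b α β) H φ) := by
  obtain ⟨p, hp⟩ := (zariskiDense_isGeneric (V := V) M).nonempty
  have hp0 := hp.stressSpace_eq_bot hG
  have hab := hp.dir_ne_zero hne
  let T (s t r q : Fin 2 ⊕ Fin 2) : Prop := ∃ e : doubleButterfly ≃g H,
    B = ({0, 1, 3, 4} : Finset (Fin 8)).image e ∧ glueRight φ (e 0) = Sum.inl (Sum.inr s) ∧
    glueRight φ (e 1) = Sum.inl (Sum.inr t) ∧ glueRight φ (e 3) = Sum.inl (Sum.inr r) ∧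
    glueRight φ (e 4) = Sum.inl (Sum.inr q)
  have h₁ : ∀ {s t r q}, T s t r q → T t s r q := by
    rintro s t r q ⟨e, hB, hs, ht, hr, hq⟩
    refine ⟨swapFirst.trans e, ?_, ht, hs, hr, hq⟩
    rw [hB, show ⇑(swapFirst.trans e) = e ∘ swapFirst from rfl, ← Finset.image_image]
    exact congrArg _ (by decide)
  have h₂ : ∀ {s t r q}, T s t r q → T r q s t := by
    rintro s t r q ⟨e, hB, hs, ht, hr, hq⟩
    refine ⟨swapButterflies.trans e, ?_, hr, hq, hs, ht⟩
    rw [hB, show ⇑(swapButterflies.trans e) = e ∘ swapButterflies from rfl, ← Finset.image_image]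
    exact congrArg _ (by decide)
  have hT : ∃ s t r q, T s t r q ∧ s ≠ t ∧ s ≠ r ∧ s ≠ q ∧ t ≠ r ∧ t ≠ q ∧ r ≠ q := by
    obtain ⟨e, hB⟩ := hH
    have hex : ∀ k ∈ ({0, 1, 3, 4} : Finset (Fin 8)), ∃ m : Fin 2 ⊕ Fin 2,
        glueRight φ (e k) = Sum.inl (Sum.inr m) := by
      intro k hk
      have hm : e k ∈ B := hB ▸ Finset.mem_image_of_mem e hk
      obtain ⟨m, hm'⟩ := mem_newVertices.1 (hA (φ.symm ⟨e k, hm⟩).2)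
      exact ⟨m, by rw [glueRight_of_mem φ hm, hm']⟩
    obtain ⟨s, hs⟩ := hex 0 (by decide)
    obtain ⟨t, ht⟩ := hex 1 (by decide)
    obtain ⟨r, hr⟩ := hex 3 (by decide)
    obtain ⟨q, hq⟩ := hex 4 (by decide)
    have hinj : ∀ {k l : Fin 8} {m m' : Fin 2 ⊕ Fin 2}, glueRight φ (e k) = Sum.inl (Sum.inr m) →
        glueRight φ (e l) = Sum.inl (Sum.inr m') → k ≠ l → m ≠ m' := by
      rintro k l m m' hk hl hkl rfl
      exact hkl (e.injective (glueRight_injective φ (hk.trans hl.symm)))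
    exact ⟨s, t, r, q, ⟨e, hB, hs, ht, hr, hq⟩, hinj hs ht (by decide), hinj hs hr (by decide),
      hinj hs hq (by decide), hinj ht hr (by decide), hinj ht hq (by decide), hinj hr hq (by decide)⟩
  obtain ⟨s, t, r, q, hT, hst, hsr, hsq, htr, htq, hrq⟩ := hT
  have hmem : ∀ {P : Fin 8 → Prop}, P 0 → P 1 → P 3 → P 4 →
      ∀ k ∈ ({0, 1, 3, 4} : Finset (Fin 8)), P k := by
    intro P h0 h1 h3 h4 k hk
    simp only [Finset.mem_insert, Finset.mem_singleton] at hk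
    rcases hk with rfl | rfl | rfl | rfl <;> assumption
  suffices h : ∃ P, stressSpace M (glue (splitGraph G a b α β) H φ) P = ⊥ by
    obtain ⟨P, hP⟩ := h
    exact independent_of_stressSpace_eq_bot P hP
  rcases exists_arrangement (T := T) h₁ h₂ hT hst hsr hsq htr htq hrq with
    ⟨i, i', j, j', hi, hj, e, hB, e0, e1, e3, e4⟩ | h
  -- The entries at 2, 5, 6 and 7 are dummies, since only gluing vertices are identified.
  · let n : Fin 8 → SplitVertex a b := ![newA a b i, newA a b i', newA a b i, newB a b j,
      newB a b j', newA a b i, newA a b i, newA a b i]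
    obtain ⟨q, hq, hcore⟩ := exists_placement_of_not_aligned (M := M) (G := G) (α := α) (β := β)
      (n := n) hne hp0 hab hi hj rfl rfl rfl rfl
    exact exists_stressSpace_glue_eq_bot hA e hB (hmem e0 e1 e3 e4) hq hcore
  -- The copy with nonzero force depends on the split, so it is found first and then arranged into
  -- the second butterfly.
  · obtain ⟨i, f, hf, hload⟩ := exists_copy_load hne hn hp0 hab α β
    obtain ⟨i', j, j', hi, hj, e, hB, e0, e1, e3, e4⟩ := h i
    let n : Fin 8 → SplitVertex a b := ![newA a b i', newB a b j', newA a b i, newA a b i,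
      newB a b j, newA a b i, newA a b i, newA a b i]
    obtain ⟨q, hq, hcore⟩ := exists_placement_of_aligned (M := M) (G := G) (α := α) (β := β)
      (n := n) hne hn hp0 hab hi hj rfl rfl rfl rfl hf hload
    exact exists_stressSpace_glue_eq_bot hA e hB (hmem e0 e1 e3 e4) hq hcore

end GlueStress

/-! ### Edge bounds. -/

section Count

variable {V : Type*} [Fintype V] [DecidableEq V] {M : RigidityMatroid} {Γ : SimpleGraph V}

lemma ncard_clusterGraph_le_choose (Γ : SimpleGraph V) (S : Finset V) :
    (clusterGraph Γ S).edgeSet.ncard ≤ S.card.choose 2 := by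
  rw [← Sym2.card_image_offDiag, ← Set.ncard_coe_finset]
  refine Set.ncard_le_ncard fun e he => ?_
  induction e with | _ x y => ?_
  have h := clusterGraph_adj.1 he
  exact Finset.mem_coe.2 (Finset.mem_image_of_mem (Function.uncurry Sym2.mk)
    (Finset.mem_offDiag.2 ⟨h.2.1, h.2.2, h.1.ne⟩ : (x, y) ∈ S.offDiag))

lemma ncard_clusterGraph_lt_choose {S : Finset V} {x y : V} (hx : x ∈ S) (hy : y ∈ S)
    (hxy : x ≠ y) (hn : ¬ Γ.Adj x y) : (clusterGraph Γ S).edgeSet.ncard + 1 ≤ S.card.choose 2 := by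
  have h := ncard_clusterGraph_le_choose (Γ ⊔ SimpleGraph.edge x y) S
  have h1 : clusterGraph (Γ ⊔ SimpleGraph.edge x y) S = clusterGraph Γ S ⊔ SimpleGraph.edge x y := by
    ext u w
    simp only [clusterGraph_adj, SimpleGraph.sup_adj, SimpleGraph.edge_adj]
    constructor
    · tauto
    · rintro (h | ⟨⟨rfl, rfl⟩ | ⟨rfl, rfl⟩, hne⟩) <;> tauto
  rwa [h1, edgeSet_sup_edge hxy, Set.ncard_insert_of_notMem] at h
  exact fun h => hn (clusterGraph_adj.1 h).1

/-- The edge bound for five or more vertices of an independent nucleation-free graph. -/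
lemma NucleationFree.ncard_add_seven_le (hΓ : NucleationFree M Γ) (hind : Independent M Γ)
    {S : Finset V} (hS : 5 ≤ S.card) : (clusterGraph Γ S).edgeSet.ncard + 7 ≤ 3 * S.card := by
  by_contra hlt
  -- Exactly `3|S| - 6` edges are kept: they are independent, hence of rank `3|S| - 6`, and form a
  -- nucleation whatever the total number of edges is.
  obtain ⟨E, hE, hcard⟩ := Set.exists_subset_card_eq
    (show 3 * S.card - 6 ≤ (clusterGraph Γ S).edgeSet.ncard by omega)
  have hadj : ∀ {x y}, s(x, y) ∈ E → Γ.Adj x y ∧ x ∈ S ∧ y ∈ S := fun h => clusterGraph_adj.1 (hE h)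
  let N : Γ.Subgraph :=
    { verts := S
      Adj := fun x y => s(x, y) ∈ E
      adj_sub := fun h => (hadj h).1
      edge_vert := fun h => (hadj h).2.1
      symm := ⟨fun x y h => by rwa [Sym2.eq_swap]⟩ }
  have hNE : N.spanningCoe.edgeSet = E := by
    ext e
    induction e with | _ x y => exact Iff.rfl
  refine hΓ N ⟨by simpa [N] using hS, ?_⟩
  rw [hind.mono N.spanningCoe_le, hNE, hcard]
  simp only [N, Set.ncard_coe_finset]
  omega

end Count

/-! ### Edge bounds in the split graph. -/

section SplitCount

variable {V : Type*} [Fintype V] [DecidableEq V] {M : RigidityMatroid} {G : SimpleGraph V}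
  {a b : V} {α β : V → Fin 2}

/-- With the copies placed on top of each other, every stress collapses to a stress of `G`. -/
lemma independent_splitGraph (hG : Independent M G) (hne : a ≠ b) :
    Independent M (splitGraph G a b α β) := by
  obtain ⟨p, hp⟩ := hG.exists_stressSpace_eq_bot
  refine independent_of_stressSpace_eq_bot (fun s => p (collapse a b s)) ?_
  rw [eq_bot_iff]
  intro y hy
  obtain ⟨hym, hyl⟩ := mem_stressSpace.1 hy
  refine eq_zero_of_push_collapse hne hp hym fun v => ?_
  classical
  rw [load_push]
  exact Finset.sum_eq_zero fun s _ => by rw [hyl, ite_self]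

/-- The edge bound for a vertex set of the split graph that contains three or four new vertices. -/
lemma ncard_clusterGraph_splitGraph_le (hG : Independent M G) (hne : a ≠ b)
    {S : Finset (SplitVertex a b)} (hS : 3 ≤ (S ∩ newVertices a b).card) :
    (clusterGraph (splitGraph G a b α β) S).edgeSet.ncard + 3 * (S ∩ newVertices a b).card ≤
      3 * S.card + 1 := by
  have hinj : Set.InjOn (Sym2.map (collapse a b))
      (clusterGraph (splitGraph G a b α β) S).edgeSet := by
    intro e he e' he' h
    induction e with | _ s t => ?_
    induction e' with | _ s' t' => ?_
    have h1 := (clusterGraph_adj.1 he).1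
    have h2 := (clusterGraph_adj.1 he').1
    simp only [Sym2.map_mk, Sym2.eq_iff] at h
    rcases h with h | h
    · obtain ⟨rfl, rfl⟩ := collapse_adj_injective hne h1 h2 h.1 h.2
      rfl
    · obtain ⟨rfl, rfl⟩ := collapse_adj_injective hne h1 h2.symm h.1 h.2
      exact Sym2.eq_swap
  have hle : (clusterGraph (splitGraph G a b α β) S).edgeSet.ncard ≤
      (clusterGraph G (S.image (collapse a b))).edgeSet.ncard := by
    rw [← hinj.ncard_image]
    refine Set.ncard_le_ncard ?_
    rintro _ ⟨e, he, rfl⟩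
    induction e with | _ s t => ?_
    obtain ⟨h, hs, ht⟩ := clusterGraph_adj.1 he
    exact clusterGraph_adj.2 ⟨collapse_adj h, Finset.mem_image_of_mem _ hs,
      Finset.mem_image_of_mem _ ht⟩
  -- Three new vertices include a copy of `a` and a copy of `b`; this also gives the two vertices
  -- needed for the `3n - 5` bound.
  have hab : {a, b} ⊆ S.image (collapse a b) := by
    have key : ∀ c, (∃ m m' : Fin 2 ⊕ Fin 2, ∀ s ∈ newVertices a b, collapse a b s ≠ c →
        s = Sum.inr m ∨ s = Sum.inr m') → c ∈ S.image (collapse a b) := by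
      rintro c ⟨m, m', hm⟩
      by_contra hc
      have h1 : S ∩ newVertices a b ⊆ {Sum.inr m, Sum.inr m'} := by
        intro s hs
        rw [Finset.mem_inter] at hs
        simpa using hm s hs.2 fun h => hc (h ▸ Finset.mem_image_of_mem _ hs.1)
      have h2 := (Finset.card_le_card h1).trans Finset.card_le_two
      omega
    intro c hc
    rw [Finset.mem_insert, Finset.mem_singleton] at hc
    rcases hc with rfl | rfl
    · refine key _ ⟨.inr 0, .inr 1, fun s hs h => ?_⟩
      obtain ⟨m | m, rfl⟩ := mem_newVertices.1 hs
      · exact absurd rfl h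
      · fin_cases m <;> simp
    · refine key _ ⟨.inl 0, .inl 1, fun s hs h => ?_⟩
      obtain ⟨m | m, rfl⟩ := mem_newVertices.1 hs
      · fin_cases m <;> simp
      · exact absurd rfl h
  have hcard2 := Finset.card_le_card hab
  rw [Finset.card_pair hne] at hcard2
  have hcard : (S.image (collapse a b)).card + (S ∩ newVertices a b).card ≤ S.card + 2 := by
    have h1 : S.image (collapse a b) ⊆ (S \ newVertices a b).image (collapse a b) ∪ {a, b} := by
      intro c hc
      obtain ⟨s, hs, rfl⟩ := Finset.mem_image.1 hc
      by_cases hn : s ∈ newVertices a b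
      · obtain ⟨m | m, rfl⟩ := mem_newVertices.1 hn <;> simp [collapse]
      · exact Finset.mem_union_left _ (Finset.mem_image_of_mem _ (Finset.mem_sdiff.2 ⟨hs, hn⟩))
    have h2 := (Finset.card_le_card h1).trans (Finset.card_union_le _ _)
    have h3 := Finset.card_image_le (s := S \ newVertices a b) (f := collapse a b)
    have h4 := Finset.card_sdiff_add_card_inter S (newVertices a b)
    rw [Finset.card_pair hne] at h2
    omega
  -- The image has at most `|S| - k + 2` vertices, `k` counting the new ones, so at most `3(|S| - k
  -- + 2) - 5` edges.
  have h5 := (hG.mono (clusterGraph_le G (S.image (collapse a b)))).ncard_add_five_le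
    (fun i j h => (clusterGraph_adj.1 h).2.1) hcard2
  omega

end SplitCount

/-! ### Edge bounds in the double-butterfly. -/

section EarCount

/-- The edges of the double-butterfly. -/
def doubleButterflyEdges : Finset (Fin 8 × Fin 8) :=
  {(0, 2), (0, 6), (0, 7), (1, 2), (1, 6), (1, 7), (2, 6), (2, 7), (3, 5), (3, 6), (3, 7), (4, 5),
    (4, 6), (4, 7), (5, 6), (5, 7)}

lemma mem_doubleButterflyEdges {k l : Fin 8} (h : doubleButterfly.Adj k l) :
    (k, l) ∈ doubleButterflyEdges ∨ (l, k) ∈ doubleButterflyEdges := by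
  revert k l; decide

/-- Bounds on the number of edges of a subgraph of the double-butterfly, in terms of the numbers of
its gluing vertices and of its other vertices. -/
lemma doubleButterfly_count (c : Fin 8 → Bool) {e k j : ℕ}
    (he : (doubleButterflyEdges.filter fun x => c x.1 ∧ c x.2).card = e)
    (hk : (({0, 1, 3, 4} : Finset (Fin 8)).filter fun x => c x).card = k)
    (hj : (({2, 5, 6, 7} : Finset (Fin 8)).filter fun x => c x).card = j) :
    (k = 4 → e ≤ 3 * j + 4) ∧ (k = 3 → e ≤ 3 * j + 1) ∧ (k = 2 → e ≤ 3 * j) ∧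
      (k = 1 → 1 ≤ j → e + 2 ≤ 3 * j) ∧ (k = 0 → 1 ≤ j → e + 3 ≤ 3 * j) ∧
      (k = 0 → e + 8 ≤ 3 * j ∨ j ≤ 3) ∧ (j = 0 → e = 0) ∧
      (5 ≤ k + j → e + 7 ≤ 3 * (k + j)) ∧ k ≤ 4 ∧ j ≤ 4 := by
  have h2 : ∀ x y : Bool, (if x = true ∧ y = true then 1 else 0) = (x && y).toNat := by decide
  have h1 : ∀ x : Bool, (if x = true then 1 else 0) = x.toNat := by decide
  simp only [Finset.card_filter, doubleButterflyEdges] at he hk hj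
  repeat rw [Finset.sum_insert (by decide)] at he
  repeat rw [Finset.sum_insert (by decide)] at hk
  repeat rw [Finset.sum_insert (by decide)] at hj
  simp only [Finset.sum_singleton, h1, h2] at he hk hj
  subst he hk hj
  -- All counts are now sums of eight Boolean variables, so the 256 vertex subsets can be checked by
  -- evaluation.
  generalize c 0 = b₀
  generalize c 1 = b₁
  generalize c 2 = b₂
  generalize c 3 = b₃
  generalize c 4 = b₄
  generalize c 5 = b₅
  generalize c 6 = b₆
  generalize c 7 = b₇
  revert b₀ b₁ b₂ b₃ b₄ b₅ b₆ b₇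
  decide +kernel

end EarCount

/-! ### No nucleation in the glue. -/

section Nucleation

variable {V W : Type*} [Fintype V] [DecidableEq V] [Fintype W] [DecidableEq W]
  {M : RigidityMatroid} {G : SimpleGraph V} {a b : V} {α β : V → Fin 2} {H : SimpleGraph W}
  {A : Finset (SplitVertex a b)} {B : Finset W} {φ : A ≃ B}

/-- Let `m` vertices lie in the split graph, `k` of them gluing vertices, and `j` in the rest of the
ear. The edge bounds on the two sides add up to less than the rank `3(m + j) - 6` of a nucleation.
-/
theorem nucleationFree_glue_doubleButterfly (hG : Independent M G) (hne : a ≠ b)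
    (hA : A ⊆ newVertices a b) (hH : IsDoubleButterfly H B)
    (hsplit : NucleationFree M (splitGraph G a b α β)) :
    NucleationFree M (glue (splitGraph G a b α β) H φ) := by
  classical
  obtain ⟨e, hB⟩ := hH
  have hmem : ∀ k, e k ∈ B ↔ k ∈ ({0, 1, 3, 4} : Finset (Fin 8)) := by
    intro k
    rw [hB, Finset.mem_image]
    exact ⟨fun ⟨l, hl, h⟩ => e.injective h ▸ hl, fun h => ⟨k, h, rfl⟩⟩
  have hAcard : A.card = 4 := by
    have h1 := Fintype.card_congr φ
    rw [Fintype.card_coe, Fintype.card_coe, hB, Finset.card_image_of_injective _ e.injective] at h1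
    exact h1
  have hAeq : A = newVertices a b := Finset.eq_of_subset_of_card_le hA
    (hAcard ▸ Finset.card_le_four)
  set Γ := splitGraph G a b α β with hΓ
  rintro N ⟨hcard, hrank⟩
  have hind : Independent M Γ := independent_splitGraph hG hne
  let ψ : Fin 8 → GlueVertex (SplitVertex a b) B := fun k => glueRight φ (e k)
  have hψinj : Function.Injective ψ := (glueRight_injective φ).comp e.injective
  let S : Finset (SplitVertex a b) := Finset.univ.filter fun s => Sum.inl s ∈ N.verts
  have hS : ∀ {s}, s ∈ S ↔ Sum.inl s ∈ N.verts := by simp [S]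
  let c : Fin 8 → Bool := fun k => decide (ψ k ∈ N.verts)
  have hc : ∀ {k}, c k = true ↔ ψ k ∈ N.verts := by simp [c]
  obtain ⟨E, hE⟩ : ∃ E, (doubleButterflyEdges.filter fun x => c x.1 ∧ c x.2).card = E := ⟨_, rfl⟩
  obtain ⟨k, hk⟩ : ∃ k, (({0, 1, 3, 4} : Finset (Fin 8)).filter fun x => c x).card = k := ⟨_, rfl⟩
  obtain ⟨j, hj⟩ : ∃ j, (({2, 5, 6, 7} : Finset (Fin 8)).filter fun x => c x).card = j := ⟨_, rfl⟩
  have hψr : ∀ {k}, k ∈ ({2, 5, 6, 7} : Finset (Fin 8)) → ∃ w, ψ k = Sum.inr w := by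
    intro k hk
    refine ⟨_, glueRight_of_notMem φ ((hmem k).not.2 ?_)⟩
    revert k; decide
  have hcompl : ∀ {k : Fin 8}, k ∉ ({0, 1, 3, 4} : Finset (Fin 8)) →
      k ∈ ({2, 5, 6, 7} : Finset (Fin 8)) := by decide
  have hverts : N.verts.ncard = S.card + j := by
    have h1 : N.verts = (Sum.inl '' (S : Set (SplitVertex a b))) ∪
        ψ '' ((({2, 5, 6, 7} : Finset (Fin 8)).filter fun x => c x : Finset (Fin 8)) : Set (Fin 8)) := by
      ext z
      constructor
      · intro hz
        rcases z with s | ⟨w, hw⟩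
        · exact Or.inl ⟨s, hS.2 hz, rfl⟩
        · obtain ⟨k, rfl⟩ := e.surjective w
          have hψk : ψ k = Sum.inr ⟨e k, hw⟩ := glueRight_of_notMem φ hw
          refine Or.inr ⟨k, Finset.mem_coe.2 (Finset.mem_filter.2 ⟨?_, hc.2 (hψk ▸ hz)⟩), hψk⟩
          exact hcompl ((hmem k).not.1 hw)
      · rintro (⟨s, hs, rfl⟩ | ⟨k, hk, rfl⟩)
        · exact hS.1 hs
        · exact hc.1 (Finset.mem_filter.1 (Finset.mem_coe.1 hk)).2
    rw [h1, Set.ncard_union_eq, Set.ncard_image_of_injective _ Sum.inl_injective,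
      Set.ncard_image_of_injective _ hψinj, Set.ncard_coe_finset, Set.ncard_coe_finset, hj]
    rw [Set.disjoint_left]
    rintro _ ⟨s, -, rfl⟩ ⟨k, hk, h⟩
    obtain ⟨w, hw⟩ := hψr (Finset.mem_filter.1 (Finset.mem_coe.1 hk)).1
    rw [hw] at h
    cases h
  have hnew : (S ∩ newVertices a b).card = k := by
    rw [← hk, ← Finset.card_image_of_injective _ hψinj,
      ← Finset.card_image_of_injective (S ∩ newVertices a b)
        (Sum.inl_injective (β := {w : W // w ∉ B}))]
    congr 1
    ext z
    simp only [Finset.mem_image, Finset.mem_inter, Finset.mem_filter, hc, hS]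
    constructor
    · rintro ⟨s, ⟨hs, hsn⟩, rfl⟩
      rw [← hAeq] at hsn
      obtain ⟨l, hl⟩ := e.surjective (φ ⟨s, hsn⟩)
      have hψl : ψ l = Sum.inl s := by
        change glueRight φ (e l) = _
        rw [hl, glueRight_apply]
      exact ⟨l, ⟨(hmem l).1 (hl ▸ (φ ⟨s, hsn⟩).2), hψl ▸ hs⟩, hψl⟩
    · rintro ⟨l, ⟨hl, hlN⟩, rfl⟩
      have hψl : ψ l = Sum.inl _ := glueRight_of_mem φ ((hmem l).2 hl)
      exact ⟨_, ⟨hψl ▸ hlN, hA (φ.symm ⟨e l, (hmem l).2 hl⟩).2⟩, hψl.symm⟩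
  have hedges : rank M N.spanningCoe ≤ (clusterGraph Γ S).edgeSet.ncard + E := by
    refine (rank_le_ncard M _).trans ?_
    have h1 : N.spanningCoe.edgeSet ⊆ (Sym2.map Sum.inl '' (clusterGraph Γ S).edgeSet) ∪
        (fun x : Fin 8 × Fin 8 => s(ψ x.1, ψ x.2)) ''
          ((doubleButterflyEdges.filter fun x => c x.1 ∧ c x.2 : Finset _) : Set (Fin 8 × Fin 8)) := by
      intro z hz
      induction z with | _ x y => ?_
      have hN : N.Adj x y := hz
      have hx := N.edge_vert hN
      have hy := N.edge_vert hN.symm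
      rcases N.adj_sub hN with ⟨-, s, t, hst, rfl, rfl⟩ | ⟨-, u, w, huw, rfl, rfl⟩
      · exact Or.inl ⟨s(s, t), clusterGraph_adj.2 ⟨hst, hS.2 hx, hS.2 hy⟩, rfl⟩
      · obtain ⟨k, rfl⟩ := e.surjective u
        obtain ⟨l, rfl⟩ := e.surjective w
        rcases mem_doubleButterflyEdges (e.map_adj_iff.1 huw) with h | h
        · exact Or.inr ⟨(k, l), Finset.mem_coe.2 (Finset.mem_filter.2 ⟨h, hc.2 hx, hc.2 hy⟩), rfl⟩
        · exact Or.inr ⟨(l, k), Finset.mem_coe.2 (Finset.mem_filter.2 ⟨h, hc.2 hy, hc.2 hx⟩),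
            Sym2.eq_swap⟩
    refine (Set.ncard_le_ncard h1).trans ((Set.ncard_union_le _ _).trans ?_)
    refine add_le_add (Set.ncard_image_le) ?_
    rw [← hE, ← Set.ncard_coe_finset]
    exact Set.ncard_image_le
  obtain ⟨c4, c3, c2, c1, c0, c0', cj, c5, hk4, hj4⟩ := doubleButterfly_count c hE hk hj
  have hkS : k ≤ S.card := hnew ▸ Finset.card_le_card Finset.inter_subset_left
  have f5 : 5 ≤ S.card → (clusterGraph Γ S).edgeSet.ncard + 7 ≤ 3 * S.card :=
    hsplit.ncard_add_seven_le hind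
  have f34 : 3 ≤ k → (clusterGraph Γ S).edgeSet.ncard + 3 * k ≤ 3 * S.card + 1 := by
    intro h
    rw [← hnew] at h ⊢
    exact ncard_clusterGraph_splitGraph_le hG hne h
  have fpair : 2 ≤ k → (clusterGraph Γ S).edgeSet.ncard + 1 ≤ S.card.choose 2 := by
    intro h
    rw [← hnew] at h
    obtain ⟨x, hx, y, hy, hxy⟩ := Finset.one_lt_card.1 h
    rw [Finset.mem_inter] at hx hy
    exact ncard_clusterGraph_lt_choose hx.1 hy.1 hxy (splitGraph_new_new hx.2 hy.2)
  have f2 : 2 ≤ S.card → (clusterGraph Γ S).edgeSet.ncard + 5 ≤ 3 * S.card :=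
    (hind.mono (clusterGraph_le Γ S)).ncard_add_five_le fun i j h => (clusterGraph_adj.1 h).2.1
  have f0 : S.card = k → (clusterGraph Γ S).edgeSet.ncard = 0 := by
    intro h
    have h1 : S ∩ newVertices a b = S := Finset.eq_of_subset_of_card_le Finset.inter_subset_left
      (by rw [h, hnew])
    rw [Set.ncard_eq_zero, Set.eq_empty_iff_forall_notMem]
    intro z hz
    induction z with | _ x y => ?_
    obtain ⟨h2, hx, hy⟩ := clusterGraph_adj.1 hz
    rw [← h1, Finset.mem_inter] at hx hy
    exact splitGraph_new_new hx.2 hy.2 h2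
  have fchoose := ncard_clusterGraph_le_choose Γ S
  rw [hverts] at hcard hrank
  generalize (clusterGraph Γ S).edgeSet.ncard = ε at *
  generalize rank M N.spanningCoe = ρ at *
  generalize S.card = m at *
  -- Below five vertices nucleation-freeness of the split graph says nothing, so the small sizes use
  -- that few pairs exist and that new vertices are nonadjacent.
  obtain h | h | h | h | h | h : m = 0 ∨ m = 1 ∨ m = 2 ∨ m = 3 ∨ m = 4 ∨ 5 ≤ m := by omega
  · subst h; simp at fchoose; omega
  · subst h; simp at fchoose; omega
  · subst h; simp at fchoose fpair; omega
  · subst h; simp [Nat.choose] at fchoose fpair; omega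
  · subst h; simp [Nat.choose] at fchoose fpair; omega
  -- For `k ≤ 2` the slack of seven in the split graph suffices. For `k = 3` and `k = 4` the surplus
  -- 1 and 4 of the ear is absorbed by the collapse bounds `3m - 8` and `3m - 11`.
  · clear fpair fchoose
    omega

end Nucleation

end SplitGlue

theorem corollary3p9 {V W : Type*} [Fintype V] [DecidableEq V] [Fintype W] [DecidableEq W]
    (M : RigidityMatroid) (G : SimpleGraph V) (𝒳 : Finset (Finset V)) (a b : V) (α β : V → Fin 2)
    (H : SimpleGraph W) (𝒴 : Finset (Finset W)) (A : Finset (SplitVertex a b)) (B : Finset W)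
    (φ : A ≃ B)
    (hsafe : IsSafeSplitAndGlue M G 𝒳 a b α β H 𝒴 φ)
    (hear : IsDoubleButterfly H B)
    (hsplit : NucleationFree M (splitGraph G a b α β)) :
    Independent M (glue (splitGraph G a b α β) H φ) ∧
      NucleationFree M (glue (splitGraph G a b α β) H φ) ∧
      ∃ x y, IsImpliedNonedge M (glue (splitGraph G a b α β) H φ) x y := by
  have hs := hsafe.base.safe_split
  have hind : Independent M (glue (splitGraph G a b α β) H φ) :=
    independent_glue_doubleButterfly hsafe.base.indep hsafe.base.ne hs.nonedge
      hsafe.gluing_subset hear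
  exact ⟨hind, nucleationFree_glue_doubleButterfly hsafe.base.indep hsafe.base.ne
    hsafe.gluing_subset hear hsplit, exists_isImpliedNonedge_glue hsafe hind⟩
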